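/- Let $A$ be a finite-dimensional semisimple $\mathbb{Q}$-algebra and let $e_1,\dots,e_m$ be its distinct irreducible central idempotents (nonzero central idempotents that are not the sum of two nonzero orthogonal central idempotents). Let $S$ be an infinite set of prime numbers, let $\mathbb{Z}_S\subseteq\mathbb{Q}$ be the localization of $\mathbb{Z}$ at the nonzero integers not divisible by any prime in $S$, and let $\mathfrak{O}$ be a maximal $\mathbb{Z}_S$-order in $A$. (Then $e_i\in\mathfrak{O}$ for all $i$.) Let $\underline{u}=(u_1,\dots,u_m)\in\mathbb{Q}^m$ with $u_i>0$ for all $i$, and for a finite $\mathfrak{O}$-module $G$ put $|G|^{\underline{u}}:=\prod_{i=1}^m|e_iG|^{u_i}$. Let $X=X(A,\underline{u},\mathfrak{O})$ be the random finite $\mathfrak{O}$-module such that for all finite $\mathfrak{O}$-modules $G_1,G_2$ $$\frac{\mathbb{P}(X\cong G_1)}{\mathbb{P}(X\cong G_2)}=\frac{|G_2|^{\underline{u}}\,|\mathrm{Aut}_{\mathfrak{O}}(G_2)|}{|G_1|^{\underline{u}}\,|\mathrm{Aut}_{\mathfrak{O}}(G_1)|}.$$ Such a random module exists, and $\mathbb{E}\big(|\mathrm{Sur}_{\mathfrak{O}}(X,G)|\big)=1/|G|^{\underline{u}}$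 for every finite $\mathfrak{O}$-module $G$, where $\mathrm{Sur}_{\mathfrak{O}}(X,G)$ is the set of surjective $\mathfrak{O}$-module homomorphisms $X\to G$. If $Y$ is a random variable taking values in finite $\mathfrak{O}$-modules such that $$\mathbb{E}\big(|\mathrm{Sur}_{\mathfrak{O}}(Y,G)|\big)=\frac{1}{|G|^{\underline{u}}}=\mathbb{E}\big(|\mathrm{Sur}_{\mathfrak{O}}(X,G)|\big)$$ for all finite $\mathfrak{O}$-modules $G$, then $$\mathbb{P}(Y\cong G)=\mathbb{P}(X\cong G)$$ for all finite $\mathfrak{O}$-modules $G$. -/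

import Mathlib

open MeasureTheory
open scoped ENNReal nonZeroDivisors

namespace CohenMartinet

universe u

/-- The nonzero integers that are not divisible by any prime in `S`. -/
def denominators (S : Set Nat.Primes) : Submonoid ℤ where
  carrier := {n | n ≠ 0 ∧ ∀ p ∈ S, ¬ (((p : ℕ) : ℤ) ∣ n)}
  one_mem' := by
    refine ⟨one_ne_zero, fun p _ h => ?_⟩
    exact (Nat.prime_iff_prime_int.mp p.2).not_isUnit (isUnit_of_dvd_one h)
  mul_mem' := by
    rintro a b ⟨ha, ha'⟩ ⟨hb, hb'⟩
    refine ⟨mul_ne_zero ha hb, fun p hp h => ?_⟩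
    rcases (Nat.prime_iff_prime_int.mp p.2).dvd_or_dvd h with h | h
    · exact ha' p hp h
    · exact hb' p hp h

theorem denominators_le (S : Set Nat.Primes) : denominators S ≤ ℤ⁰ :=
  fun _ hn => mem_nonZeroDivisors_of_ne_zero hn.1

/-- `ℤ_S`, the localization of `ℤ` at the nonzero integers prime to `S`, as a subring of `ℚ`. -/
noncomputable abbrev ZS (S : Set Nat.Primes) : Subalgebra ℤ ℚ :=
  Localization.subalgebra.ofField ℚ (denominators S) (denominators_le S)

section Orders

variable {A : Type u} [Ring A] [Algebra ℚ A]

/-- A `ℤ_S`-order of `A`: a subring containing `ℤ_S` which is a full `ℤ_S`-lattice of `A`, that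
is, finitely generated as a `ℤ_S`-module and spanning `A` over `ℚ`. -/
def IsOrderOver (S : Set Nat.Primes) (O : Subalgebra (ZS S) A) : Prop :=
  Submodule.IsLattice ℚ (Subalgebra.toSubmodule O)

/-- A maximal `ℤ_S`-order of `A`. -/
def IsMaximalOrder (S : Set Nat.Primes) (O : Subalgebra (ZS S) A) : Prop :=
  Maximal (IsOrderOver S) O

/-- `e` is a central idempotent of `A`. -/
def IsCentralIdempotent (e : A) : Prop :=
  IsIdempotentElem e ∧ e ∈ Set.center A

/-- `e` is an irreducible central idempotent: nonzero, and not the sum of two nonzero orthogonal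
central idempotents. -/
def IsIrreducibleCentralIdempotent (e : A) : Prop :=
  IsCentralIdempotent e ∧ e ≠ 0 ∧
    ∀ f g : A, IsCentralIdempotent f → IsCentralIdempotent g → f * g = 0 → e = f + g →
      f = 0 ∨ g = 0

/-- `e 0, …, e (m - 1)` is the list, without repetition, of all irreducible central idempotents
of `A`. -/
structure IsIdempotentList {m : ℕ} (e : Fin m → A) : Prop where
  injective : Function.Injective e
  mem_range_iff : ∀ x : A, x ∈ Set.range e ↔ IsIrreducibleCentralIdempotent x

/-- Every central idempotent lies in every maximal order. -/
theorem IsMaximalOrder.mem_of_isCentralIdempotent {S : Set Nat.Primes} {O : Subalgebra (ZS S) A}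
    (hO : IsMaximalOrder S O) {e : A} (he : IsCentralIdempotent e) : e ∈ O := by
  obtain ⟨hid, hc⟩ := he
  have hid' : e * e = e := hid
  have hcomm : ∀ x : A, e * x = x * e := fun x => (Set.mem_center_iff.mp hc).comm x
  have hee : ∀ x : A, e * (e * x) = e * x := fun x => by rw [← mul_assoc, hid']
  have hxe : ∀ x y : A, x * (e * y) = e * (x * y) := fun x y => by
    rw [← mul_assoc, ← hcomm, mul_assoc]
  -- the order `e O + (1 - e) O`
  let M : Submodule (ZS S) A :=
    (Subalgebra.toSubmodule O).map (LinearMap.mulLeft (ZS S) e) ⊔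
      (Subalgebra.toSubmodule O).map (LinearMap.mulLeft (ZS S) (1 - e))
  have hM : ∀ x : A, x ∈ M ↔ ∃ a ∈ O, ∃ b ∈ O, x = e * a + (1 - e) * b := by
    intro x
    simp only [M, Submodule.mem_sup, Submodule.mem_map, Subalgebra.mem_toSubmodule,
      LinearMap.mulLeft_apply]
    constructor
    · rintro ⟨_, ⟨a, ha, rfl⟩, _, ⟨b, hb, rfl⟩, rfl⟩
      exact ⟨a, ha, b, hb, rfl⟩
    · rintro ⟨a, ha, b, hb, rfl⟩
      exact ⟨_, ⟨a, ha, rfl⟩, _, ⟨b, hb, rfl⟩, rfl⟩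
  have hle : ∀ x ∈ O, x ∈ M := fun x hx => (hM x).2 ⟨x, hx, x, hx, by noncomm_ring⟩
  let O' : Subalgebra (ZS S) A := Submodule.toSubalgebra M (hle 1 O.one_mem) (by
    intro x y hx hy
    obtain ⟨a, ha, b, hb, rfl⟩ := (hM x).1 hx
    obtain ⟨c, hc, d, hd, rfl⟩ := (hM y).1 hy
    refine (hM _).2 ⟨a * c, O.mul_mem ha hc, b * d, O.mul_mem hb hd, ?_⟩
    simp only [sub_mul, mul_add, add_mul, mul_sub, one_mul, mul_assoc, hxe, hee]
    abel)
  have hOO' : O ≤ O' := hle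
  have hO' : IsOrderOver S O' := by
    have hl : Submodule.IsLattice ℚ (Subalgebra.toSubmodule O) := hO.prop
    have : Subalgebra.toSubmodule O' = M := Submodule.toSubalgebra_toSubmodule M _ _
    refine ⟨?_, ?_⟩
    · rw [this]
      exact (hl.fg.map _).sup (hl.fg.map _)
    · refine top_le_iff.mp (hl.span_eq_top.symm.le.trans (Submodule.span_mono ?_))
      exact hle
  have h : e ∈ O' := (hM e).2 ⟨1, O.one_mem, 0, O.zero_mem, by simp⟩
  exact hO.le_of_ge hO' hOO' h

end Orders

/-- A finite left module over `R`. -/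
structure FiniteModule (R : Type u) [Ring R] where
  /-- The underlying finite set. -/
  carrier : Type
  [addCommGroup : AddCommGroup carrier]
  [module : Module R carrier]
  [finite : Finite carrier]

namespace FiniteModule

instance (R : Type u) [Ring R] : CoeSort (FiniteModule R) Type := ⟨FiniteModule.carrier⟩

attribute [instance] FiniteModule.addCommGroup FiniteModule.module FiniteModule.finite

end FiniteModule

section Counting

variable {R : Type u} [Ring R]

/-- `G` and `H` are isomorphic `R`-modules. -/
def Iso (G H : FiniteModule R) : Prop := Nonempty (G ≃ₗ[R] H)

/-- `|Sur_R(G, H)|`. -/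
noncomputable def surCount (G H : FiniteModule R) : ℕ :=
  Nat.card {f : G →ₗ[R] H // Function.Surjective f}

/-- `|Aut_R(G)|`. -/
noncomputable def autCount (G : FiniteModule R) : ℕ := Nat.card (G ≃ₗ[R] G)

/-- The set `a G = {a • g | g ∈ G}`. -/
def component (a : R) (G : FiniteModule R) : Set G := Set.range fun g : G => a • g

end Counting

section Probability

variable {R : Type u} [Ring R] {Ω : Type*} [MeasurableSpace Ω]

/-- `X` is a random variable with values in finite `R`-modules: the events `X ≅ G` are
measurable. -/
def IsRandomModule (X : Ω → FiniteModule R) : Prop :=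
  ∀ G : FiniteModule R, MeasurableSet {ω | Iso (X ω) G}

/-- The probability that `X ≅ G`. -/
noncomputable def probIso (P : Measure Ω) (X : Ω → FiniteModule R) (G : FiniteModule R) : ℝ :=
  P.real {ω | Iso (X ω) G}

/-- The `G`-moment `𝔼 |Sur_R(X, G)|`. -/
noncomputable def surMoment (P : Measure Ω) (X : Ω → FiniteModule R) (G : FiniteModule R) : ℝ≥0∞ :=
  ∫⁻ ω, (surCount (X ω) G : ℝ≥0∞) ∂P

end Probability

section Distribution

variable {A : Type u} [Ring A] [Algebra ℚ A] {S : Set Nat.Primes} {O : Subalgebra (ZS S) A}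

/-- The irreducible central idempotent `e i`, as an element of the maximal order `O`. -/
def idem (hO : IsMaximalOrder S O) {m : ℕ} {e : Fin m → A} (he : IsIdempotentList e)
    (i : Fin m) : O :=
  ⟨e i, hO.mem_of_isCentralIdempotent ((he.mem_range_iff (e i)).1 ⟨i, rfl⟩).1⟩

/-- `|G|^u = ∏ i, |e i G| ^ (u i)`. -/
noncomputable def cardPow (hO : IsMaximalOrder S O) {m : ℕ} {e : Fin m → A}
    (he : IsIdempotentList e) (u : Fin m → ℚ) (G : FiniteModule O) : ℝ :=
  ∏ i, (Nat.card (component (idem hO he i) G) : ℝ) ^ (u i : ℝ)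

/-- `X`, on the probability space `(Ω, P)`, is a random module `X(A, u, O)`: the probabilities of
`G₁` and `G₂` are inversely proportional to `|G₁|^u |Aut G₁|` and `|G₂|^u |Aut G₂|`. The right
side is positive, so that the equation forces all `probIso P X G` to be nonzero. -/
def IsCohenMartinetModule (hO : IsMaximalOrder S O) {m : ℕ} {e : Fin m → A}
    (he : IsIdempotentList e) (u : Fin m → ℚ) {Ω : Type*} [MeasurableSpace Ω] (P : Measure Ω)
    (X : Ω → FiniteModule O) : Prop :=
  IsProbabilityMeasure P ∧ IsRandomModule X ∧
    ∀ G₁ G₂ : FiniteModule O,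
      probIso P X G₁ / probIso P X G₂ =
        (cardPow hO he u G₂ * autCount G₂) / (cardPow hO he u G₁ * autCount G₁)

end Distribution

end CohenMartinet

/-! Put `c G = 1 / |G|^u`. Each `|e_i G|` is multiplicative in short exact sequences, hence so is
`c`. Give the class of `G` the mass `c G / |Aut G|`; the random module `X` exists because the total
mass is finite.

The algebraic heart is `IsDedekindLike.tsum_seqCount_div_autCount_eq_one`: for finite `K` and `G`,
the numbers of sequences `0 → K → E → G → 0`, each divided by `|Aut E|`, add up to 1 over all `E`.
Equivalently `|Ext¹(G, K)| = |Hom(G, K)|`. This holds because a finite-index submodule of a finitely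
generated projective module has as many homomorphisms to `K` as the whole module
(`IsDedekindLike.card_hom_ker_eq`), which rests on the ideal theory of maximal orders: the
annihilators `P` of finite simple modules are invertible (`one_mem_inverse_mul`), hence projective,
and distinct ones satisfy `P ∩ Q = P Q`.

Moments: sort the surjections `H → G` by their kernel `K`, write `c H = c K * c G` and exchange the
sums. The sum over `H` is the mass-one formula, and `c G` times the total mass remains. The same
computation on finite sets of classes closed under submodules bounds the total mass: a nonzero
module surjects onto some simple `L`, and the masses of the simple modules are summable, since `c`
decays like a power of the order, `|Aut L| ≥ p - 1`, and boundedly many `L` belong to each residue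
characteristic `p`.

Uniqueness: for a finite set `T` of simple modules, count only the surjections to `G` whose kernel
has no nonzero homomorphism to a member of `T`. For `T = ∅` these moments are given; as `T` grows
they tend to `|Aut G|` times the probability of `G`. From `T` to `T ∪ {L}` one uses
inclusion-exclusion over surjections of the kernel to `L^j`. Such a pair of surjections is the same
as a surjection with `T`-free kernel onto an extension of `G` by `L^j`, so every term is a
combination of moments for `T`. By the mass-one formula the truncation error is at most `c G / 2 ^
J`, so the moments for `T ∪ {L}` are determined (`freeMoment_insert_eq`). -/

namespace CohenMartinet

universe u v w

/-! ### Finite simple modules and their annihilators -/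

section SimpleModules

variable {R : Type*} [Ring R]

/-- A simple module killed by the annihilator of a finite simple module is isomorphic to it. -/
theorem nonempty_linearEquiv_of_annihilator_le {K K' : Type*} [AddCommGroup K] [Module R K]
    [AddCommGroup K'] [Module R K'] [Finite K] [IsSimpleModule R K] [IsSimpleModule R K']
    (h : Module.annihilator R K ≤ Module.annihilator R K') : Nonempty (K ≃ₗ[R] K') := by
  classical
  -- The kernel of `j` is the annihilator of `K`, so the quotient by it embeds in a finite power of
  -- `K`, which is semisimple. The nonzero map to `K'` given by `y` therefore extends to this power
  -- and is nonzero on one of its factors.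
  let j : R →ₗ[R] (K → K) := LinearMap.pi fun x => LinearMap.toSpanSingleton R K x
  have := IsSimpleModule.nontrivial R K'
  obtain ⟨y, hy⟩ := exists_ne (0 : K')
  let g := LinearMap.toSpanSingleton R K' y
  have hker : LinearMap.ker j ≤ LinearMap.ker g := by
    intro r hr
    have : r ∈ Module.annihilator R K := by
      rw [Module.mem_annihilator]
      intro x
      exact congrFun (LinearMap.mem_ker.1 hr) x
    exact LinearMap.mem_ker.2 (Module.mem_annihilator.1 (h this) y)
  let g' : (R ⧸ LinearMap.ker j) →ₗ[R] K' := (LinearMap.ker j).liftQ g hker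
  let j' : (R ⧸ LinearMap.ker j) →ₗ[R] (K → K) := (LinearMap.ker j).liftQ j le_rfl
  have hj' : Function.Injective j' := by
    rw [← LinearMap.ker_eq_bot]
    exact Submodule.ker_liftQ_eq_bot _ _ _ le_rfl
  obtain ⟨F, hF⟩ := IsSemisimpleModule.extension_property j' hj' g'
  have hFne : F ≠ 0 := by
    rintro rfl
    have : g' (Submodule.Quotient.mk 1) = 0 := by rw [← hF]; rfl
    exact hy (by simpa [g', g] using this)
  obtain ⟨x, hx⟩ : ∃ x, F.comp (LinearMap.single R (fun _ : K => K) x) ≠ 0 := by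
    by_contra! hcon
    exact hFne (LinearMap.pi_ext' (by simpa using hcon))
  exact ⟨LinearEquiv.ofBijective _ (LinearMap.bijective_of_ne_zero hx)⟩

theorem eq_zero_of_not_linearEquiv {K K' : Type*} [AddCommGroup K] [Module R K]
    [AddCommGroup K'] [Module R K'] [IsSimpleModule R K] [IsSimpleModule R K']
    (h : ¬ Nonempty (K ≃ₗ[R] K')) (f : K →ₗ[R] K') : f = 0 := by
  by_contra hf
  exact h ⟨LinearEquiv.ofBijective _ (LinearMap.bijective_of_ne_zero hf)⟩

/-- The annihilator of a finite simple module is maximal among the proper two-sided ideals. -/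
theorem eq_annihilator_of_le {K : Type*} [AddCommGroup K] [Module R K] [Finite K]
    [IsSimpleModule R K] {J : Ideal R} [J.IsTwoSided] (h : Module.annihilator R K ≤ J)
    (hJ : J ≠ ⊤) : J = Module.annihilator R K := by
  -- Being two-sided, `J` annihilates all of `R ⧸ I`. So `R ⧸ I` is a simple module killed by the
  -- annihilator of `K`, hence isomorphic to `K`.
  obtain ⟨I, hI, hJI⟩ := Ideal.exists_le_maximal J hJ
  have : IsSimpleModule R (R ⧸ I) := isSimpleModule_iff_isCoatom.2 hI.out
  have hJK : J ≤ Module.annihilator R (R ⧸ I) := by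
    intro a ha
    rw [Module.mem_annihilator]
    intro m
    obtain ⟨r, rfl⟩ := Submodule.Quotient.mk_surjective _ m
    rw [← Submodule.Quotient.mk_smul, Submodule.Quotient.mk_eq_zero]
    exact hJI (J.mul_mem_right _ ha)
  obtain ⟨e⟩ := nonempty_linearEquiv_of_annihilator_le (h.trans hJK)
  exact le_antisymm (hJK.trans e.annihilator_eq.ge) h

/-- The annihilator of a simple module is a prime ideal. -/
theorem mem_annihilator_or_of_forall_mul_mul_mem {K : Type*} [AddCommGroup K] [Module R K]
    [IsSimpleModule R K] {a b : R} (h : ∀ r, a * r * b ∈ Module.annihilator R K) :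
    a ∈ Module.annihilator R K ∨ b ∈ Module.annihilator R K := by
  by_contra! hcon
  obtain ⟨ha, hb⟩ := hcon
  simp only [Module.mem_annihilator, not_forall] at ha hb h
  obtain ⟨y, hy⟩ := ha
  obtain ⟨x, hx⟩ := hb
  obtain ⟨r, hr⟩ := IsSimpleModule.toSpanSingleton_surjective R hx y
  apply hy
  rw [← hr, LinearMap.toSpanSingleton_apply, smul_smul, smul_smul, h r x]

/-- The annihilators of the finite simple modules. -/
def IsFinitePrimitive (P : Ideal R) : Prop :=
  ∃ I : Ideal R, I.IsMaximal ∧ Finite (R ⧸ I) ∧ P = Module.annihilator R (R ⧸ I)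

/-- `IsFinitePrimitive` refers to quotients of `R` in order to be independent of universes; this
makes it available for simple modules of any universe. -/
theorem isFinitePrimitive_annihilator (K : Type*) [AddCommGroup K] [Module R K] [Finite K]
    [IsSimpleModule R K] : IsFinitePrimitive (Module.annihilator R K) := by
  obtain ⟨I, hI, ⟨e⟩⟩ := isSimpleModule_iff_quot_maximal.1 ‹IsSimpleModule R K›
  exact ⟨I, hI, Finite.of_equiv _ e.toEquiv, e.annihilator_eq⟩

theorem IsFinitePrimitive.isTwoSided {P : Ideal R} (hP : IsFinitePrimitive P) : P.IsTwoSided := by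
  obtain ⟨I, -, -, rfl⟩ := hP
  infer_instance

theorem IsFinitePrimitive.ne_top {P : Ideal R} (hP : IsFinitePrimitive P) : P ≠ ⊤ := by
  obtain ⟨I, hI, -, rfl⟩ := hP
  have : IsSimpleModule R (R ⧸ I) := isSimpleModule_iff_isCoatom.2 hI.out
  have := IsSimpleModule.nontrivial R (R ⧸ I)
  rw [Ne, Ideal.eq_top_iff_one, Module.mem_annihilator]
  obtain ⟨y, hy⟩ := exists_ne (0 : R ⧸ I)
  exact fun h => hy (by simpa using h y)

theorem IsFinitePrimitive.eq_of_le {P J : Ideal R} (hP : IsFinitePrimitive P) [J.IsTwoSided]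
    (h : P ≤ J) (hJ : J ≠ ⊤) : J = P := by
  obtain ⟨I, hI, _, rfl⟩ := hP
  have : IsSimpleModule R (R ⧸ I) := isSimpleModule_iff_isCoatom.2 hI.out
  exact eq_annihilator_of_le h hJ

theorem IsFinitePrimitive.mem_or_mem {P : Ideal R} (hP : IsFinitePrimitive P) {a b : R}
    (h : ∀ r, a * r * b ∈ P) : a ∈ P ∨ b ∈ P := by
  obtain ⟨I, hI, _, rfl⟩ := hP
  have : IsSimpleModule R (R ⧸ I) := isSimpleModule_iff_isCoatom.2 hI.out
  exact mem_annihilator_or_of_forall_mul_mul_mem h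

theorem exists_simple_submodule_of_finite (M : Type*) [AddCommGroup M] [Module R M] [Finite M]
    [Nontrivial M] : ∃ m : Submodule R M, IsSimpleModule R m := by
  obtain ⟨m, hm⟩ := IsAtomic.exists_atom (Submodule R M)
  exact ⟨m, isSimpleModule_iff_isAtom.2 hm⟩

theorem exists_simple_quotient_of_finite (M : Type*) [AddCommGroup M] [Module R M] [Finite M]
    [Nontrivial M] : ∃ m : Submodule R M, IsSimpleModule R (M ⧸ m) := by
  obtain ⟨m, hm⟩ := IsCoatomic.exists_coatom (Submodule R M)
  exact ⟨m, isSimpleModule_iff_isCoatom.2 hm⟩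

/-- A left ideal of finite index contains a product of annihilators of finite simple modules. -/
theorem exists_list_isFinitePrimitive (n : ℕ) :
    ∀ X : Ideal R, Finite (R ⧸ X) → Nat.card (R ⧸ X) = n →
      ∃ l : List (Ideal R), (∀ P ∈ l, IsFinitePrimitive P) ∧ l.foldr (· * ·) ⊤ ≤ X := by
  induction n using Nat.strong_induction_on with
  | _ n ih =>
    intro X hX hn
    by_cases hT : X = ⊤
    · exact ⟨[], by simp, by simp [hT]⟩
    have : Nontrivial (R ⧸ X) := Submodule.Quotient.nontrivial_iff.2 hT
    obtain ⟨m, hm⟩ := exists_simple_submodule_of_finite (R := R) (R ⧸ X)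
    have := IsSimpleModule.nontrivial R m
    -- The preimage `X'` of the simple submodule `m` has smaller index than `X`, and the annihilator
    -- of `m` multiplies `X'` into `X`.
    let X' : Ideal R := m.comap X.mkQ
    have e : ((R ⧸ X) ⧸ m) ≃ₗ[R] (R ⧸ X') := by
      refine (Submodule.quotEquivOfEq _ _ ?_).trans
        (Submodule.quotientQuotientEquivQuotient X X' ?_)
      · exact (Submodule.map_comap_eq_of_surjective (Submodule.mkQ_surjective X) m).symm
      · exact (Submodule.ker_mkQ X).symm.le.trans (LinearMap.ker_le_comap _)
    have : Finite ((R ⧸ X) ⧸ m) := Finite.of_surjective _ (Submodule.mkQ_surjective m)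
    have hfin : Finite (R ⧸ X') := Finite.of_equiv _ e.toEquiv
    have hcard : Nat.card (R ⧸ X') < n := by
      rw [← hn, Submodule.card_eq_card_quotient_mul_card m, Nat.card_congr e.toEquiv]
      have h1 : 1 < Nat.card m := Finite.one_lt_card
      have h2 : 0 < Nat.card (R ⧸ X') := Nat.card_pos
      nlinarith
    obtain ⟨l, hl, hl'⟩ := ih _ hcard X' hfin rfl
    refine ⟨Module.annihilator R m :: l, ?_, ?_⟩
    · simp only [List.mem_cons, forall_eq_or_imp]
      exact ⟨isFinitePrimitive_annihilator m, hl⟩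
    · rw [List.foldr_cons, Ideal.mul_le]
      intro p hp x hx
      have hx' : X.mkQ x ∈ m := hl' hx
      have := congrArg Subtype.val (Module.mem_annihilator.1 hp ⟨_, hx'⟩)
      rw [← Submodule.Quotient.mk_eq_zero X]
      exact this

end SimpleModules

/-! ### Residues of `ℤ_S` modulo integers -/

section ResidueRing

variable (S : Set Nat.Primes)

instance : IsNoetherianRing (ZS S) :=
  IsLocalization.isNoetherianRing (denominators S) (ZS S) inferInstance

/-- Every residue class of `ℤ_S` modulo `n` is represented by a natural number less than `n`. -/
theorem exists_residue {n : ℕ} (hn : n ≠ 0) (z : ZS S) :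
    ∃ i : Fin n, ∃ z' : ZS S, z = ((i : ℕ) : ZS S) + (n : ZS S) * z' := by
  have : NeZero n := ⟨hn⟩
  obtain ⟨⟨a, b⟩, hab⟩ := IsLocalization.surj (denominators S) z
  have hu := IsLocalization.map_units (ZS S) b
  obtain ⟨v, hv⟩ := hu
  simp only [algebraMap_int_eq, eq_intCast] at hab hv
  -- The denominator `b` need not be prime to `n`. But two powers of `b` agree modulo `n`, and
  -- dividing `b ^ (i + m + 1) - b ^ i = n * c` by the unit `b ^ (i + 1)` of `ℤ_S` shows that `b⁻¹`
  -- is congruent to the integer `b ^ m`.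
  obtain ⟨i, j, hij, hpow⟩ := Finite.exists_ne_map_eq_of_infinite
    (fun i : ℕ => ((b : ℤ) : ZMod n) ^ i)
  wlog hlt : i < j generalizing i j
  · exact this j i hij.symm hpow.symm (lt_of_le_of_ne (not_lt.1 hlt) hij.symm)
  obtain ⟨m, rfl⟩ := Nat.exists_eq_add_of_lt hlt
  have hdvd : (n : ℤ) ∣ (b : ℤ) ^ (i + m + 1) - (b : ℤ) ^ i := by
    rw [← ZMod.intCast_zmod_eq_zero_iff_dvd]
    push_cast
    exact sub_eq_zero.2 hpow.symm
  obtain ⟨c, hc⟩ := hdvd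
  have hc' : (((b : ℤ) : ZS S)) ^ (i + m + 1) - (((b : ℤ) : ZS S)) ^ i = (n : ZS S) * (c : ZS S) := by
    exact_mod_cast congrArg (fun t : ℤ => (t : ZS S)) hc
  have key : z = ((a * (b : ℤ) ^ m : ℤ) : ZS S)
      + n * (-(c * a * ((v⁻¹ : (ZS S)ˣ) : ZS S) ^ (i + 1))) := by
    have h1 : z = a * ((v⁻¹ : (ZS S)ˣ) : ZS S) := by
      rw [← hab, ← hv, Units.mul_inv_cancel_right]
    have h2 : (v : ZS S) * ((v⁻¹ : (ZS S)ˣ) : ZS S) = 1 := Units.mul_inv v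
    rw [h1]
    push_cast
    rw [← hv] at hc' ⊢
    have h3 : (v : ZS S) ^ i * ((v⁻¹ : (ZS S)ˣ) : ZS S) ^ i = 1 := by rw [← mul_pow, h2, one_pow]
    set w := ((v⁻¹ : (ZS S)ˣ) : ZS S)
    set y := (v : ZS S)
    have h4 : (n : ZS S) * (c : ZS S) * w ^ (i + 1) = y ^ m - w := by
      rw [← hc']
      calc (y ^ (i + m + 1) - y ^ i) * w ^ (i + 1)
          = (y ^ i * w ^ i) * (y ^ m * (y * w)) - (y ^ i * w ^ i) * w := by ring
        _ = y ^ m - w := by rw [h3, h2]; ring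
    linear_combination (a : ZS S) * h4
  set t : ℤ := a * (b : ℤ) ^ m
  have hpos : (0 : ℤ) < n := by positivity
  refine ⟨⟨(t % n).toNat, ?_⟩, ((t / n : ℤ) : ZS S) + -(c * a * ((v⁻¹ : (ZS S)ˣ) : ZS S) ^ (i + 1)), ?_⟩
  · have := Int.emod_lt_of_pos t hpos
    have := Int.emod_nonneg t hpos.ne'
    omega
  · have h0 : (((t % n).toNat : ℕ) : ℤ) = t % n := Int.toNat_of_nonneg (Int.emod_nonneg t hpos.ne')
    have h5 : (t : ZS S) = (((t % n).toNat : ℕ) : ZS S) + (n : ZS S) * ((t / n : ℤ) : ZS S) := by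
      have := congrArg (fun t : ℤ => (t : ZS S)) (Int.emod_add_mul_ediv t n)
      rw [← h0] at this
      exact_mod_cast this.symm
    rw [key, h5]
    ring

end ResidueRing

/-! ### Finiteness and maximality of orders -/

section OrderTheory

variable {A : Type u} [Ring A] [Algebra ℚ A] {S : Set Nat.Primes} {O : Subalgebra (ZS S) A}

/-- The quotients `O / nO` of an order have at most polynomially many elements. -/
theorem IsOrderOver.exists_card_quotient_le (hO : IsOrderOver S O) :
    ∃ g : ℕ, ∀ n : ℕ, n ≠ 0 → Finite (O ⧸ Ideal.span {(n : O)}) ∧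
      Nat.card (O ⧸ Ideal.span {(n : O)}) ≤ n ^ g := by
  have hfg : Module.Finite (ZS S) O := Module.Finite.iff_fg.2 hO.fg
  obtain ⟨g, f, hf⟩ := Module.Finite.exists_fin' (ZS S) O
  refine ⟨g, fun n hn => ?_⟩
  let q : (Fin g → Fin n) → O ⧸ Ideal.span {(n : O)} :=
    fun c => Submodule.Quotient.mk (f fun j => ((c j : ℕ) : ZS S))
  have hq : Function.Surjective q := by
    intro x
    obtain ⟨x, rfl⟩ := Submodule.Quotient.mk_surjective _ x
    obtain ⟨z, rfl⟩ := hf x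
    choose c z' hz using fun j => exists_residue S hn (z j)
    refine ⟨c, ?_⟩
    rw [Submodule.Quotient.eq, ← map_sub]
    have : (fun j => ((c j : ℕ) : ZS S)) - z = (n : ZS S) • (-z') := by
      ext j
      simp [hz j]
    rw [this, map_smul, Ideal.mem_span_singleton']
    refine ⟨f (-z'), ?_⟩
    rw [Algebra.smul_def, map_natCast, Nat.cast_comm]
  have := Finite.of_surjective q hq
  refine ⟨this, (Nat.card_le_card_of_surjective q hq).trans ?_⟩
  simp

theorem IsOrderOver.isNoetherianRing (hO : IsOrderOver S O) : IsNoetherianRing O := by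
  have hfg : Module.Finite (ZS S) O := Module.Finite.iff_fg.2 hO.fg
  have : IsNoetherian (ZS S) O := inferInstance
  exact isNoetherian_of_tower (ZS S) this

theorem natCast_mul_eq_zero_iff_of_order {n : ℕ} (hn : n ≠ 0) (x : O) : (n : O) * x = 0 ↔ x = 0 := by
  refine ⟨fun h => ?_, fun h => by rw [h, mul_zero]⟩
  have h1 : (n : A) * (x : A) = 0 := by simpa using congrArg Subtype.val h
  have h2 : (n : ℚ) • (x : A) = 0 := by rw [Algebra.smul_def, map_natCast, h1]
  have h3 : (x : A) = 0 := by
    have := congrArg (fun y => (n : ℚ)⁻¹ • y) h2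
    simpa [smul_smul, hn] using this
  exact Subtype.ext h3

/-- An order containing a maximal order `O` with bounded denominators is equal to `O`. -/
theorem IsMaximalOrder.mem_of_natCast_mul_mem (hO : IsMaximalOrder S O) {O' : Subalgebra (ZS S) A}
    (h : O ≤ O') {n : ℕ} (hn : n ≠ 0) (hO' : ∀ x ∈ O', (n : A) * x ∈ O) {x : A} (hx : x ∈ O') :
    x ∈ O := by
  have hl : Submodule.IsLattice ℚ (Subalgebra.toSubmodule O) := hO.prop
  refine hO.le_of_ge (y := O') ⟨?_, ?_⟩ h hx
  · let N := (Subalgebra.toSubmodule O).map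
      (LinearMap.mulLeft (ZS S) (algebraMap ℚ A ((n : ℚ)⁻¹)))
    have hN : N.FG := hl.fg.map _
    have : IsNoetherian (ZS S) N := isNoetherian_of_fg_of_noetherian N hN
    refine Submodule.FG.of_le hN ?_
    intro y hy
    refine Submodule.mem_map.2 ⟨n * y, hO' y hy, ?_⟩
    rw [LinearMap.mulLeft_apply, ← mul_assoc, ← map_natCast (algebraMap ℚ A), ← map_mul,
      inv_mul_cancel₀ (by exact_mod_cast hn), map_one, one_mul]
  · exact top_le_iff.mp (hl.span_eq_top.symm.le.trans (Submodule.span_mono h))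

/-- The left order of a submodule of `A`. -/
def leftOrder (X : Submodule (ZS S) A) : Subalgebra (ZS S) A where
  carrier := {x | ∀ y ∈ X, x * y ∈ X}
  mul_mem' ha hb y hy := by rw [mul_assoc]; exact ha _ (hb y hy)
  add_mem' ha hb y hy := by rw [add_mul]; exact X.add_mem (ha y hy) (hb y hy)
  algebraMap_mem' r _ hy := by rw [← Algebra.smul_def]; exact X.smul_mem r hy

/-- The right order of a submodule of `A`. -/
def rightOrder (X : Submodule (ZS S) A) : Subalgebra (ZS S) A where
  carrier := {x | ∀ y ∈ X, y * x ∈ X}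
  mul_mem' ha hb y hy := by rw [← mul_assoc]; exact hb _ (ha y hy)
  add_mem' ha hb y hy := by rw [mul_add]; exact X.add_mem (ha y hy) (hb y hy)
  algebraMap_mem' r _ hy := by
    rw [← Algebra.commutes, ← Algebra.smul_def]; exact X.smul_mem r hy

/-- The left order of `X` contains `O`, and the factor `n ∈ X` carries it into `X ⊆ O`; so
maximality makes it equal to `O`. The next lemma is the mirror image with right orders. -/
theorem IsMaximalOrder.mem_of_forall_mul_mem (hO : IsMaximalOrder S O) {X : Submodule (ZS S) A}
    (hX : X ≤ Subalgebra.toSubmodule O) (hOX : ∀ x ∈ O, ∀ y ∈ X, x * y ∈ X) {n : ℕ} (hn : n ≠ 0)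
    (hnX : (n : A) ∈ X) {x : A} (hx : ∀ y ∈ X, x * y ∈ X) : x ∈ O :=
  hO.mem_of_natCast_mul_mem (O' := leftOrder X) hOX hn
    (fun y hy => hX (by rw [Nat.cast_comm]; exact hy _ hnX)) hx

theorem IsMaximalOrder.mem_of_forall_mul_mem' (hO : IsMaximalOrder S O) {X : Submodule (ZS S) A}
    (hX : X ≤ Subalgebra.toSubmodule O) (hOX : ∀ x ∈ O, ∀ y ∈ X, y * x ∈ X) {n : ℕ} (hn : n ≠ 0)
    (hnX : (n : A) ∈ X) {x : A} (hx : ∀ y ∈ X, y * x ∈ X) : x ∈ O :=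
  hO.mem_of_natCast_mul_mem (O' := rightOrder X) hOX hn (fun _ hy => hX (hy _ hnX)) hx

end OrderTheory

/-! ### Invertibility of the finite primitive ideals of a maximal order -/

section Invertibility

variable {A : Type u} [Ring A] [Algebra ℚ A] {S : Set Nat.Primes} {O : Subalgebra (ZS S) A}

/-- An ideal of `O` as a submodule of `A`. -/
noncomputable def toSub (P : Ideal O) : Submodule (ZS S) A :=
  (P.restrictScalars (ZS S)).map O.val.toLinearMap

theorem mem_toSub {P : Ideal O} {x : A} : x ∈ toSub P ↔ ∃ y ∈ P, (y : A) = x := Iff.rfl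

theorem coe_mem_toSub {P : Ideal O} {x : O} : (x : A) ∈ toSub P ↔ x ∈ P := by
  rw [mem_toSub]
  exact ⟨fun ⟨y, hy, h⟩ => Subtype.ext h ▸ hy, fun h => ⟨x, h, rfl⟩⟩

theorem toSub_le (P : Ideal O) : toSub P ≤ Subalgebra.toSubmodule O := by
  rintro _ ⟨y, -, rfl⟩
  exact y.2

theorem toSub_mono {P Q : Ideal O} (h : P ≤ Q) : toSub P ≤ toSub Q := by
  rintro _ ⟨y, hy, rfl⟩
  exact ⟨y, h hy, rfl⟩

theorem mul_mem_toSub {P : Ideal O} {x y : A} (hx : x ∈ O) (hy : y ∈ toSub P) :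
    x * y ∈ toSub P := by
  obtain ⟨y, hy, rfl⟩ := hy
  exact ⟨⟨x, hx⟩ * y, P.mul_mem_left _ hy, rfl⟩

theorem mul_mem_toSub' {P : Ideal O} [P.IsTwoSided] {x y : A} (hx : x ∈ O) (hy : y ∈ toSub P) :
    y * x ∈ toSub P := by
  obtain ⟨y, hy, rfl⟩ := hy
  exact ⟨y * ⟨x, hx⟩, P.mul_mem_right _ hy, rfl⟩

/-- For the empty list the left side is `ℤ_S · 1` and the right side all of `O`, which is why only
an inclusion is claimed. -/
theorem prod_map_toSub_le (l : List (Ideal O)) :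
    (l.map toSub).prod ≤ toSub (l.foldr (fun P J : Ideal O => P * J) ⊤) := by
  induction l with
  | nil =>
    rw [List.map_nil, List.prod_nil, Submodule.one_le]
    exact ⟨1, Submodule.mem_top, rfl⟩
  | cons P l ih =>
    rw [List.map_cons, List.prod_cons, List.foldr_cons, Submodule.mul_le]
    intro x hx y hy
    obtain ⟨x, hx, rfl⟩ := hx
    obtain ⟨y, hy', rfl⟩ := ih hy
    exact ⟨x * y, Ideal.mul_mem_mul hx hy', rfl⟩

theorem prod_map_toSub_le_order (l : List (Ideal O)) :
    (l.map toSub).prod ≤ Subalgebra.toSubmodule O :=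
  (prod_map_toSub_le l).trans (toSub_le _)

theorem IsFinitePrimitive.exists_natCast_mem {R : Type*} [Ring R] {P : Ideal R}
    (hP : IsFinitePrimitive P) : ∃ n : ℕ, n ≠ 0 ∧ (n : R) ∈ P := by
  obtain ⟨I, -, _, rfl⟩ := hP
  refine ⟨Nat.card (R ⧸ I), Nat.card_pos.ne', ?_⟩
  rw [Module.mem_annihilator]
  intro m
  rw [Nat.cast_smul_eq_nsmul, card_nsmul_eq_zero']

theorem exists_natCast_mem_prod (l : List (Ideal O)) (hl : ∀ P ∈ l, IsFinitePrimitive P) :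
    ∃ n : ℕ, n ≠ 0 ∧ (n : A) ∈ (l.map toSub).prod := by
  induction l with
  | nil => exact ⟨1, one_ne_zero, by
    rw [Nat.cast_one]; exact Submodule.one_le.1 le_rfl⟩
  | cons P l ih =>
    simp only [List.mem_cons, forall_eq_or_imp] at hl
    obtain ⟨n, hn, hn'⟩ := ih hl.2
    obtain ⟨k, hk, hk'⟩ := hl.1.exists_natCast_mem
    refine ⟨k * n, mul_ne_zero hk hn, ?_⟩
    rw [List.map_cons, List.prod_cons, Nat.cast_mul]
    exact Submodule.mul_mem_mul ⟨_, hk', by simp⟩ hn'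

/-- A finite primitive ideal that contains a product of finite primitive ideals is one of them. -/
theorem IsFinitePrimitive.mem_of_prod_le {P : Ideal O} (hP : IsFinitePrimitive P)
    (l : List (Ideal O)) (hl : ∀ Q ∈ l, IsFinitePrimitive Q)
    (h : (l.map toSub).prod ≤ toSub P) : P ∈ l := by
  induction l with
  | nil =>
    rw [List.map_nil, List.prod_nil, Submodule.one_le] at h
    exact absurd (coe_mem_toSub (x := (1 : O)).1 h) ((Ideal.ne_top_iff_one P).1 hP.ne_top)
  | cons Q l ih =>
    simp only [List.mem_cons, forall_eq_or_imp] at hl ⊢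
    by_cases hQP : Q ≤ P
    · have := hP.isTwoSided
      exact Or.inl (hl.1.eq_of_le hQP hP.ne_top)
    · right
      refine ih hl.2 fun y hy => ?_
      obtain ⟨q, hq, hqP⟩ := Set.not_subset.1 hQP
      have hyO : y ∈ O := prod_map_toSub_le_order l hy
      have := hl.1.isTwoSided
      have hP' : ∀ r : O, q * r * ⟨y, hyO⟩ ∈ P := fun r => by
        rw [← coe_mem_toSub]
        exact h (by
          rw [List.map_cons, List.prod_cons]
          exact Submodule.mul_mem_mul (coe_mem_toSub.2 (Q.mul_mem_right r hq)) hy)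
      exact coe_mem_toSub.2 ((hP.mem_or_mem hP').resolve_left hqP)

/-- The inverse `{x | P x ⊆ O}` of an ideal of `O`. -/
def inverse (P : Ideal O) : Submodule (ZS S) A where
  carrier := {x | ∀ y ∈ P, (y : A) * x ∈ O}
  add_mem' ha hb y hy := by rw [mul_add]; exact O.add_mem (ha y hy) (hb y hy)
  zero_mem' y _ := by rw [mul_zero]; exact O.zero_mem
  smul_mem' r x hx y hy := by rw [mul_smul_comm]; exact O.smul_mem (hx y hy) r

/-- Suppose `k O` contains a product of finite primitive ideals. Then `P ⊇ k O` is one of the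
factors and the product reads `B P C`. The rotated product `X = P C B` (with `B`, `C` made stable
under `O`) satisfies `X X = P C (B P C) B ⊆ k X`, so `k⁻¹ X` lies in the left order of `X`, which is
`O`. Thus `k⁻¹ C B ⊆ inverse P ⊆ O`, and the shorter product `C B` already lies in `k O`. The
descent ends at the empty product with `1 ∈ k O ⊆ P`. -/
theorem not_prod_le_of_inverse_le (hO : IsMaximalOrder S O) {P : Ideal O}
    (hP : IsFinitePrimitive P) (hinv : inverse P ≤ Subalgebra.toSubmodule O) {k : ℕ}
    (hk : k ≠ 0) (hkP : (k : O) ∈ P) (n : ℕ) :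
    ∀ l : List (Ideal O), l.length = n → (∀ Q ∈ l, IsFinitePrimitive Q) →
      ¬ ∀ x ∈ (l.map toSub).prod, ∃ y ∈ O, x = k * y := by
  have h2 := hP.isTwoSided
  have hkc : ∀ x : A, (k : A) * x = x * k := fun x => Nat.cast_comm k x
  induction n with
  | zero =>
    intro l hl _ h
    rw [List.length_eq_zero_iff] at hl
    subst hl
    obtain ⟨y, hy, h⟩ := h 1 (Submodule.one_le.1 le_rfl)
    refine (Ideal.ne_top_iff_one P).1 hP.ne_top ?_
    have : (1 : O) = k * ⟨y, hy⟩ := Subtype.ext (by simpa using h)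
    rw [this]
    exact P.mul_mem_right _ hkP
  | succ n ih =>
    intro l hln hl h
    have hlP : (l.map toSub).prod ≤ toSub P := by
      intro x hx
      obtain ⟨y, hy, rfl⟩ := h x hx
      exact mul_mem_toSub' hy (coe_mem_toSub.2 hkP)
    obtain ⟨l₁, l₂, rfl⟩ := List.append_of_mem (hP.mem_of_prod_le l hl hlP)
    have hl' : ∀ Q ∈ l₂ ++ l₁, IsFinitePrimitive Q := by
      intro Q hQ
      refine hl Q ?_
      simp only [List.mem_append, List.mem_cons] at hQ ⊢
      tauto
    refine ih (l₂ ++ l₁) (by simp at hln ⊢; omega) hl' ?_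
    rw [List.map_append, List.prod_append]
    rw [List.map_append, List.prod_append, List.map_cons, List.prod_cons] at h
    set L := Subalgebra.toSubmodule O
    set B := (l₁.map toSub).prod with hB
    set C := (l₂.map toSub).prod with hC
    have hBO : B ≤ L := prod_map_toSub_le_order l₁
    have hCO : C ≤ L := prod_map_toSub_le_order l₂
    have hPO : toSub P ≤ L := toSub_le P
    have hLL : L * L ≤ L := Submodule.mul_le.2 fun x hx y hy => O.mul_mem hx hy
    have h1L : (1 : Submodule (ZS S) A) ≤ L := Submodule.one_le.2 O.one_mem
    have hLP : L * toSub P ≤ toSub P := Submodule.mul_le.2 fun x hx y hy => mul_mem_toSub hx hy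
    have hPL : toSub P * L ≤ toSub P := Submodule.mul_le.2 fun x hx y hy => mul_mem_toSub' hy hx
    let kL : Submodule (ZS S) A := L.map (LinearMap.mulLeft (ZS S) (k : A))
    have hkL : ∀ x, x ∈ kL ↔ ∃ y ∈ O, x = k * y := fun x =>
      ⟨fun ⟨y, hy, h⟩ => ⟨y, hy, h.symm⟩, fun ⟨y, hy, h⟩ => ⟨y, hy, h.symm⟩⟩
    have hkLL : kL * L ≤ kL := by
      rw [Submodule.mul_le]
      intro x hx y hy
      obtain ⟨x, hx', rfl⟩ := (hkL _).1 hx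
      exact (hkL _).2 ⟨x * y, O.mul_mem hx' hy, mul_assoc _ _ _⟩
    have hLkL : L * kL ≤ kL := by
      rw [Submodule.mul_le]
      intro y hy x hx
      obtain ⟨x, hx', rfl⟩ := (hkL _).1 hx
      exact (hkL _).2 ⟨y * x, O.mul_mem hy hx', by rw [← mul_assoc, ← hkc, mul_assoc]⟩
    have hBPC : B * (toSub P * C) ≤ kL := fun x hx => (hkL x).2 (h x hx)
    -- `B` or `C` may be the empty product `ℤ_S · 1`, which is not stable under `O`. Saturating by
    -- `O` on both sides repairs this, and the inclusion in `k O` survives because `P` and `k O` are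
    -- two-sided.
    let B' := L * B * L
    let C' := L * C * L
    have hB'C' : B' * toSub P * C' ≤ kL := by
      have e1 : B' * toSub P * C' = L * (B * (((L * toSub P) * L) * C)) * L := by
        simp only [B', C', mul_assoc]
      rw [e1]
      have e2 : (L * toSub P) * L ≤ toSub P := (mul_le_mul' hLP le_rfl).trans hPL
      calc L * (B * (((L * toSub P) * L) * C)) * L ≤ L * (B * (toSub P * C)) * L := by gcongr
        _ ≤ L * kL * L := by gcongr
        _ ≤ kL * L := by gcongr
        _ ≤ kL := hkLL
    let X := toSub P * C' * B'
    have hC'L : C' ≤ L := calc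
      C' ≤ L * L * L := mul_le_mul' (mul_le_mul' le_rfl hCO) le_rfl
      _ ≤ L * L := mul_le_mul' hLL le_rfl
      _ ≤ L := hLL
    have hB'L : B' ≤ L := calc
      B' ≤ L * L * L := mul_le_mul' (mul_le_mul' le_rfl hBO) le_rfl
      _ ≤ L * L := mul_le_mul' hLL le_rfl
      _ ≤ L := hLL
    have hXL : X ≤ L := calc
      X ≤ L * L * L := mul_le_mul' (mul_le_mul' hPO hC'L) hB'L
      _ ≤ L * L := mul_le_mul' hLL le_rfl
      _ ≤ L := hLL
    have hLX : L * X ≤ X := by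
      calc L * X = L * toSub P * C' * B' := by simp only [X, mul_assoc]
        _ ≤ X := mul_le_mul' (mul_le_mul' hLP le_rfl) le_rfl
    have hCC' : C ≤ C' := calc
      C = 1 * C * 1 := by rw [one_mul, mul_one]
      _ ≤ C' := mul_le_mul' (mul_le_mul' h1L le_rfl) h1L
    have hBB' : B ≤ B' := calc
      B = 1 * B * 1 := by rw [one_mul, mul_one]
      _ ≤ B' := mul_le_mul' (mul_le_mul' h1L le_rfl) h1L
    have hXX : ∀ x ∈ X, ∀ y ∈ X, ∃ z ∈ X, x * y = k * z := by
      have hXX' : X * X ≤ X.map (LinearMap.mulLeft (ZS S) (k : A)) := by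
        calc X * X = toSub P * C' * (B' * toSub P * C') * B' := by simp only [X, mul_assoc]
          _ ≤ toSub P * C' * kL * B' := by gcongr
          _ ≤ X.map (LinearMap.mulLeft (ZS S) (k : A)) := by
            rw [Submodule.mul_le]
            intro x hx y hy
            have hx' : x ∈ (toSub P * C').map (LinearMap.mulLeft (ZS S) (k : A)) := by
              refine Submodule.mul_le.2 ?_ hx
              intro a ha b hb
              obtain ⟨b, hb', rfl⟩ := (hkL _).1 hb
              refine ⟨a * b, ?_, ?_⟩
              · have : toSub P * C' * L ≤ toSub P * C' := by
                  have : toSub P * C' * L = toSub P * (L * C * (L * L)) := by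
                    simp only [C', mul_assoc]
                  rw [this]
                  simp only [C']
                  gcongr
                exact this (Submodule.mul_mem_mul ha hb')
              · rw [LinearMap.mulLeft_apply, ← mul_assoc, hkc, mul_assoc]
            obtain ⟨a, ha, rfl⟩ := hx'
            exact ⟨a * y, Submodule.mul_mem_mul ha hy, by simp [mul_assoc]⟩
      intro x hx y hy
      obtain ⟨z, hz, h⟩ := hXX' (Submodule.mul_mem_mul hx hy)
      exact ⟨z, hz, h.symm⟩
    obtain ⟨n₁, hn₁, hn₁'⟩ := exists_natCast_mem_prod (P :: (l₂ ++ l₁)) (by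
      simp only [List.mem_cons, forall_eq_or_imp]
      exact ⟨hP, hl'⟩)
    have hnX : (n₁ : A) ∈ X := by
      rw [List.map_cons, List.prod_cons, List.map_append, List.prod_append, ← mul_assoc] at hn₁'
      exact (mul_le_mul' (mul_le_mul' le_rfl hCC') hBB' :
        toSub P * C * B ≤ X) hn₁'
    have hkinv : ∀ x : A, (k : A) * (algebraMap ℚ A ((k : ℚ)⁻¹) * x) = x := fun x => by
      rw [← mul_assoc, ← map_natCast (algebraMap ℚ A), ← map_mul,
        mul_inv_cancel₀ (by exact_mod_cast hk), map_one, one_mul]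
    have hkinv' : ∀ x : A, algebraMap ℚ A ((k : ℚ)⁻¹) * ((k : A) * x) = x := fun x => by
      rw [← mul_assoc, ← map_natCast (algebraMap ℚ A), ← map_mul,
        inv_mul_cancel₀ (by exact_mod_cast hk), map_one, one_mul]
    have hXk : ∀ x ∈ X, algebraMap ℚ A ((k : ℚ)⁻¹) * x ∈ O := by
      intro x hx
      refine hO.mem_of_forall_mul_mem hXL (fun a ha b hb => hLX (Submodule.mul_mem_mul ha hb))
        hn₁ hnX ?_
      intro y hy
      obtain ⟨z, hz, h⟩ := hXX x hx y hy
      rwa [mul_assoc, h, hkinv']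
    intro x hx
    refine ⟨algebraMap ℚ A ((k : ℚ)⁻¹) * x, hinv ?_, (hkinv x).symm⟩
    intro y hy
    rw [← mul_assoc, ← Algebra.commutes, mul_assoc]
    refine hXk _ ?_
    have : toSub P * (C * B) ≤ X := by
      rw [← mul_assoc]
      exact mul_le_mul' (mul_le_mul' le_rfl hCC') hBB'
    exact this (Submodule.mul_mem_mul (coe_mem_toSub.2 hy) hx)

/-- The elements of `O` in a submodule of `A`, as an ideal of `O`. -/
def idealOf (X : Submodule (ZS S) A) (h : ∀ r ∈ O, ∀ x ∈ X, r * x ∈ X) : Ideal O where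
  carrier := {x | (x : A) ∈ X}
  add_mem' ha hb := X.add_mem ha hb
  zero_mem' := X.zero_mem
  smul_mem' r x hx := h r r.2 x hx

/-- As `O / k O` is finite, `k O` does contain a product of finite primitive ideals, contrary to the
previous lemma. -/
theorem not_inverse_le (hO : IsMaximalOrder S O) {P : Ideal O} (hP : IsFinitePrimitive P) :
    ¬ inverse P ≤ Subalgebra.toSubmodule O := by
  intro hinv
  obtain ⟨k, hk, hkP⟩ := hP.exists_natCast_mem
  obtain ⟨g, hg⟩ := IsOrderOver.exists_card_quotient_le hO.prop
  obtain ⟨l, hl, hl'⟩ := exists_list_isFinitePrimitive _ (Ideal.span {(k : O)}) (hg k hk).1 rfl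
  refine not_prod_le_of_inverse_le hO hP hinv hk hkP _ l rfl hl fun x hx => ?_
  obtain ⟨y, hy, rfl⟩ := (prod_map_toSub_le l).trans (toSub_mono hl') hx
  obtain ⟨z, rfl⟩ := Ideal.mem_span_singleton'.1 hy
  refine ⟨z, z.2, ?_⟩
  simp [Nat.cast_comm]

/-- The left and the right inverse of `P` agree: if `P x ⊆ O`, then `P (x y) ⊆ P` for `y ∈ P`, so `x
y` is in the right order of `P`, which is `O` by maximality. -/
theorem mem_inverse_iff (hO : IsMaximalOrder S O) {P : Ideal O} (hP : IsFinitePrimitive P)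
    {x : A} : x ∈ inverse P ↔ ∀ y ∈ P, x * (y : A) ∈ O := by
  have := hP.isTwoSided
  obtain ⟨k, hk, hkP⟩ := hP.exists_natCast_mem
  have hkP' : (k : A) ∈ toSub P := ⟨_, hkP, by simp⟩
  constructor
  · intro hx y hy
    refine hO.mem_of_forall_mul_mem' (toSub_le P) (fun r hr z hz => mul_mem_toSub' hr hz) hk hkP' ?_
    rintro _ ⟨z, hz, rfl⟩
    rw [← mul_assoc]
    exact mul_mem_toSub (hx z hz) (coe_mem_toSub.2 hy)
  · intro hx y hy
    refine hO.mem_of_forall_mul_mem (toSub_le P) (fun r hr z hz => mul_mem_toSub hr hz) hk hkP' ?_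
    rintro _ ⟨z, hz, rfl⟩
    rw [mul_assoc]
    exact mul_mem_toSub' (hx z hz) (coe_mem_toSub.2 hy)

theorem one_mem_inverse (P : Ideal O) : 1 ∈ inverse P := fun y _ => by rw [mul_one]; exact y.2

/-- The finite primitive ideals of a maximal order are invertible. -/
theorem one_mem_inverse_mul (hO : IsMaximalOrder S O) {P : Ideal O} (hP : IsFinitePrimitive P) :
    1 ∈ inverse P * toSub P ∧ 1 ∈ toSub P * inverse P := by
  have h2 := hP.isTwoSided
  obtain ⟨k, hk, hkP⟩ := hP.exists_natCast_mem
  have hkP' : (k : A) ∈ toSub P := ⟨_, hkP, by simp⟩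
  set L := Subalgebra.toSubmodule O with hL
  have hinv : ∀ r ∈ O, ∀ x ∈ inverse P, r * x ∈ inverse P := fun r hr x hx y hy => by
    rw [← mul_assoc]
    exact hx (y * ⟨r, hr⟩) (P.mul_mem_right _ hy)
  have hinv' : ∀ r ∈ O, ∀ x ∈ inverse P, x * r ∈ inverse P := fun r hr x hx y hy => by
    rw [← mul_assoc]
    exact O.mul_mem (hx y hy) hr
  have hLI : L * inverse P ≤ inverse P := Submodule.mul_le.2 hinv
  have hIL : inverse P * L ≤ inverse P := Submodule.mul_le.2 fun x hx r hr => hinv' r hr x hx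
  have hLP : L * toSub P ≤ toSub P := Submodule.mul_le.2 fun x hx y hy => mul_mem_toSub hx hy
  have hPL : toSub P * L ≤ toSub P := Submodule.mul_le.2 fun x hx y hy => mul_mem_toSub' hy hx
  -- A two-sided ideal between `P` and `O` and different from `P` is `O`. This will be applied to
  -- `P⁻¹ P` and to `P P⁻¹`.
  have key : ∀ X : Submodule (ZS S) A, L * X ≤ X → X * L ≤ X → toSub P ≤ X → X ≤ L →
      ¬ X ≤ toSub P → 1 ∈ X := by
    intro X hLX hXL hPX hXL' hXP
    let J := idealOf (O := O) X fun r hr x hx => hLX (Submodule.mul_mem_mul hr hx)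
    have hJ2 : J.IsTwoSided := ⟨fun b ha => hXL (Submodule.mul_mem_mul ha b.2)⟩
    by_contra h1
    have hJT : J ≠ ⊤ := (Ideal.ne_top_iff_one J).2 h1
    have hPJ : P ≤ J := fun x hx => hPX (coe_mem_toSub.2 hx)
    have hJP := hP.eq_of_le hPJ hJT
    refine hXP fun x hx => ?_
    have : (⟨x, hXL' hx⟩ : O) ∈ J := hx
    rw [hJP] at this
    exact coe_mem_toSub.2 this
  constructor
  · refine key _ ?_ ?_ ?_ ?_ ?_
    · rw [← mul_assoc]
      exact mul_le_mul' hLI le_rfl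
    · rw [mul_assoc]
      exact mul_le_mul' le_rfl hPL
    · intro x hx
      rw [← one_mul x]
      exact Submodule.mul_mem_mul (one_mem_inverse P) hx
    · rw [Submodule.mul_le]
      rintro x hx _ ⟨y, hy, rfl⟩
      exact (mem_inverse_iff hO hP).1 hx y hy
    -- If `P⁻¹ P ⊆ P`, then `P⁻¹` is contained in the left order of `P`, that is, in `O`.
    · intro h
      refine not_inverse_le hO hP fun x hx => ?_
      exact hO.mem_of_forall_mul_mem (toSub_le P) (fun r hr z hz => mul_mem_toSub hr hz) hk hkP'
        fun y hy => h (Submodule.mul_mem_mul hx hy)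
  · refine key _ ?_ ?_ ?_ ?_ ?_
    · rw [← mul_assoc]
      exact mul_le_mul' hLP le_rfl
    · rw [mul_assoc]
      exact mul_le_mul' le_rfl hIL
    · intro x hx
      rw [← mul_one x]
      exact Submodule.mul_mem_mul hx (one_mem_inverse P)
    · rw [Submodule.mul_le]
      rintro _ ⟨y, hy, rfl⟩ x hx
      exact hx y hy
    · intro h
      refine not_inverse_le hO hP fun x hx => ?_
      exact hO.mem_of_forall_mul_mem' (toSub_le P) (fun r hr z hz => mul_mem_toSub' hr hz) hk hkP'
        fun y hy => h (Submodule.mul_mem_mul hy hx)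

/-- The finite primitive ideals of a maximal order are projective left modules. -/
theorem projective_of_isFinitePrimitive (hO : IsMaximalOrder S O) {P : Ideal O}
    (hP : IsFinitePrimitive P) : Module.Projective O P := by
  have hright : ∀ x : inverse P, ∀ y : P, ((y : O) : A) * x ∈ O := fun x y => x.2 y y.2
  let φ : inverse P → (P →ₗ[O] O) := fun x =>
    { toFun := fun y => ⟨((y : O) : A) * x, hright x y⟩
      map_add' := fun y z => Subtype.ext (by simp [add_mul])
      map_smul' := fun r y => Subtype.ext (by simp [mul_assoc]) }
  have h1 := (one_mem_inverse_mul hO hP).1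
  -- a finite dual basis
  have hdual : ∀ t ∈ inverse P * toSub P, ∃ (n : ℕ) (x : Fin n → inverse P) (p : Fin n → P),
      t = ∑ i, (x i : A) * ((p i : O) : A) := by
    intro t ht
    induction ht using Submodule.mul_induction_on' with
    | mem_mul_mem x hx y hy =>
      obtain ⟨y, hy, rfl⟩ := hy
      exact ⟨1, fun _ => ⟨x, hx⟩, fun _ => ⟨y, hy⟩, by simp⟩
    | add s hs t ht ihs iht =>
      obtain ⟨n, x, p, rfl⟩ := ihs
      obtain ⟨m, x', p', rfl⟩ := iht
      exact ⟨n + m, Fin.append x x', Fin.append p p', by simp [Fin.sum_univ_add]⟩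
  obtain ⟨n, x, p, hxp⟩ := hdual 1 h1
  let i : P →ₗ[O] (Fin n → O) := LinearMap.pi fun j => φ (x j)
  let s : (Fin n → O) →ₗ[O] P := Fintype.linearCombination O p
  refine Module.Projective.of_split i s ?_
  ext y
  simp only [s, i, φ, LinearMap.comp_apply, Fintype.linearCombination_apply, LinearMap.id_apply]
  have : ((y : O) : A) = ∑ j, ((y : O) : A) * (x j) * ((p j : O) : A) := by
    conv_lhs => rw [← mul_one ((y : O) : A), hxp, Finset.mul_sum]
    simp only [mul_assoc]
  rw [this]
  simp

/-- Distinct finite primitive ideals of a maximal order commute: `P ∩ Q = P Q`. -/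
theorem mem_closure_mul_of_mem_inf (hO : IsMaximalOrder S O) {P Q : Ideal O}
    (hP : IsFinitePrimitive P) (hQ : IsFinitePrimitive Q) (hPQ : P ≠ Q) {x : O} (hxP : x ∈ P)
    (hxQ : x ∈ Q) : x ∈ AddSubgroup.closure {y : O | ∃ a ∈ P, ∃ b ∈ Q, y = a * b} := by
  have h2P := hP.isTwoSided
  have h2Q := hQ.isTwoSided
  -- For `y ∈ P⁻¹` one has `q r (y x) = (q r y) x ∈ O x ⊆ Q`, so `y x ∈ Q` because `Q` is prime and
  -- `q ∉ Q`. Hence `x ∈ P P⁻¹ x ⊆ P Q`.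
  obtain ⟨q, hqP, hqQ⟩ : ∃ q ∈ P, q ∉ Q := by
    by_contra! h
    exact hPQ (hP.eq_of_le h hQ.ne_top).symm
  have hmem : ∀ y (hy : y ∈ inverse P), ∃ h : y * (x : A) ∈ O, (⟨_, h⟩ : O) ∈ Q := by
    intro y hy
    refine ⟨(mem_inverse_iff hO hP).1 hy x hxP, ?_⟩
    refine (hQ.mem_or_mem (a := q) fun r => ?_).resolve_left hqQ
    have h1 : (q * r : O) ∈ P := P.mul_mem_right r hqP
    have h2 : ((q * r : O) : A) * y ∈ O := hy _ h1
    have : q * r * ⟨y * (x : A), (mem_inverse_iff hO hP).1 hy x hxP⟩ = ⟨_, h2⟩ * x :=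
      Subtype.ext (by simp [mul_assoc])
    rw [this]
    exact Q.mul_mem_left _ hxQ
  have key : ∀ t ∈ toSub P * inverse P, ∃ z : O, (z : A) = t * x ∧
      z ∈ AddSubgroup.closure {y : O | ∃ a ∈ P, ∃ b ∈ Q, y = a * b} := by
    intro t ht
    induction ht using Submodule.mul_induction_on' with
    | mem_mul_mem p hp y hy =>
      obtain ⟨p, hp, rfl⟩ := hp
      obtain ⟨h, hQ'⟩ := hmem y hy
      exact ⟨p * ⟨_, h⟩, by simp [mul_assoc], AddSubgroup.subset_closure ⟨p, hp, _, hQ', rfl⟩⟩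
    | add s hs t ht ihs iht =>
      obtain ⟨z, hz, hz'⟩ := ihs
      obtain ⟨w, hw, hw'⟩ := iht
      exact ⟨z + w, by simp [hz, hw, add_mul], add_mem hz' hw'⟩
  obtain ⟨z, hz, hz'⟩ := key 1 (one_mem_inverse_mul hO hP).2
  rw [one_mul] at hz
  rwa [← Subtype.ext hz]

end Invertibility

/-- The properties of a maximal order on which the counting of its finite modules rests. -/
structure IsDedekindLike (R : Type u) [Ring R] : Prop where
  projective : ∀ P : Ideal R, IsFinitePrimitive P → Module.Projective R P
  mem_closure : ∀ P Q : Ideal R, IsFinitePrimitive P → IsFinitePrimitive Q → P ≠ Q →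
    ∀ x ∈ P, x ∈ Q → x ∈ AddSubgroup.closure {y : R | ∃ a ∈ P, ∃ b ∈ Q, y = a * b}
  natCast_mul_eq_zero : ∀ n : ℕ, n ≠ 0 → ∀ x : R, (n : R) * x = 0 → x = 0
  exists_card_quotient_le : ∃ g : ℕ, ∀ n : ℕ, n ≠ 0 →
    Finite (R ⧸ Ideal.span {(n : R)}) ∧ Nat.card (R ⧸ Ideal.span {(n : R)}) ≤ n ^ g

/-- The counting of finite modules below uses only these four properties and that the ring is
noetherian; the order itself returns with the weight `|G|^u`. -/
theorem IsMaximalOrder.isDedekindLike {A : Type u} [Ring A] [Algebra ℚ A] {S : Set Nat.Primes}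
    {O : Subalgebra (ZS S) A} (hO : IsMaximalOrder S O) : IsDedekindLike O where
  projective _ hP := projective_of_isFinitePrimitive hO hP
  mem_closure _ _ hP hQ h _ hx hx' := mem_closure_mul_of_mem_inf hO hP hQ h hx hx'
  natCast_mul_eq_zero _ hn x := (natCast_mul_eq_zero_iff_of_order hn x).1
  exists_card_quotient_le := IsOrderOver.exists_card_quotient_le hO.prop

/-! ### Cardinalities of groups of homomorphisms -/

section Cardinalities

theorem natCard_eq_ker_mul {G H : Type*} [AddCommGroup G] [AddCommGroup H] (φ : G →+ H)
    (hφ : Function.Surjective φ) : Nat.card G = Nat.card φ.ker * Nat.card H := by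
  rw [AddSubgroup.card_eq_card_quotient_mul_card_addSubgroup φ.ker, mul_comm,
    Nat.card_congr (QuotientAddGroup.quotientKerEquivOfSurjective φ hφ).toEquiv]

variable {R : Type u} [Ring R]

theorem finite_linearMap {M K : Type*} [AddCommGroup M] [Module R M] [AddCommGroup K] [Module R K]
    [Module.Finite R M] [Finite K] : Finite (M →ₗ[R] K) := by
  obtain ⟨n, f, hf⟩ := Module.Finite.exists_fin' R M
  refine Finite.of_injective (fun φ : M →ₗ[R] K => fun i : Fin n => φ (f (Pi.single i 1))) ?_
  intro φ ψ h
  have : φ.comp f = ψ.comp f := by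
    refine LinearMap.pi_ext' fun i => LinearMap.ext_ring ?_
    exact congrFun h i
  ext m
  obtain ⟨x, rfl⟩ := hf m
  exact LinearMap.congr_fun this x

theorem card_hom_pos (M K : Type*) [AddCommGroup M] [Module R M] [AddCommGroup K] [Module R K]
    [Module.Finite R M] [Finite K] : 0 < Nat.card (M →ₗ[R] K) := by
  have : Finite (M →ₗ[R] K) := finite_linearMap
  exact Nat.card_pos

/-- Precomposition with a linear equivalence. -/
def homCongrLeft {M N : Type*} (K : Type*) [AddCommGroup M] [Module R M] [AddCommGroup N]
    [Module R N] [AddCommGroup K] [Module R K] (e : M ≃ₗ[R] N) : (M →ₗ[R] K) ≃ (N →ₗ[R] K) where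
  toFun f := f.comp e.symm.toLinearMap
  invFun f := f.comp e.toLinearMap
  left_inv f := by ext; simp
  right_inv f := by ext; simp

/-- Postcomposition with a linear equivalence. -/
def homCongrRight {K L : Type*} (M : Type*) [AddCommGroup M] [Module R M] [AddCommGroup L]
    [Module R L] [AddCommGroup K] [Module R K] (e : K ≃ₗ[R] L) : (M →ₗ[R] K) ≃ (M →ₗ[R] L) where
  toFun f := e.toLinearMap.comp f
  invFun f := e.symm.toLinearMap.comp f
  left_inv f := by ext; simp
  right_inv f := by ext; simp

theorem card_hom_prod (M N K : Type*) [AddCommGroup M] [Module R M] [AddCommGroup N]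
    [Module R N] [AddCommGroup K] [Module R K] :
    Nat.card (M × N →ₗ[R] K) = Nat.card (M →ₗ[R] K) * Nat.card (N →ₗ[R] K) := by
  rw [← Nat.card_congr (LinearMap.coprodEquiv (R := R) (M := M) (M₂ := N) (M₃ := K) ℕ).toEquiv,
    Nat.card_prod]

theorem card_hom_pi (n : ℕ) (K : Type*) [AddCommGroup K] [Module R K] :
    Nat.card ((Fin n → R) →ₗ[R] K) = Nat.card K ^ n := by
  rw [← Nat.card_congr ((Pi.basisFun R (Fin n)).constr ℕ (M' := K)).toEquiv, Nat.card_fun]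
  simp

/-- The equivalence of Schanuel's lemma. -/
theorem schanuel {M N K : Type*} [AddCommGroup M] [Module R M] [AddCommGroup N]
    [Module R N] [AddCommGroup K] [Module R K] [Module.Projective R M] [Module.Projective R N]
    (f : M →ₗ[R] K) (g : N →ₗ[R] K) (hf : Function.Surjective f) (hg : Function.Surjective g) :
    Nonempty ((LinearMap.ker f × N) ≃ₗ[R] (M × LinearMap.ker g)) := by
  obtain ⟨s, hs⟩ := Module.projective_lifting_property g f hg
  obtain ⟨t, ht⟩ := Module.projective_lifting_property f g hf
  have hs' : ∀ m, g (s m) = f m := fun m => LinearMap.congr_fun hs m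
  have ht' : ∀ n, f (t n) = g n := fun n => LinearMap.congr_fun ht n
  refine ⟨{
    toFun := fun x => (x.1 + t x.2, ⟨x.2 - s (x.1 + t x.2), ?_⟩)
    invFun := fun y => (⟨y.1 - t (y.2 + s y.1), ?_⟩, y.2 + s y.1)
    map_add' := ?_
    map_smul' := ?_
    left_inv := ?_
    right_inv := ?_ }⟩
  · rw [LinearMap.mem_ker, map_sub, hs', map_add, ht', LinearMap.mem_ker.1 x.1.2]
    simp
  · intro x y
    refine Prod.ext ?_ (Subtype.ext ?_)
    · simp; abel
    · simp; abel
  · intro r x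
    refine Prod.ext ?_ (Subtype.ext ?_)
    · simp
    · simp [smul_sub]
  · rw [LinearMap.mem_ker, map_sub, ht', map_add, hs', LinearMap.mem_ker.1 y.2.2]
    simp
  · intro x
    refine Prod.ext (Subtype.ext ?_) ?_ <;> simp
  · intro y
    refine Prod.ext ?_ (Subtype.ext ?_) <;> simp

/-- Surjections from a projective module induce surjections on homomorphisms. -/
theorem card_hom_eq_mul {M N L : Type*} [AddCommGroup M] [Module R M] [AddCommGroup N]
    [Module R N] [AddCommGroup L] [Module R L] [Module.Projective R M] (f : N →ₗ[R] L)
    (hf : Function.Surjective f) :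
    Nat.card (M →ₗ[R] N) = Nat.card (M →ₗ[R] LinearMap.ker f) * Nat.card (M →ₗ[R] L) := by
  let φ : (M →ₗ[R] N) →+ (M →ₗ[R] L) :=
    { toFun := fun a => f.comp a
      map_zero' := LinearMap.comp_zero f
      map_add' := fun a b => LinearMap.comp_add _ _ _ }
  rw [natCard_eq_ker_mul φ (fun b => Module.projective_lifting_property f b hf)]
  congr 1
  refine Nat.card_congr ⟨fun a => a.1.codRestrict _ fun m => LinearMap.congr_fun a.2 m,
    fun b => ⟨(LinearMap.ker f).subtype.comp b, ?_⟩, fun a => ?_, fun b => ?_⟩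
  · ext m
    exact (b m).2
  · ext m; rfl
  · ext m; rfl

end Cardinalities

/-! ### Projectivity of finite-index submodules and extension of homomorphisms -/

section Hereditary

variable {R : Type u} [Ring R]

/-- A property of modules that passes to kernels of surjections onto finite simple modules passes
to kernels of surjections onto finite modules. -/
theorem ker_induction (p : ∀ (M : Type u) [AddCommGroup M] [Module R M], Prop)
    (hiso : ∀ (M N : Type u) [AddCommGroup M] [Module R M] [AddCommGroup N] [Module R N],
      (M ≃ₗ[R] N) → p M → p N)
    (hstep : ∀ (M : Type u) [AddCommGroup M] [Module R M] (K : Type w) [AddCommGroup K]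
      [Module R K] [Finite K] [IsSimpleModule R K] (f : M →ₗ[R] K), Function.Surjective f →
      p M → p (LinearMap.ker f)) (n : ℕ) :
    ∀ (M : Type u) [AddCommGroup M] [Module R M] (G : Type w) [AddCommGroup G] [Module R G]
      [Finite G] (f : M →ₗ[R] G), Function.Surjective f → Nat.card G = n → p M →
      p (LinearMap.ker f) := by
  induction n using Nat.strong_induction_on with
  | _ n ih =>
    intro M _ _ G _ _ _ f hf hn hp
    rcases subsingleton_or_nontrivial G with hG | hG
    · have : LinearMap.ker f = ⊤ := LinearMap.ker_eq_top.2 (LinearMap.ext fun x => Subsingleton.elim _ _)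
      exact hiso _ _ ((LinearEquiv.ofEq _ _ this).trans Submodule.topEquiv).symm hp
    · obtain ⟨m, hm⟩ := exists_simple_submodule_of_finite (R := R) G
      have := IsSimpleModule.nontrivial R m
      have : Finite (G ⧸ m) := Finite.of_surjective _ (Submodule.mkQ_surjective m)
      -- Descend in two stages: to the kernel of `g`, whose quotient `G ⧸ m` is smaller than `G`,
      -- and from there by `f` onto the simple module `m`, with kernel that of `f`.
      let g : M →ₗ[R] G ⧸ m := m.mkQ.comp f
      have hg : Function.Surjective g := (Submodule.mkQ_surjective m).comp hf
      have hcard : Nat.card (G ⧸ m) < n := by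
        rw [← hn, Submodule.card_eq_card_quotient_mul_card m]
        have h1 : 1 < Nat.card m := Finite.one_lt_card
        have h2 : 0 < Nat.card (G ⧸ m) := Nat.card_pos
        nlinarith
      have hpg := ih _ hcard M (G ⧸ m) g hg rfl hp
      have hgm : ∀ x, x ∈ LinearMap.ker g ↔ f x ∈ m := fun x => by
        rw [LinearMap.mem_ker]
        exact Submodule.Quotient.mk_eq_zero m
      let f' : LinearMap.ker g →ₗ[R] m :=
        (f.comp (LinearMap.ker g).subtype).codRestrict m fun x => (hgm x).1 x.2
      have hf' : Function.Surjective f' := by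
        rintro ⟨y, hy⟩
        obtain ⟨x, rfl⟩ := hf y
        exact ⟨⟨x, (hgm x).2 hy⟩, rfl⟩
      have hpf := hstep _ m f' hf' hpg
      have hle : LinearMap.ker f ≤ LinearMap.ker g := fun x hx => by
        rw [hgm, LinearMap.mem_ker.1 hx]
        exact m.zero_mem
      refine hiso _ _ ?_ hpf
      have hker : LinearMap.ker f' = (LinearMap.ker f).submoduleOf (LinearMap.ker g) := by
        ext x
        rw [LinearMap.mem_ker, ← Submodule.coe_eq_zero]
        rfl
      exact (LinearEquiv.ofEq _ _ hker).trans (Submodule.submoduleOfEquivOfLe hle)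

theorem isSemisimpleModule_quotient_annihilator (K : Type*) [AddCommGroup K] [Module R K]
    [Finite K] [IsSimpleModule R K] : IsSemisimpleModule R (R ⧸ Module.annihilator R K) := by
  let j : R →ₗ[R] (K → K) := LinearMap.pi fun x => LinearMap.toSpanSingleton R K x
  have hj : LinearMap.ker j = Module.annihilator R K := by
    ext r
    rw [LinearMap.mem_ker, Module.mem_annihilator]
    exact ⟨fun h x => congrFun h x, fun h => funext h⟩
  refine IsSemisimpleModule.of_injective ((Module.annihilator R K).liftQ j hj.ge) ?_
  rw [← LinearMap.ker_eq_bot]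
  exact Submodule.ker_liftQ_eq_bot _ _ _ hj.le

/-- With `P` the annihilator of `K`, semisimplicity of `R ⧸ P` splits off the image of `ker g`:
there is `c` with `1 - c ∈ ker g` and `(ker g) c ⊆ P`. Then `x ↦ (x c, x)` embeds `ker g` in `P ×
R`, with retraction `(p, r) ↦ p + r (1 - c)`, and `P` is projective. -/
theorem IsDedekindLike.projective_ker_of_simple (hR : IsDedekindLike R) {K : Type*}
    [AddCommGroup K] [Module R K] [Finite K] [IsSimpleModule R K] (g : R →ₗ[R] K) :
    Module.Projective R (LinearMap.ker g) := by
  set P := Module.annihilator R K with hPdef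
  have hPp := hR.projective P (isFinitePrimitive_annihilator K)
  have hss := isSemisimpleModule_quotient_annihilator (R := R) K
  have hg : ∀ r, g r = r • g 1 := fun r => by rw [← map_smul, smul_eq_mul, mul_one]
  have hPI : P ≤ LinearMap.ker g := fun r hr => by
    rw [LinearMap.mem_ker, hg]
    exact Module.mem_annihilator.1 hr _
  let N : Submodule R (R ⧸ P) := (LinearMap.ker g).map P.mkQ
  have hN : ∀ r, Submodule.Quotient.mk (p := P) r ∈ N → r ∈ LinearMap.ker g := by
    rintro r ⟨s, hs, hsr⟩
    have : s - r ∈ P := (Submodule.Quotient.eq P).1 hsr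
    have h2 := (LinearMap.ker g).sub_mem hs (hPI this)
    rwa [sub_sub_cancel] at h2
  obtain ⟨C, hC⟩ := exists_isCompl N
  obtain ⟨a, ha, c, hc, hac⟩ := Submodule.mem_sup.1
    (hC.sup_eq_top.ge (Submodule.mem_top : Submodule.Quotient.mk (p := P) (1 : R) ∈ ⊤))
  obtain ⟨c, rfl⟩ := Submodule.Quotient.mk_surjective _ c
  have ha' : 1 - c ∈ LinearMap.ker g := hN _ (by
    rw [Submodule.Quotient.mk_sub, ← hac, add_sub_cancel_right]
    exact ha)
  have hxc : ∀ x ∈ LinearMap.ker g, x * c ∈ P := by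
    intro x hx
    have h1 : x * c ∈ LinearMap.ker g := by
      have : x * c = x - x * (1 - c) := by rw [mul_sub, mul_one, sub_sub_cancel]
      rw [this]
      exact (LinearMap.ker g).sub_mem hx ((LinearMap.ker g).smul_mem x ha')
    rw [← Submodule.Quotient.mk_eq_zero P]
    refine (Submodule.mem_bot R).1 (hC.inf_eq_bot.le ⟨⟨_, h1, rfl⟩, ?_⟩)
    have := C.smul_mem x hc
    rwa [← Submodule.Quotient.mk_smul, smul_eq_mul] at this
  let i : LinearMap.ker g →ₗ[R] P × R :=
    { toFun := fun x => (⟨x * c, hxc x x.2⟩, x)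
      map_add' := fun x y => Prod.ext (Subtype.ext (by simp [add_mul])) rfl
      map_smul' := fun r x => Prod.ext (Subtype.ext (by simp [mul_assoc])) rfl }
  let s : P × R →ₗ[R] LinearMap.ker g :=
    (Submodule.inclusion hPI).coprod (LinearMap.toSpanSingleton R _ ⟨1 - c, ha'⟩)
  refine Module.Projective.of_split i s ?_
  ext x
  simp [i, s, mul_sub]

/-- Projective modules that are finitely generated. -/
def IsFGProjective (R : Type u) [Ring R] (M : Type*) [AddCommGroup M] [Module R M] : Prop :=
  Module.Projective R M ∧ Module.Finite R M

theorem IsFGProjective.of_equiv {M N : Type*} [AddCommGroup M] [Module R M] [AddCommGroup N]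
    [Module R N] (e : M ≃ₗ[R] N) (h : IsFGProjective R M) : IsFGProjective R N := by
  have := h.1
  have := h.2
  exact ⟨Module.Projective.of_equiv e, Module.Finite.equiv e⟩

theorem IsFGProjective.of_prod_left {M N : Type*} [AddCommGroup M] [Module R M] [AddCommGroup N]
    [Module R N] (h : IsFGProjective R (M × N)) : IsFGProjective R M := by
  have := h.1
  have := h.2
  exact ⟨Module.Projective.of_split (LinearMap.inl R M N) (LinearMap.fst R M N) (by ext; simp),
    Module.Finite.of_surjective (LinearMap.fst R M N) Prod.fst_surjective⟩

theorem IsFGProjective.prod {M N : Type*} [AddCommGroup M] [Module R M] [AddCommGroup N]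
    [Module R N] (hM : IsFGProjective R M) (hN : IsFGProjective R N) :
    IsFGProjective R (M × N) := by
  have := hM.1
  have := hM.2
  have := hN.1
  have := hN.2
  exact ⟨inferInstance, inferInstance⟩

theorem isFGProjective_self : IsFGProjective R R := ⟨inferInstance, inferInstance⟩

/-- Schanuel's lemma against a surjection `g : R → K` gives `ker f × R ≃ M × ker g`, which reduces
the claim to `ker g`. -/
theorem IsDedekindLike.isFGProjective_ker_of_simple [IsNoetherianRing R] (hR : IsDedekindLike R)
    {M K : Type*} [AddCommGroup M] [Module R M] [AddCommGroup K] [Module R K] [Finite K]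
    [IsSimpleModule R K] (f : M →ₗ[R] K) (hf : Function.Surjective f) (hM : IsFGProjective R M) :
    IsFGProjective R (LinearMap.ker f) := by
  have := hM.1
  have := IsSimpleModule.nontrivial R K
  obtain ⟨x, hx⟩ := exists_ne (0 : K)
  let g := LinearMap.toSpanSingleton R K x
  obtain ⟨e⟩ := schanuel f g hf (IsSimpleModule.toSpanSingleton_surjective R hx)
  exact ((hM.prod ⟨hR.projective_ker_of_simple g, inferInstance⟩).of_equiv e.symm).of_prod_left

theorem IsDedekindLike.isFGProjective_ker [IsNoetherianRing R] (hR : IsDedekindLike R)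
    {M : Type u} {G : Type w} [AddCommGroup M] [Module R M] [AddCommGroup G] [Module R G] [Finite G]
    (f : M →ₗ[R] G) (hf : Function.Surjective f) (hM : IsFGProjective R M) :
    IsFGProjective R (LinearMap.ker f) :=
  ker_induction (fun M _ _ => IsFGProjective R M) (fun _ _ _ _ _ _ e h => h.of_equiv e)
    (fun _ _ _ _ _ _ _ _ f hf h => hR.isFGProjective_ker_of_simple f hf h) _ M G f hf rfl hM

/-- Both ideals are maximal among the proper two-sided ideals, so `P + Q` is the whole ring. -/
theorem IsFinitePrimitive.exists_mem_one_sub_mem {P Q : Ideal R} (hP : IsFinitePrimitive P)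
    (hQ : IsFinitePrimitive Q) (hPQ : P ≠ Q) : ∃ b ∈ Q, 1 - b ∈ P := by
  have h2P := hP.isTwoSided
  have h2Q := hQ.isTwoSided
  have h2 : (P ⊔ Q).IsTwoSided := ⟨fun {a} b ha => by
    obtain ⟨x, hx, y, hy, rfl⟩ := Submodule.mem_sup.1 ha
    rw [add_mul]
    exact Submodule.add_mem_sup (P.mul_mem_right b hx) (Q.mul_mem_right b hy)⟩
  have htop : P ⊔ Q = ⊤ := by
    by_contra h
    have h1 := hP.eq_of_le le_sup_left h
    have h3 := hQ.eq_of_le le_sup_right h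
    exact hPQ (h1.symm.trans h3)
  obtain ⟨a, ha, b, hb, hab⟩ := Submodule.mem_sup.1 (htop.ge (Submodule.mem_top : (1 : R) ∈ ⊤))
  exact ⟨b, hb, by rwa [← hab, add_sub_cancel_right]⟩

/-- Homomorphisms to a `P`-torsion module extend along inclusions with `Q`-torsion quotient. -/
theorem IsDedekindLike.exists_extension (hR : IsDedekindLike R) {P Q : Ideal R}
    (hP : IsFinitePrimitive P) (hQ : IsFinitePrimitive Q) (hPQ : P ≠ Q) {M K : Type*}
    [AddCommGroup M] [Module R M] [AddCommGroup K] [Module R K] {N : Submodule R M}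
    (hN : ∀ b ∈ Q, ∀ m : M, b • m ∈ N) (hK : P ≤ Module.annihilator R K) (α : N →ₗ[R] K) :
    ∃ β : M →ₗ[R] K, β.comp N.subtype = α := by
  have h2P := hP.isTwoSided
  have h2Q := hQ.isTwoSided
  obtain ⟨b, hbQ, hbP⟩ := hP.exists_mem_one_sub_mem hQ hPQ
  -- The extension will be `m ↦ α (b • m)`. It is linear because `b r - r b` lies in `P ∩ Q`, hence
  -- in `P Q`, and `α` kills `P Q M`: `Q M ⊆ N`, and `P` annihilates `K`.
  have hzero : ∀ x ∈ AddSubgroup.closure {y : R | ∃ a ∈ P, ∃ b ∈ Q, y = a * b}, ∀ m : M,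
      ∃ h : x • m ∈ N, α ⟨x • m, h⟩ = 0 := by
    intro x hx m
    induction hx using AddSubgroup.closure_induction with
    | mem x hx =>
      obtain ⟨a, ha, c, hc, rfl⟩ := hx
      refine ⟨by rw [mul_smul]; exact N.smul_mem a (hN c hc m), ?_⟩
      have : (⟨(a * c) • m, by rw [mul_smul]; exact N.smul_mem a (hN c hc m)⟩ : N)
          = a • ⟨c • m, hN c hc m⟩ := Subtype.ext (mul_smul a c m)
      rw [this, map_smul]
      exact Module.mem_annihilator.1 (hK ha) _
    | zero =>
      refine ⟨by rw [zero_smul]; exact N.zero_mem, ?_⟩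
      rw [← map_zero α]
      congr 1
      exact Subtype.ext (zero_smul R m)
    | add x y _ _ ihx ihy =>
      obtain ⟨h1, h2⟩ := ihx
      obtain ⟨h3, h4⟩ := ihy
      refine ⟨by rw [add_smul]; exact N.add_mem h1 h3, ?_⟩
      have : (⟨(x + y) • m, by rw [add_smul]; exact N.add_mem h1 h3⟩ : N)
          = ⟨x • m, h1⟩ + ⟨y • m, h3⟩ := Subtype.ext (add_smul x y m)
      rw [this, map_add, h2, h4, add_zero]
    | neg x _ ihx =>
      obtain ⟨h1, h2⟩ := ihx
      refine ⟨by rw [neg_smul]; exact N.neg_mem h1, ?_⟩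
      have : (⟨(-x) • m, by rw [neg_smul]; exact N.neg_mem h1⟩ : N)
          = -⟨x • m, h1⟩ := Subtype.ext (neg_smul x m)
      rw [this, map_neg, h2, neg_zero]
  refine ⟨{ toFun := fun m => α ⟨b • m, hN b hbQ m⟩, map_add' := ?_, map_smul' := ?_ }, ?_⟩
  · intro m m'
    rw [← map_add]
    congr 1
    exact Subtype.ext (smul_add b m m')
  · intro r m
    have hxQ : b * r - r * b ∈ Q := Q.sub_mem (Q.mul_mem_right r hbQ) (Q.mul_mem_left r hbQ)
    have hxP : b * r - r * b ∈ P := by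
      have : b * r - r * b = r * (1 - b) - (1 - b) * r := by noncomm_ring
      rw [this]
      exact P.sub_mem (P.mul_mem_left r hbP) (P.mul_mem_right r hbP)
    obtain ⟨h1, h2⟩ := hzero _ (hR.mem_closure P Q hP hQ hPQ _ hxP hxQ) m
    rw [RingHom.id_apply, ← map_smul, ← sub_eq_zero, ← map_sub, ← h2]
    congr 1
    refine Subtype.ext ?_
    simp [sub_smul, mul_smul]
  · ext n
    change α ⟨b • (n : M), _⟩ = α n
    have h1 : (1 - b) • α n = 0 := Module.mem_annihilator.1 (hK hbP) _
    rw [sub_smul, one_smul, sub_eq_zero] at h1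
    rw [h1, ← map_smul]
    rfl

end Hereditary

/-! ### Homomorphisms from finite-index submodules to finite modules -/

section HomCount

variable {R : Type u} [Ring R]

/-- Kernels of maps to a simple module `L` have as many homomorphisms to a simple module
that is not isomorphic to `L`. -/
theorem IsDedekindLike.card_hom_ker_eq_of_not_iso (hR : IsDedekindLike R) {M K L : Type*}
    [AddCommGroup M] [Module R M] [AddCommGroup K] [Module R K] [AddCommGroup L] [Module R L]
    [Finite K] [Finite L] [IsSimpleModule R K] [IsSimpleModule R L]
    (hKL : ¬ Nonempty (L ≃ₗ[R] K)) (f : M →ₗ[R] L) (hf : Function.Surjective f) :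
    Nat.card (LinearMap.ker f →ₗ[R] K) = Nat.card (M →ₗ[R] K) := by
  symm
  -- Restriction is bijective: two extensions differ by a map that factors through `L`, hence by
  -- zero, and extensions exist because `K` and `L` have distinct annihilators.
  refine Nat.card_congr (Equiv.ofBijective
    (fun β : M →ₗ[R] K => β.comp (LinearMap.ker f).subtype) ⟨?_, ?_⟩)
  · intro β β' h
    have hker : LinearMap.ker f ≤ LinearMap.ker (β - β') := fun x hx => by
      rw [LinearMap.mem_ker, LinearMap.sub_apply, sub_eq_zero]
      exact LinearMap.congr_fun h ⟨x, hx⟩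
    let e := f.quotKerEquivOfSurjective hf
    have hz := eq_zero_of_not_linearEquiv hKL
      (((LinearMap.ker f).liftQ (β - β') hker).comp e.symm.toLinearMap)
    rw [← sub_eq_zero]
    ext x
    have := LinearMap.congr_fun hz (e (Submodule.Quotient.mk x))
    simpa using this
  · intro α
    refine hR.exists_extension (isFinitePrimitive_annihilator K) (isFinitePrimitive_annihilator L)
      (fun h => hKL (nonempty_linearEquiv_of_annihilator_le h.ge)) ?_ le_rfl α
    intro b hb m
    rw [LinearMap.mem_ker, map_smul]
    exact Module.mem_annihilator.1 hb _

/-- By Schanuel, the ratio of `|Hom(ker f, K)|` to `|Hom(M, K)|` is the same for all surjections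
from projective modules to modules isomorphic to `K`. It remains to see that this common ratio is 1.
-/
theorem card_hom_ker_mul_of_iso {M N K L : Type*} [AddCommGroup M] [Module R M] [AddCommGroup N]
    [Module R N] [AddCommGroup K] [Module R K] [AddCommGroup L] [Module R L]
    [Module.Projective R M] [Module.Projective R N] (e : L ≃ₗ[R] K) (f : M →ₗ[R] L)
    (hf : Function.Surjective f) (g : N →ₗ[R] K) (hg : Function.Surjective g) :
    Nat.card (LinearMap.ker f →ₗ[R] K) * Nat.card (N →ₗ[R] K) =
      Nat.card (M →ₗ[R] K) * Nat.card (LinearMap.ker g →ₗ[R] K) := by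
  have hker : LinearMap.ker (e.toLinearMap.comp f) = LinearMap.ker f :=
    LinearEquiv.ker_comp e f
  obtain ⟨s⟩ := schanuel (e.toLinearMap.comp f) g (e.surjective.comp hf) hg
  rw [← card_hom_prod, ← card_hom_prod, ← Nat.card_congr (homCongrLeft K s),
    Nat.card_congr (homCongrLeft K ((LinearEquiv.ofEq _ _ hker).prodCongr (LinearEquiv.refl R N)))]

/-- A surjection of `R` onto a simple module `K` has a kernel with as many homomorphisms to `K` as
`R` itself. -/
theorem IsDedekindLike.card_hom_ker_eq_self [IsNoetherianRing R] (hR : IsDedekindLike R)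
    {K : Type w} [AddCommGroup K] [Module R K] [Finite K] [IsSimpleModule R K] (g : R →ₗ[R] K)
    (hg : Function.Surjective g) :
    Nat.card (LinearMap.ker g →ₗ[R] K) = Nat.card (R →ₗ[R] K) := by
  set k := Nat.card K with hk
  have hk0 : k ≠ 0 := Nat.card_pos.ne'
  obtain ⟨d, hd⟩ := hR.exists_card_quotient_le
  have hfin := (hd k hk0).1
  have hkI : ∀ r : R, r * k ∈ LinearMap.ker g := fun r => by
    rw [LinearMap.mem_ker, ← Nat.cast_comm, ← smul_eq_mul, map_smul, Nat.cast_smul_eq_nsmul,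
      hk, card_nsmul_eq_zero']
  let q := (Ideal.span {(k : R)}).mkQ.comp (LinearMap.ker g).subtype
  let f := q.rangeRestrict
  have hf : Function.Surjective f := LinearMap.surjective_rangeRestrict q
  have hI := hR.isFGProjective_ker g hg isFGProjective_self
  let a := Nat.card (R →ₗ[R] K)
  let b := Nat.card (LinearMap.ker g →ₗ[R] K)
  -- Descend from `ker g` to its submodule `k R ≃ R`. Every step with quotient `K` multiplies the
  -- number of homomorphisms by `b / a`, the others leave it unchanged; `n` counts the former. At
  -- the end the number is `a` again, so `b ^ (n + 1) = a ^ (n + 1)`.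
  have hmain := ker_induction (R := R)
    (fun M _ _ => IsFGProjective R M ∧ ∃ n : ℕ, b * b ^ n = a ^ n * Nat.card (M →ₗ[R] K))
    (fun M N _ _ _ _ e h => ⟨h.1.of_equiv e, by
      rw [← Nat.card_congr (homCongrLeft K e)]; exact h.2⟩)
    (fun M _ _ L _ _ _ _ f hf h => by
      refine ⟨hR.isFGProjective_ker_of_simple f hf h.1, ?_⟩
      obtain ⟨hM, n, hn⟩ := h
      have := hM.1
      by_cases hLK : Nonempty (L ≃ₗ[R] K)
      · obtain ⟨e⟩ := hLK
        have := card_hom_ker_mul_of_iso e f hf g hg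
        refine ⟨n + 1, ?_⟩
        change _ * a = _ * b at this
        calc b * b ^ (n + 1) = (b * b ^ n) * b := by ring
          _ = a ^ n * (Nat.card (M →ₗ[R] K) * b) := by rw [hn]; ring
          _ = _ := by rw [← this]; ring
      · exact ⟨n, by rw [hR.card_hom_ker_eq_of_not_iso hLK f hf, hn]⟩)
    _ (LinearMap.ker g) (LinearMap.range q) f hf rfl ⟨hI, 0, by simp [b]⟩
  obtain ⟨-, n, hn⟩ := hmain
  have e : R ≃ₗ[R] LinearMap.ker f := by
    refine LinearEquiv.ofBijective
      (LinearMap.toSpanSingleton R (LinearMap.ker f) ⟨⟨k, by simpa using hkI 1⟩, ?_⟩) ⟨?_, ?_⟩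
    · rw [LinearMap.ker_rangeRestrict, LinearMap.mem_ker]
      exact (Submodule.Quotient.mk_eq_zero _).2 (Ideal.mem_span_singleton_self _)
    · rw [← LinearMap.ker_eq_bot, Submodule.eq_bot_iff]
      intro r hr
      refine hR.natCast_mul_eq_zero k hk0 r ?_
      have := congrArg (fun x : LinearMap.ker f => ((x : LinearMap.ker g) : R)) (LinearMap.mem_ker.1 hr)
      rw [Nat.cast_comm]
      exact this
    · rintro ⟨⟨x, hx⟩, hx'⟩
      rw [LinearMap.ker_rangeRestrict, LinearMap.mem_ker] at hx'
      obtain ⟨r, rfl⟩ := Ideal.mem_span_singleton'.1 ((Submodule.Quotient.mk_eq_zero _).1 hx')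
      exact ⟨r, rfl⟩
  rw [← Nat.card_congr (homCongrLeft K e), ← pow_succ, ← pow_succ'] at hn
  exact Nat.pow_left_injective (Nat.succ_ne_zero n) (by simpa [a, mul_comm] using hn)

/-- Over a maximal order, projective modules have as many homomorphisms to a finite simple module
as their submodules of finite index. -/
theorem IsDedekindLike.card_hom_ker_eq_of_simple [IsNoetherianRing R] (hR : IsDedekindLike R)
    {M : Type u} {G K : Type w} [AddCommGroup M] [Module R M] [AddCommGroup G] [Module R G]
    [Finite G] [AddCommGroup K] [Module R K] [Finite K] [IsSimpleModule R K]
    (f : M →ₗ[R] G) (hf : Function.Surjective f) (hM : IsFGProjective R M) :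
    Nat.card (LinearMap.ker f →ₗ[R] K) = Nat.card (M →ₗ[R] K) := by
  have := IsSimpleModule.nontrivial R K
  obtain ⟨x, hx⟩ := exists_ne (0 : K)
  let g := LinearMap.toSpanSingleton R K x
  have hg : Function.Surjective g := IsSimpleModule.toSpanSingleton_surjective R hx
  exact (ker_induction (R := R)
    (fun N _ _ => IsFGProjective R N ∧ Nat.card (N →ₗ[R] K) = Nat.card (M →ₗ[R] K))
    (fun M N _ _ _ _ e h => ⟨h.1.of_equiv e, by
      rw [← Nat.card_congr (homCongrLeft K e)]; exact h.2⟩)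
    (fun N _ _ L _ _ _ _ f hf h => by
      refine ⟨hR.isFGProjective_ker_of_simple f hf h.1, ?_⟩
      have := h.1.1
      rw [← h.2]
      by_cases hLK : Nonempty (L ≃ₗ[R] K)
      · obtain ⟨e⟩ := hLK
        have := card_hom_ker_mul_of_iso e f hf g hg
        rw [hR.card_hom_ker_eq_self g hg] at this
        exact Nat.eq_of_mul_eq_mul_right (card_hom_pos R K) this
      · exact hR.card_hom_ker_eq_of_not_iso hLK f hf)
    _ M G f hf rfl ⟨hM, rfl⟩).2

/-- Over a maximal order, projective modules have as many homomorphisms to a finite module as their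
submodules of finite index. -/
theorem IsDedekindLike.card_hom_ker_eq [IsNoetherianRing R] (hR : IsDedekindLike R)
    {M : Type u} {G : Type w} [AddCommGroup M] [Module R M] [AddCommGroup G] [Module R G]
    [Finite G] (f : M →ₗ[R] G) (hf : Function.Surjective f) (hM : IsFGProjective R M) (n : ℕ) :
    ∀ (N : Type w) [AddCommGroup N] [Module R N] [Finite N], Nat.card N = n →
      Nat.card (LinearMap.ker f →ₗ[R] N) = Nat.card (M →ₗ[R] N) := by
  have hMp := hM.1
  have hfp := (hR.isFGProjective_ker f hf hM).1
  induction n using Nat.strong_induction_on with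
  | _ n ih =>
    intro N _ _ _ hn
    rcases subsingleton_or_nontrivial N with hN | hN
    · have h1 : ∀ (M' : Type u) [AddCommGroup M'] [Module R M'], Subsingleton (M' →ₗ[R] N) :=
        fun M' _ _ => ⟨fun a b => LinearMap.ext fun x => Subsingleton.elim _ _⟩
      have := h1 M
      have := h1 (LinearMap.ker f)
      simp
    · obtain ⟨m, hm⟩ := exists_simple_quotient_of_finite (R := R) N
      have : Finite (N ⧸ m) := Finite.of_surjective _ (Submodule.mkQ_surjective m)
      have := IsSimpleModule.nontrivial R (N ⧸ m)
      have hcard : Nat.card (LinearMap.ker m.mkQ) < n := by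
        rw [← hn, Submodule.ker_mkQ, Submodule.card_eq_card_quotient_mul_card m]
        have h1 : 1 < Nat.card (N ⧸ m) := Finite.one_lt_card
        have h2 : 0 < Nat.card m := Nat.card_pos
        nlinarith
      -- Since `M` and the kernel of `f` are projective, both sides are multiplicative along `0 → m
      -- → N → N ⧸ m → 0`.
      rw [card_hom_eq_mul m.mkQ (Submodule.mkQ_surjective m),
        card_hom_eq_mul m.mkQ (Submodule.mkQ_surjective m), ih _ hcard _ rfl,
        hR.card_hom_ker_eq_of_simple f hf hM]

/-- In terms of the presentation `f` of `G`, this is the equality of the orders of `Ext¹(G, N)` and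
`Hom(G, N)`. -/
theorem IsDedekindLike.card_hom_ker_pi [IsNoetherianRing R] (hR : IsDedekindLike R) {d : ℕ}
    {G N : Type w} [AddCommGroup G] [Module R G] [Finite G] [AddCommGroup N] [Module R N]
    [Finite N] (f : (Fin d → R) →ₗ[R] G) (hf : Function.Surjective f) :
    Nat.card (LinearMap.ker f →ₗ[R] N) = Nat.card N ^ d := by
  rw [hR.card_hom_ker_eq f hf ⟨inferInstance, inferInstance⟩ _ N rfl, card_hom_pi]

end HomCount

/-! ### Isomorphism classes, and counting up to automorphisms -/

section IsoClasses

variable (R : Type u) [Ring R]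

/-- Isomorphism of finite modules, as an equivalence relation. -/
def isoSetoid : Setoid (FiniteModule R) where
  r := Iso
  iseqv := ⟨fun _ => ⟨LinearEquiv.refl _ _⟩, fun ⟨e⟩ => ⟨e.symm⟩, fun ⟨e⟩ ⟨f⟩ => ⟨e.trans f⟩⟩

/-- The isomorphism classes of finite modules. -/
def IsoClass : Type (max 1 u) := Quotient (isoSetoid R)

variable {R}

/-- A representative of an isomorphism class. -/
noncomputable def IsoClass.out (E : IsoClass R) : FiniteModule R := Quotient.out E

/-- The isomorphism class of a finite module. -/
def FiniteModule.toClass (G : FiniteModule R) : IsoClass R := Quotient.mk (isoSetoid R) G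

theorem FiniteModule.toClass_eq_iff {G H : FiniteModule R} : G.toClass = H.toClass ↔ Iso G H :=
  Quotient.eq (r := isoSetoid R)

theorem FiniteModule.iso_out (G : FiniteModule R) : Iso G.toClass.out G :=
  Quotient.mk_out (s := isoSetoid R) G

theorem IsoClass.toClass_out (E : IsoClass R) : E.out.toClass = E := Quotient.out_eq E

theorem IsoClass.iso_out_iff {E : IsoClass R} {G : FiniteModule R} :
    Iso E.out G ↔ E = G.toClass := by
  rw [← FiniteModule.toClass_eq_iff, E.toClass_out]

/-- A finite module over `R` in any universe, as a `FiniteModule R`. -/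
noncomputable def FiniteModule.ofFinite (M : Type v) [AddCommGroup M] [Module R M] [Finite M] :
    FiniteModule R where
  carrier := Shrink.{0} M

/-- A finite module is isomorphic to its model in `Type`. -/
noncomputable def FiniteModule.ofFiniteEquiv (M : Type v) [AddCommGroup M] [Module R M] [Finite M] :
    FiniteModule.ofFinite (R := R) M ≃ₗ[R] M := Shrink.linearEquiv.{0} R M

instance finite_linearEquiv {M N : Type*} [AddCommGroup M] [Module R M] [AddCommGroup N]
    [Module R N] [Finite M] [Finite N] : Finite (M ≃ₗ[R] N) := DFunLike.finite _

theorem autCount_pos (G : FiniteModule R) : 0 < autCount G :=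
  Nat.card_pos (α := G ≃ₗ[R] G)

theorem autCount_ne_zero (G : FiniteModule R) : (autCount G : ℝ≥0∞) ≠ 0 := by
  exact_mod_cast (autCount_pos G).ne'

theorem autCount_congr {G H : FiniteModule R} (e : G ≃ₗ[R] H) : autCount G = autCount H :=
  Nat.card_congr ⟨fun a => (e.symm.trans a).trans e, fun a => (e.trans a).trans e.symm,
    fun a => by ext; simp, fun a => by ext; simp⟩

theorem surCount_congr {G G' H H' : FiniteModule R} (e : G ≃ₗ[R] G') (f : H ≃ₗ[R] H') :
    surCount G H = surCount G' H' := by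
  refine Nat.card_congr (Equiv.subtypeEquiv ((homCongrLeft _ e).trans (homCongrRight _ f)) ?_)
  intro a
  simp [homCongrLeft, homCongrRight]

/-- Weighted by the inverse orders of the automorphism groups, a finite module has exactly one
isomorphism to a representative of an isomorphism class. -/
theorem tsum_card_linearEquiv_div_autCount (M : Type v) [AddCommGroup M] [Module R M] [Finite M] :
    ∑' E : IsoClass R, (Nat.card (E.out ≃ₗ[R] M) : ℝ≥0∞) / autCount E.out = 1 := by
  set G := FiniteModule.ofFinite (R := R) M
  have e := FiniteModule.ofFiniteEquiv (R := R) M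
  obtain ⟨s⟩ := G.iso_out
  rw [tsum_eq_single G.toClass]
  · have : Nat.card (G.toClass.out ≃ₗ[R] M) = autCount G.toClass.out := by
      refine Nat.card_congr ⟨fun a => a.trans (s.trans e).symm, fun a => a.trans (s.trans e), ?_, ?_⟩
      · intro a; ext; simp
      · intro a; ext; simp
    rw [this]
    exact ENNReal.div_self (autCount_ne_zero _) (ENNReal.natCast_ne_top _)
  · intro E hE
    have : IsEmpty (E.out ≃ₗ[R] M) := ⟨fun a => hE (IsoClass.iso_out_iff.1 ⟨a.trans e.symm⟩)⟩
    simp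

/-- Counting by orbits of automorphism groups. -/
theorem tsum_card_div_autCount {Z : Type*} [Finite Z] (M : Z → Type v) [∀ z, AddCommGroup (M z)]
    [∀ z, Module R (M z)] [∀ z, Finite (M z)] (X : IsoClass R → Type*)
    (e : ∀ E, Nonempty (X E ≃ Σ z, (E.out ≃ₗ[R] M z))) :
    ∑' E : IsoClass R, (Nat.card (X E) : ℝ≥0∞) / autCount E.out = Nat.card Z := by
  have := Fintype.ofFinite Z
  have h : ∀ E, (Nat.card (X E) : ℝ≥0∞) / autCount E.out
      = ∑' z, (Nat.card (E.out ≃ₗ[R] M z) : ℝ≥0∞) / autCount E.out := fun E => by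
    obtain ⟨e⟩ := e E
    rw [Nat.card_congr e, Nat.card_sigma, tsum_fintype]
    push_cast
    simp only [div_eq_mul_inv, Finset.sum_mul]
  simp_rw [h]
  rw [ENNReal.tsum_comm]
  simp_rw [tsum_card_linearEquiv_div_autCount]
  simp [Nat.card_eq_fintype_card]

end IsoClasses

/-! ### Surjections onto extensions as pairs of surjections -/

section ShortExact

variable {R : Type u} [Ring R]

theorem exists_factor {B E G : Type*} [AddCommGroup B] [Module R B] [AddCommGroup E] [Module R E]
    [AddCommGroup G] [Module R G] (χ : B →ₗ[R] E) (hχ : Function.Surjective χ) (φ : B →ₗ[R] G)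
    (h : ∀ b, χ b = 0 → φ b = 0) : ∃ π : E →ₗ[R] G, ∀ b, π (χ b) = φ b := by
  let e := χ.quotKerEquivOfSurjective hχ
  refine ⟨((LinearMap.ker χ).liftQ φ fun b hb => h b hb).comp e.symm.toLinearMap, fun b => ?_⟩
  have : e.symm (χ b) = Submodule.Quotient.mk b := by
    rw [LinearEquiv.symm_apply_eq]
    rfl
  rw [LinearMap.comp_apply, LinearEquiv.coe_coe, this]
  rfl

/-- Surjections with kernel `N` are the isomorphisms with the quotient by `N`. -/
noncomputable def surjectionEquiv {B E : Type*} [AddCommGroup B] [Module R B] [AddCommGroup E]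
    [Module R E] (N : Submodule R B) :
    {χ : B →ₗ[R] E // Function.Surjective χ ∧ LinearMap.ker χ = N} ≃ (E ≃ₗ[R] (B ⧸ N)) where
  toFun χ := ((Submodule.quotEquivOfEq _ _ χ.2.2.symm).trans
    (χ.1.quotKerEquivOfSurjective χ.2.1)).symm
  invFun e := ⟨e.symm.toLinearMap.comp N.mkQ, e.symm.surjective.comp N.mkQ_surjective, by
    rw [LinearEquiv.ker_comp, Submodule.ker_mkQ]⟩
  left_inv χ := by
    ext b
    rfl
  right_inv e := by
    ext x
    rw [LinearEquiv.symm_apply_eq]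
    obtain ⟨b, hb⟩ := Submodule.Quotient.mk_surjective _ (e x)
    rw [← hb]
    change x = e.symm (Submodule.Quotient.mk b)
    rw [hb, LinearEquiv.symm_apply_apply]

/-- Short exact sequences `0 → K → E → G → 0`. -/
@[ext]
structure ShortExactSeq (R : Type u) [Ring R] (K E G : Type*) [AddCommGroup K] [Module R K]
    [AddCommGroup E] [Module R E] [AddCommGroup G] [Module R G] where
  /-- The inclusion of the kernel. -/
  inc : K →ₗ[R] E
  /-- The projection to the quotient. -/
  proj : E →ₗ[R] G
  inc_injective : Function.Injective inc
  proj_surjective : Function.Surjective proj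
  exact : ∀ x, proj x = 0 ↔ ∃ k, inc k = x

variable {H K E G : Type*} [AddCommGroup H] [Module R H] [AddCommGroup K] [Module R K]
    [AddCommGroup E] [Module R E] [AddCommGroup G] [Module R G]

theorem ShortExactSeq.proj_inc (s : ShortExactSeq R K E G) (k : K) : s.proj (s.inc k) = 0 :=
  (s.exact _).2 ⟨k, rfl⟩

/-- Surjections `H → G` together with a surjection of the kernel to `K`. -/
structure SurPair (R : Type u) [Ring R] (H K G : Type*) [AddCommGroup H] [Module R H]
    [AddCommGroup K] [Module R K] [AddCommGroup G] [Module R G] where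
  /-- The surjection to `G`. -/
  φ : H →ₗ[R] G
  φ_surjective : Function.Surjective φ
  /-- The surjection from the kernel. -/
  ψ : LinearMap.ker φ →ₗ[R] K
  ψ_surjective : Function.Surjective ψ

theorem SurPair.ext' {z z' : SurPair R H K G} (h : ∀ x, z.φ x = z'.φ x)
    (h' : ∀ x (hx : z.φ x = 0) (hx' : z'.φ x = 0), z.ψ ⟨x, hx⟩ = z'.ψ ⟨x, hx'⟩) : z = z' := by
  obtain ⟨φ, hφ, ψ, hψ⟩ := z
  obtain ⟨φ', hφ', ψ', hψ'⟩ := z'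
  obtain rfl : φ = φ' := LinearMap.ext h
  obtain rfl : ψ = ψ' := LinearMap.ext fun x => h' x x.2 x.2
  rfl

theorem SurPair.ψ_congr {z z' : SurPair R H K G} (h : z = z') (x : H) (hx : z.φ x = 0)
    (hx' : z'.φ x = 0) : z.ψ ⟨x, hx⟩ = z'.ψ ⟨x, hx'⟩ := by
  subst h
  rfl

/-- The kernel of the second surjection, in `H`. -/
def SurPair.kernel (z : SurPair R H K G) : Submodule R H :=
  (LinearMap.ker z.ψ).map (LinearMap.ker z.φ).subtype

theorem SurPair.mem_kernel {z : SurPair R H K G} {x : H} :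
    x ∈ z.kernel ↔ ∃ h : z.φ x = 0, z.ψ ⟨x, h⟩ = 0 := by
  constructor
  · rintro ⟨y, hy, rfl⟩
    exact ⟨y.2, hy⟩
  · rintro ⟨h, h'⟩
    exact ⟨⟨x, h⟩, h', rfl⟩

/-- `z` is obtained from the surjection `χ` and the short exact sequence `s`. -/
def IsInduced (χ : H →ₗ[R] E) (s : ShortExactSeq R K E G) (z : SurPair R H K G) : Prop :=
  (∀ x, s.proj (χ x) = z.φ x) ∧ ∀ x (hx : z.φ x = 0), s.inc (z.ψ ⟨x, hx⟩) = χ x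

theorem IsInduced.ker_eq {χ : H →ₗ[R] E} {s : ShortExactSeq R K E G} {z : SurPair R H K G}
    (h : IsInduced χ s z) : LinearMap.ker χ = z.kernel := by
  ext x
  rw [LinearMap.mem_ker, SurPair.mem_kernel]
  constructor
  · intro hx
    have h0 : z.φ x = 0 := by rw [← h.1, hx, map_zero]
    refine ⟨h0, s.inc_injective ?_⟩
    rw [h.2, hx, map_zero]
  · rintro ⟨h0, h1⟩
    rw [← h.2 x h0, h1, map_zero]

theorem exists_isInduced (χ : H →ₗ[R] E) (hχ : Function.Surjective χ)
    (s : ShortExactSeq R K E G) : ∃ z, IsInduced χ s z := by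
  let φ := s.proj.comp χ
  have hr : ∀ x : LinearMap.ker φ, χ x ∈ LinearMap.range s.inc := fun x => (s.exact _).1 x.2
  let ι := LinearEquiv.ofInjective s.inc s.inc_injective
  let ψ : LinearMap.ker φ →ₗ[R] K :=
    ι.symm.toLinearMap.comp ((χ.comp (LinearMap.ker φ).subtype).codRestrict _ hr)
  have hψ : ∀ x : LinearMap.ker φ, s.inc (ψ x) = χ x := fun x => by
    have : ι (ψ x) = ⟨χ x, hr x⟩ := LinearEquiv.apply_symm_apply _ _
    exact congrArg Subtype.val this
  refine ⟨⟨φ, s.proj_surjective.comp hχ, ψ, ?_⟩, fun _ => rfl, fun x hx => hψ ⟨x, hx⟩⟩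
  intro k
  obtain ⟨x, hx⟩ := hχ (s.inc k)
  have hx0 : φ x = 0 := by simp [φ, hx, s.proj_inc]
  exact ⟨⟨x, hx0⟩, s.inc_injective (by rw [hψ]; exact hx)⟩

theorem IsInduced.pair_unique {χ : H →ₗ[R] E} {s : ShortExactSeq R K E G} {z z' : SurPair R H K G}
    (h : IsInduced χ s z) (h' : IsInduced χ s z') : z = z' :=
  SurPair.ext' (fun x => by rw [← h.1, h'.1])
    fun x hx hx' => s.inc_injective (by rw [h.2, h'.2])

theorem IsInduced.seq_unique {χ : H →ₗ[R] E} (hχ : Function.Surjective χ)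
    {s s' : ShortExactSeq R K E G} {z : SurPair R H K G}
    (h : IsInduced χ s z) (h' : IsInduced χ s' z) : s = s' := by
  refine ShortExactSeq.ext (LinearMap.ext fun k => ?_) (LinearMap.ext fun y => ?_)
  · obtain ⟨x, rfl⟩ := z.ψ_surjective k
    rw [h.2 x x.2, h'.2 x x.2]
  · obtain ⟨x, rfl⟩ := hχ y
    rw [h.1, h'.1]

theorem exists_seq_isInduced (χ : H →ₗ[R] E) (hχ : Function.Surjective χ) (z : SurPair R H K G)
    (hz : LinearMap.ker χ = z.kernel) : ∃ s, IsInduced χ s z := by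
  have hz' : ∀ x, χ x = 0 ↔ ∃ h : z.φ x = 0, z.ψ ⟨x, h⟩ = 0 := fun x => by
    rw [← LinearMap.mem_ker, hz, SurPair.mem_kernel]
  obtain ⟨π, hπ⟩ := exists_factor χ hχ z.φ fun b hb => ((hz' b).1 hb).1
  obtain ⟨i, hi⟩ := exists_factor z.ψ z.ψ_surjective (χ.comp (LinearMap.ker z.φ).subtype)
    fun b hb => (hz' b).2 ⟨b.2, hb⟩
  refine ⟨⟨i, π, ?_, ?_, ?_⟩, hπ, fun x hx => hi ⟨x, hx⟩⟩
  · rw [← LinearMap.ker_eq_bot, Submodule.eq_bot_iff]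
    intro k hk
    obtain ⟨x, rfl⟩ := z.ψ_surjective k
    rw [LinearMap.mem_ker, hi] at hk
    exact ((hz' x).1 hk).2
  · intro y
    obtain ⟨x, rfl⟩ := z.φ_surjective y
    exact ⟨χ x, hπ x⟩
  · intro y
    obtain ⟨x, rfl⟩ := hχ y
    rw [hπ]
    constructor
    · intro h
      exact ⟨z.ψ ⟨x, h⟩, hi _⟩
    · rintro ⟨k, hk⟩
      obtain ⟨w, rfl⟩ := z.ψ_surjective k
      rw [hi] at hk
      have h0 : χ ((w : H) - x) = 0 := by rw [map_sub, sub_eq_zero]; exact hk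
      have h1 := ((hz' _).1 h0).1
      rw [map_sub, LinearMap.mem_ker.1 w.2, zero_sub, neg_eq_zero] at h1
      exact h1

/-- Counting surjections onto extensions by counting pairs of surjections. -/
theorem tsum_card_isInduced_div_autCount (p : SurPair R H K G → Prop) [Finite {z // p z}] [Finite K]
    [Finite G] :
    ∑' E : IsoClass R, (Nat.card {x : (H →ₗ[R] E.out) × ShortExactSeq R K E.out G //
        Function.Surjective x.1 ∧ ∃ z, p z ∧ IsInduced x.1 x.2 z} : ℝ≥0∞) / autCount E.out
      = Nat.card {z // p z} := by
  -- `H` may be infinite, but the quotient by `z.kernel` is an extension of a copy of `G` by a copy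
  -- of `K`.
  have hfin : ∀ z : SurPair R H K G, Finite (H ⧸ z.kernel) := by
    intro z
    have h1 : Finite (H ⧸ LinearMap.ker z.φ) :=
      Finite.of_equiv _ (z.φ.quotKerEquivOfSurjective z.φ_surjective).symm.toEquiv
    have h2 : Finite (LinearMap.ker z.φ ⧸ LinearMap.ker z.ψ) :=
      Finite.of_equiv _ (z.ψ.quotKerEquivOfSurjective z.ψ_surjective).symm.toEquiv
    have hle : z.kernel ≤ LinearMap.ker z.φ := fun x hx => (SurPair.mem_kernel.1 hx).1
    let q : (H ⧸ z.kernel) →ₗ[R] H ⧸ LinearMap.ker z.φ :=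
      z.kernel.liftQ (LinearMap.ker z.φ).mkQ (by rwa [Submodule.ker_mkQ])
    have hq : Function.Surjective q := by
      intro y
      obtain ⟨x, rfl⟩ := Submodule.Quotient.mk_surjective _ y
      exact ⟨Submodule.Quotient.mk x, rfl⟩
    let r : LinearMap.ker z.φ ⧸ LinearMap.ker z.ψ →ₗ[R] LinearMap.ker q :=
      (LinearMap.ker z.ψ).liftQ
        ((z.kernel.mkQ.comp (LinearMap.ker z.φ).subtype).codRestrict _ fun x =>
          (Submodule.Quotient.mk_eq_zero _).2 x.2)
        (fun x hx => Subtype.ext ((Submodule.Quotient.mk_eq_zero _).2 ⟨x, hx, rfl⟩))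
    have hr : Function.Surjective r := by
      rintro ⟨y, hy⟩
      obtain ⟨x, rfl⟩ := Submodule.Quotient.mk_surjective _ y
      have hx : x ∈ LinearMap.ker z.φ := (Submodule.Quotient.mk_eq_zero _).1 hy
      exact ⟨Submodule.Quotient.mk ⟨x, hx⟩, rfl⟩
    have h3 : Finite (LinearMap.ker q) := Finite.of_surjective r hr
    refine Nat.finite_of_card_ne_zero ?_
    rw [natCard_eq_ker_mul q.toAddMonoidHom hq]
    have h4 : Nat.card q.toAddMonoidHom.ker ≠ 0 := (Nat.card_pos (α := LinearMap.ker q)).ne'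
    exact mul_ne_zero h4 Nat.card_pos.ne'
  refine tsum_card_div_autCount (Z := {z // p z}) (fun z => H ⧸ z.1.kernel) _ fun E => ⟨?_⟩
  -- For a surjection `χ` with kernel `z.kernel` there is exactly one sequence that induces `z`
  -- together with `χ`, and these `χ` correspond to isomorphisms of `E` with `H ⧸ z.kernel`. So each
  -- `z` contributes 1 to the weighted sum.
  refine Equiv.trans ?_ (Equiv.sigmaCongrRight fun z : {z // p z} => surjectionEquiv z.1.kernel)
  choose t ht using fun x : Σ z : {z // p z}, {χ : H →ₗ[R] E.out //
    Function.Surjective χ ∧ LinearMap.ker χ = z.1.kernel} =>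
      exists_seq_isInduced x.2.1 x.2.2.1 x.1.1 x.2.2.2
  refine (Equiv.ofBijective (fun x => ⟨(x.2.1, t x), x.2.2.1, x.1.1, x.1.2, ht x⟩) ⟨?_, ?_⟩).symm
  · rintro ⟨⟨z, hz⟩, χ, hχ⟩ ⟨⟨z', hz'⟩, χ', hχ'⟩ h
    have h1 := congrArg Subtype.val h
    obtain rfl : χ = χ' := congrArg Prod.fst h1
    have h2 := ht ⟨⟨z', hz'⟩, χ, hχ'⟩
    have h3 : t ⟨⟨z, hz⟩, χ, hχ⟩ = t ⟨⟨z', hz'⟩, χ, hχ'⟩ := congrArg Prod.snd h1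
    rw [← h3] at h2
    obtain rfl : z = z' := (ht ⟨⟨z, hz⟩, χ, hχ⟩).pair_unique h2
    rfl
  · rintro ⟨⟨χ, s⟩, hχ, z, hz, hi⟩
    refine ⟨⟨⟨z, hz⟩, χ, hχ, hi.ker_eq⟩, Subtype.ext (Prod.ext rfl ?_)⟩
    exact (ht ⟨⟨z, hz⟩, χ, hχ, hi.ker_eq⟩).seq_unique hχ hi

end ShortExact

/-! ### The weighted number of extensions is one -/

section Moments

variable {R : Type u} [Ring R]

/-- The number of short exact sequences `0 → K → E → G → 0`. -/
noncomputable def seqCount (K E G : FiniteModule R) : ℕ := Nat.card (ShortExactSeq R K E G)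

/-- Injections with image `N` are the isomorphisms with `N`. -/
noncomputable def injectionEquiv {K E : Type*} [AddCommGroup K] [Module R K] [AddCommGroup E]
    [Module R E] (N : Submodule R E) :
    {i : K →ₗ[R] E // Function.Injective i ∧ LinearMap.range i = N} ≃ (K ≃ₗ[R] N) where
  toFun i := (LinearEquiv.ofInjective i.1 i.2.1).trans (LinearEquiv.ofEq _ _ i.2.2)
  invFun e := ⟨N.subtype.comp e.toLinearMap, N.injective_subtype.comp e.injective, by
    rw [LinearMap.range_comp, LinearEquiv.range, Submodule.map_top, Submodule.range_subtype]⟩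
  left_inv i := by
    ext
    rfl
  right_inv e := by
    ext
    rfl

/-- Counting surjections by their kernels. -/
theorem tsum_seqCount_div_autCount (H G : FiniteModule R) :
    ∑' K : IsoClass R, (seqCount K.out H G : ℝ≥0∞) / autCount K.out = surCount H G := by
  have : Finite (H →ₗ[R] G) := DFunLike.finite _
  refine tsum_card_div_autCount (Z := {f : H →ₗ[R] G // Function.Surjective f})
    (fun f => LinearMap.ker f.1) _ fun K => ⟨?_⟩
  refine Equiv.trans ?_ (Equiv.sigmaCongrRight
    fun f : {f : H →ₗ[R] G // Function.Surjective f} => injectionEquiv (LinearMap.ker f.1))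
  exact {
    toFun := fun s => ⟨⟨s.proj, s.proj_surjective⟩, s.inc, s.inc_injective, by
      ext x
      rw [LinearMap.mem_ker, s.exact]
      rfl⟩
    invFun := fun x => ⟨x.2.1, x.1.1, x.2.2.1, x.1.2, fun y => (SetLike.ext_iff.1 x.2.2.2 y).symm⟩
    left_inv := fun s => rfl
    right_inv := fun x => rfl }

/-- Over a maximal order, the extensions of `G` by `K`, weighted by the inverse orders of their
automorphism groups, have total mass one. -/
theorem IsDedekindLike.tsum_seqCount_div_autCount_eq_one [IsNoetherianRing R]
    (hR : IsDedekindLike R) (K G : FiniteModule R) :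
    ∑' E : IsoClass R, (seqCount K E.out G : ℝ≥0∞) / autCount E.out = 1 := by
  obtain ⟨d, f, hf⟩ := Module.Finite.exists_fin' R G
  have hKd : Nat.card (LinearMap.ker f →ₗ[R] K) = Nat.card K ^ d := hR.card_hom_ker_pi f hf
  have hfg : IsFGProjective R (LinearMap.ker f) :=
    hR.isFGProjective_ker f hf ⟨inferInstance, inferInstance⟩
  have := hfg.2
  have hfin : Finite (LinearMap.ker f →ₗ[R] K) := finite_linearMap
  -- Double counting on `K × R^d`: the admissible surjections onto extensions restrict to the
  -- inclusion on `K` and lift `f` on `R^d`. In terms of pairs, `φ` is `f` on the second factor and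
  -- `ψ` is the identity on `K`.
  let p : SurPair R (K × (Fin d → R)) K G → Prop := fun z =>
    (∀ x, z.φ x = f x.2) ∧ ∀ k (h : z.φ (k, 0) = 0), z.ψ ⟨(k, 0), h⟩ = k
  let φ₀ : K × (Fin d → R) →ₗ[R] G := f.comp (LinearMap.snd R _ _)
  have hφ₀ : Function.Surjective φ₀ := hf.comp Prod.snd_surjective
  let ψ₀ : (LinearMap.ker f →ₗ[R] K) → (LinearMap.ker φ₀ →ₗ[R] K) := fun α =>
    (LinearMap.fst R _ _).comp (LinearMap.ker φ₀).subtype +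
      α.comp (((LinearMap.snd R _ _).comp (LinearMap.ker φ₀).subtype).codRestrict _ fun x => x.2)
  have hψ₀ : ∀ α (x : LinearMap.ker φ₀), ψ₀ α x = x.1.1 + α ⟨x.1.2, x.2⟩ := fun α x => rfl
  have hψ₀' : ∀ α (k : K) (h : φ₀ (k, 0) = 0), ψ₀ α ⟨(k, 0), h⟩ = k := fun α k h => by
    rw [hψ₀]
    have : (⟨(k, (0 : Fin d → R)).2, h⟩ : LinearMap.ker f) = 0 := rfl
    rw [this, map_zero, add_zero]
  let toPair : (LinearMap.ker f →ₗ[R] K) → {z // p z} := fun α =>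
    ⟨⟨φ₀, hφ₀, ψ₀ α, fun k => ⟨⟨(k, 0), map_zero f⟩, hψ₀' α k _⟩⟩, fun _ => rfl,
      fun k h => hψ₀' α k h⟩
  -- As `ker φ₀ = K × ker f`, an admissible `ψ` is given by its restriction to `ker f`, an arbitrary
  -- homomorphism to `K`; there are `|K| ^ d` of them.
  have hbij : Function.Bijective toPair := by
    constructor
    · intro α β h
      have h1 : ∀ x : LinearMap.ker φ₀, ψ₀ α x = ψ₀ β x := fun x =>
        SurPair.ψ_congr (congrArg Subtype.val h) x x.2 x.2
      ext x
      have := h1 ⟨(0, x), x.2⟩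
      rw [hψ₀, hψ₀] at this
      simpa using this
    · rintro ⟨z, hz1, hz2⟩
      have hmem : ∀ x : LinearMap.ker f, ((0 : K), (x : Fin d → R)) ∈ LinearMap.ker z.φ := fun x => by
        rw [LinearMap.mem_ker, hz1]
        exact x.2
      let α : LinearMap.ker f →ₗ[R] K := z.ψ.comp
        (((LinearMap.inr R K (Fin d → R)).comp (LinearMap.ker f).subtype).codRestrict _ hmem)
      refine ⟨α, Subtype.ext (SurPair.ext' (fun x => (hz1 x).symm) ?_)⟩
      intro x hx hx'
      change ψ₀ α ⟨x, hx⟩ = _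
      rw [hψ₀]
      have h0 : z.φ (x.1, 0) = 0 := by rw [hz1]; exact map_zero f
      have h1 : z.φ (0, x.2) = 0 := hmem ⟨x.2, hx⟩
      have : (⟨x, hx'⟩ : LinearMap.ker z.φ) = ⟨(x.1, 0), h0⟩ + ⟨(0, x.2), h1⟩ :=
        Subtype.ext (by simp)
      rw [this, map_add, hz2]
      rfl
  have hZfin : Finite {z // p z} := Finite.of_surjective toPair hbij.2
  have hZ : Nat.card {z // p z} = Nat.card K ^ d := by
    rw [← hKd, Nat.card_congr (Equiv.ofBijective toPair hbij)]
  have key := tsum_card_isInduced_div_autCount (R := R) (H := K × (Fin d → R)) p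
  have hX : ∀ E : IsoClass R, Nat.card {x : (K × (Fin d → R) →ₗ[R] E.out) ×
      ShortExactSeq R K E.out G // Function.Surjective x.1 ∧ ∃ z, p z ∧ IsInduced x.1 x.2 z} =
      seqCount K E.out G * Nat.card K ^ d := by
    intro E
    choose g hg using fun s : ShortExactSeq R K E.out G =>
      Module.projective_lifting_property s.proj f s.proj_surjective
    have hg' : ∀ (s : ShortExactSeq R K E.out G) x, s.proj (g s x) = f x := fun s x => LinearMap.congr_fun (hg s) x
    rw [seqCount, ← card_hom_pi (R := R) d K, ← Nat.card_prod]
    symm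
    -- For a given sequence, lifts of `f` to `E` form a torsor under homomorphisms `R^d → K`, with
    -- base point the chosen lift `g`; this produces the factor `|K| ^ d` on the other side.
    let χ : ShortExactSeq R K E.out G × ((Fin d → R) →ₗ[R] K) → (K × (Fin d → R) →ₗ[R] E.out) :=
      fun y => y.1.inc.coprod (g y.1 + y.1.inc.comp y.2)
    have hχ : ∀ y x, χ y x = y.1.inc x.1 + (g y.1 x.2 + y.1.inc (y.2 x.2)) := fun y x => rfl
    have hχs : ∀ y, Function.Surjective (χ y) := by
      rintro ⟨s, t⟩ e
      obtain ⟨x, hx⟩ := hf (s.proj e)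
      have h0 : s.proj (e - g s x) = 0 := by rw [map_sub, hg', hx, sub_self]
      obtain ⟨k, hk⟩ := (s.exact _).1 h0
      refine ⟨(k - t x, x), ?_⟩
      rw [hχ, map_sub, hk]
      simp
    have hχp : ∀ y, ∃ z, p z ∧ IsInduced (χ y) y.1 z := by
      intro y
      obtain ⟨z, hz⟩ := exists_isInduced (χ y) (hχs y) y.1
      refine ⟨z, ⟨fun x => ?_, fun k h => ?_⟩, hz⟩
      · rw [← hz.1, hχ, map_add, map_add, hg', ShortExactSeq.proj_inc, ShortExactSeq.proj_inc]
        simp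
      · apply y.1.inc_injective
        rw [hz.2, hχ]
        simp
    refine Nat.card_congr (Equiv.ofBijective (fun y => ⟨(χ y, y.1), hχs y, hχp y⟩) ⟨?_, ?_⟩)
    · rintro ⟨s, t⟩ ⟨s', t'⟩ h
      have h1 := congrArg Subtype.val h
      obtain rfl : s = s' := congrArg Prod.snd h1
      have h2 : χ (s, t) = χ (s, t') := congrArg Prod.fst h1
      refine Prod.ext rfl (LinearMap.ext fun x => s.inc_injective ?_)
      have h3 := LinearMap.congr_fun h2 (0, x)
      rw [hχ, hχ] at h3
      simpa using h3
    · rintro ⟨⟨c, s⟩, hc, z, ⟨hz1, hz2⟩, hi⟩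
      have h0 : ∀ x, s.proj (c (0, x) - g s x) = 0 := fun x => by
        rw [map_sub, hi.1, hz1, hg', sub_self]
      have hr : ∀ x, (c.comp (LinearMap.inr R K (Fin d → R)) - g s) x ∈ LinearMap.range s.inc :=
        fun x => (s.exact _).1 (h0 x)
      let ι := LinearEquiv.ofInjective s.inc s.inc_injective
      let t : (Fin d → R) →ₗ[R] K := ι.symm.toLinearMap.comp (LinearMap.codRestrict _ _ hr)
      have ht : ∀ x, s.inc (t x) = c (0, x) - g s x := fun x => by
        have : ι (t x) = ⟨_, hr x⟩ := LinearEquiv.apply_symm_apply _ _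
        exact congrArg Subtype.val this
      refine ⟨(s, t), Subtype.ext (Prod.ext (LinearMap.ext fun x => ?_) rfl)⟩
      change χ (s, t) x = c x
      have hk : z.φ (x.1, 0) = 0 := by rw [hz1]; exact map_zero f
      have h2 := hi.2 _ hk
      rw [hz2] at h2
      rw [hχ, ht, h2, add_sub_cancel, ← map_add]
      simp
  simp_rw [hX, hZ] at key
  push_cast at key
  have hpow0 : ((Nat.card K : ℝ≥0∞) ^ d) ≠ 0 := pow_ne_zero _ (by exact_mod_cast Nat.card_pos.ne')
  have hpowT : ((Nat.card K : ℝ≥0∞) ^ d) ≠ ⊤ := ENNReal.pow_ne_top (ENNReal.natCast_ne_top _)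
  have h2 : (∑' E : IsoClass R, (seqCount K E.out G : ℝ≥0∞) / autCount E.out)
      * (Nat.card K : ℝ≥0∞) ^ d = (Nat.card K : ℝ≥0∞) ^ d := by
    rw [← ENNReal.tsum_mul_right]
    refine Eq.trans (tsum_congr fun E => ?_) key
    simp only [div_eq_mul_inv]
    ring
  have := congrArg (fun x => x / (Nat.card K : ℝ≥0∞) ^ d) h2
  simpa [ENNReal.mul_div_cancel_right hpow0 hpowT, ENNReal.div_self hpow0 hpowT] using this

end Moments

/-! ### Modules without homomorphisms to prescribed simple modules -/

section HomFree

variable {R : Type u} [Ring R]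

variable (R) in
/-- The isomorphism classes of finite simple modules. -/
def SimpleClass : Type (max 1 u) := {E : IsoClass R // IsSimpleModule R E.out}

/-- A representative of an isomorphism class of simple modules. -/
noncomputable def SimpleClass.out (K : SimpleClass R) : FiniteModule R := IsoClass.out K.1

instance (K : SimpleClass R) : IsSimpleModule R K.out := K.2

theorem SimpleClass.not_nonempty_equiv {K L : SimpleClass R} (h : K ≠ L) :
    ¬ Nonempty (K.out ≃ₗ[R] L.out) := fun hKL => h (Subtype.ext (by
  have := IsoClass.iso_out_iff.1 hKL
  rw [this]
  exact IsoClass.toClass_out L.1))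

/-- Every finite simple module is isomorphic to exactly one of the representatives. -/
theorem exists_simpleClass (M : Type v) [AddCommGroup M] [Module R M] [Finite M]
    [IsSimpleModule R M] : ∃ K : SimpleClass R, Nonempty (K.out ≃ₗ[R] M) := by
  obtain ⟨e⟩ := (FiniteModule.ofFinite (R := R) M).iso_out
  have e' := e.trans (FiniteModule.ofFiniteEquiv (R := R) M)
  exact ⟨⟨_, IsSimpleModule.congr e'⟩, ⟨e'⟩⟩

/-- `M` has no nonzero homomorphism to a simple module in `T`. -/
def HomFree (T : Set (SimpleClass R)) (M : Type*) [AddCommGroup M] [Module R M] : Prop :=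
  ∀ K ∈ T, ∀ f : M →ₗ[R] K.out, f = 0

theorem HomFree.congr {T : Set (SimpleClass R)} {M N : Type*} [AddCommGroup M] [Module R M]
    [AddCommGroup N] [Module R N] (h : HomFree T M) (e : M ≃ₗ[R] N) : HomFree T N := by
  intro K hK f
  have := h K hK (f.comp e.toLinearMap)
  ext x
  simpa using LinearMap.congr_fun this (e.symm x)

theorem homFree_congr {T : Set (SimpleClass R)} {M N : Type*} [AddCommGroup M] [Module R M]
    [AddCommGroup N] [Module R N] (e : M ≃ₗ[R] N) : HomFree T M ↔ HomFree T N :=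
  ⟨fun h => h.congr e, fun h => h.congr e.symm⟩

/-- Since `L` is not in `T`, a homomorphism from the kernel to a module in `T` extends to `M`, where
it must vanish. -/
theorem HomFree.ker {T : Set (SimpleClass R)} (hR : IsDedekindLike R) {M G : Type*}
    [AddCommGroup M] [Module R M] [AddCommGroup G] [Module R G] (h : HomFree T M)
    {L : SimpleClass R} (hL : L ∉ T) (hG : Module.annihilator R L.out ≤ Module.annihilator R G)
    (ψ : M →ₗ[R] G) : HomFree T (LinearMap.ker ψ) := by
  intro K hK α
  have hKL : K ≠ L := fun h => hL (h ▸ hK)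
  obtain ⟨β, hβ⟩ := hR.exists_extension (isFinitePrimitive_annihilator K.out)
    (isFinitePrimitive_annihilator L.out)
    (fun h => SimpleClass.not_nonempty_equiv hKL (nonempty_linearEquiv_of_annihilator_le h.le))
    (N := LinearMap.ker ψ) (fun b hb m => by
      rw [LinearMap.mem_ker, map_smul]
      exact Module.mem_annihilator.1 (hG hb) _) le_rfl α
  rw [← hβ, h K hK β, LinearMap.zero_comp]

theorem HomFree.of_ker {T : Set (SimpleClass R)} {M G : Type*}
    [AddCommGroup M] [Module R M] [AddCommGroup G] [Module R G] (ψ : M →ₗ[R] G)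
    (hψ : Function.Surjective ψ) (h : HomFree T (LinearMap.ker ψ)) (hG : HomFree T G) :
    HomFree T M := by
  intro K hK β
  have h0 : ∀ x, ψ x = 0 → β x = 0 := fun x hx =>
    LinearMap.congr_fun (h K hK (β.comp (LinearMap.ker ψ).subtype)) ⟨x, hx⟩
  obtain ⟨γ, hγ⟩ := exists_factor ψ hψ β h0
  ext x
  rw [← hγ, hG K hK γ]
  rfl

/-- The powers of a finite module. -/
def FiniteModule.pow (K : FiniteModule R) : ℕ → FiniteModule R
  | 0 => { carrier := PUnit }
  | j + 1 => { carrier := K × K.pow j }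

theorem homFree_pow {T : Set (SimpleClass R)} {L : SimpleClass R} (hL : L ∉ T) (j : ℕ) :
    HomFree T (L.out.pow j) := by
  induction j with
  | zero =>
    intro K hK f
    exact LinearMap.ext fun x => by
      rw [show x = 0 from Subsingleton.elim (α := PUnit) x 0, map_zero, map_zero]
  | succ j ih =>
    intro K hK f
    refine LinearMap.prod_ext (M := L.out) (M₂ := L.out.pow j) (f := f) (g := 0) ?_ ?_
    · rw [LinearMap.zero_comp]
      exact eq_zero_of_not_linearEquiv
        (SimpleClass.not_nonempty_equiv fun h : L = K => hL (by rw [h]; exact hK)) _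
    · rw [LinearMap.zero_comp]
      exact ih K hK _

theorem annihilator_le_annihilator_pow (L : FiniteModule R) (j : ℕ) :
    Module.annihilator R L ≤ Module.annihilator R (L.pow j) := by
  induction j with
  | zero => exact fun r hr => Module.mem_annihilator.2 fun x => Subsingleton.elim (α := PUnit) _ _
  | succ j ih =>
    intro r hr
    refine Module.mem_annihilator.2 fun x => ?_
    exact Prod.ext (Module.mem_annihilator.1 hr x.1) (Module.mem_annihilator.1 (ih hr) x.2)

theorem card_hom_pow (L : FiniteModule R) (j : ℕ) :
    Nat.card (L.pow j →ₗ[R] L) = Nat.card (L →ₗ[R] L) ^ j := by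
  induction j with
  | zero =>
    have : Subsingleton (L.pow 0 →ₗ[R] L) := ⟨fun f g => LinearMap.ext fun x => by
      rw [show x = 0 from Subsingleton.elim (α := PUnit) x 0, map_zero, map_zero]⟩
    rw [pow_zero]
    exact Nat.card_unique
  | succ j ih =>
    rw [pow_succ', ← ih]
    exact card_hom_prod L (L.pow j) L

/-- The kernel in a short exact sequence. -/
noncomputable def ShortExactSeq.kerEquiv {K E G : Type*} [AddCommGroup K] [Module R K]
    [AddCommGroup E] [Module R E] [AddCommGroup G] [Module R G] (s : ShortExactSeq R K E G) :
    K ≃ₗ[R] LinearMap.ker s.proj :=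
  (LinearEquiv.ofInjective s.inc s.inc_injective).trans (LinearEquiv.ofEq _ _ (by
    ext x
    rw [LinearMap.mem_ker, s.exact]
    rfl))

/-- Composing `f` with the automorphisms of `K` gives distinct surjections. -/
theorem autCount_le_surCount {H K : FiniteModule R} (f : H →ₗ[R] K) (hf : Function.Surjective f) :
    autCount K ≤ surCount H K := by
  have : Finite (H →ₗ[R] K) := DFunLike.finite _
  refine Nat.card_le_card_of_injective
    (fun a : K ≃ₗ[R] K => ⟨a.toLinearMap.comp f, a.surjective.comp hf⟩) ?_
  intro a b h
  ext x
  obtain ⟨y, rfl⟩ := hf x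
  exact LinearMap.congr_fun (congrArg Subtype.val h) y

end HomFree

/-! ### Multiplicative weights and the moments of their masses -/

section Weights

variable {R : Type u} [Ring R]

/-- Multiplicative positive functions of finite modules. -/
structure IsWeight (c : FiniteModule R → ℝ≥0∞) : Prop where
  mul : ∀ {K E G : FiniteModule R}, ShortExactSeq R K E G → c E = c K * c G
  ne_zero : ∀ G, c G ≠ 0
  ne_top : ∀ G, c G ≠ ⊤

/-- The mass of a finite module. -/
noncomputable def mass (c : FiniteModule R → ℝ≥0∞) (E : IsoClass R) : ℝ≥0∞ :=
  c E.out / autCount E.out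

variable {c : FiniteModule R → ℝ≥0∞}

theorem IsWeight.mass_ne_zero (hc : IsWeight c) (E : IsoClass R) : mass c E ≠ 0 :=
  ENNReal.div_ne_zero.2 ⟨hc.ne_zero _, ENNReal.natCast_ne_top _⟩

theorem IsWeight.mass_ne_top (hc : IsWeight c) (E : IsoClass R) : mass c E ≠ ⊤ :=
  ENNReal.div_ne_top (hc.ne_top _) (autCount_ne_zero _)

/-- Either no sequence exists and both sides vanish, or `c H = c K * c G`. The identity trades `|Aut
K|` for `|Aut H|`, so that a sum over `H` becomes the weighted number of extensions of `G` by `K`.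
-/
theorem IsWeight.mass_mul_seqCount_div (hc : IsWeight c) (H K : IsoClass R) (G : FiniteModule R) :
    mass c H * ((seqCount K.out H.out G : ℝ≥0∞) / autCount K.out) =
      c G * (mass c K * ((seqCount K.out H.out G : ℝ≥0∞) / autCount H.out)) := by
  rcases isEmpty_or_nonempty (ShortExactSeq R K.out H.out G) with h | ⟨⟨s⟩⟩
  · simp [seqCount]
  · simp only [mass, hc.mul s, div_eq_mul_inv]
    ring

/-- The moments of the measure with density `mass c`. -/
theorem IsWeight.tsum_mass_mul_surCount [IsNoetherianRing R] (hR : IsDedekindLike R)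
    (hc : IsWeight c) (G : FiniteModule R) :
    ∑' H : IsoClass R, mass c H * surCount H.out G = c G * ∑' K, mass c K := by
  simp_rw [← tsum_seqCount_div_autCount, ← ENNReal.tsum_mul_left, hc.mass_mul_seqCount_div]
  rw [ENNReal.tsum_comm]
  simp_rw [ENNReal.tsum_mul_left, hR.tsum_seqCount_div_autCount_eq_one, mul_one]

/-- An inequality for the moments of the restriction of the measure with density `mass c` to a set
of isomorphism classes that contains the kernels of the surjections to `G`. -/
theorem IsWeight.tsum_indicator_mul_surCount_le [IsNoetherianRing R] (hR : IsDedekindLike R)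
    (hc : IsWeight c) (G : FiniteModule R) (D : Set (IsoClass R))
    (hD : ∀ K H : IsoClass R, H ∈ D → ShortExactSeq R K.out H.out G → K ∈ D) :
    ∑' H : IsoClass R, D.indicator (mass c) H * surCount H.out G ≤
      c G * ∑' K, D.indicator (mass c) K := by
  have key : ∀ H K : IsoClass R,
      D.indicator (mass c) H * ((seqCount K.out H.out G : ℝ≥0∞) / autCount K.out) ≤
      c G * (D.indicator (mass c) K * ((seqCount K.out H.out G : ℝ≥0∞) / autCount H.out)) := by
    intro H K
    by_cases hH : H ∈ D
    · rcases isEmpty_or_nonempty (ShortExactSeq R K.out H.out G) with h | ⟨⟨s⟩⟩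
      · simp [seqCount]
      · rw [Set.indicator_of_mem hH, Set.indicator_of_mem (hD K H hH s), hc.mass_mul_seqCount_div]
    · simp [Set.indicator_of_notMem hH]
  simp_rw [← tsum_seqCount_div_autCount, ← ENNReal.tsum_mul_left]
  refine (ENNReal.tsum_le_tsum fun H => ENNReal.tsum_le_tsum fun K => key H K).trans ?_
  rw [ENNReal.tsum_comm]
  simp_rw [ENNReal.tsum_mul_left, hR.tsum_seqCount_div_autCount_eq_one, mul_one]
  exact le_rfl

end Weights

/-! ### Simple modules of given residue characteristic -/

section SimpleModuleCount

variable {R : Type u} [Ring R]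

theorem exists_prime_nsmul_eq_zero (K : Type*) [AddCommGroup K] [Module R K] [Finite K]
    [IsSimpleModule R K] : ∃ p : ℕ, p.Prime ∧ ∀ x : K, p • x = 0 := by
  have := IsSimpleModule.nontrivial R K
  obtain ⟨p, hp, hdvd⟩ := Nat.exists_prime_and_dvd (Finite.one_lt_card (α := K)).ne'
  refine ⟨p, hp, ?_⟩
  let f : K →ₗ[R] K := p • LinearMap.id
  have hf : ∀ x, f x = p • x := fun x => rfl
  rcases LinearMap.bijective_or_eq_zero f with h | h
  · exfalso
    have := Fact.mk hp
    obtain ⟨x, hx⟩ := exists_prime_addOrderOf_dvd_card' p hdvd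
    have h0 : f x = f 0 := by rw [hf, map_zero, ← hx, addOrderOf_nsmul_eq_zero]
    have h1 := h.1 h0
    rw [h1, addOrderOf_zero] at hx
    exact hp.one_lt.ne hx
  · intro x
    rw [← hf, h]
    rfl

/-- The residue characteristic of a finite simple module. -/
noncomputable def SimpleClass.char (K : SimpleClass R) : ℕ :=
  (exists_prime_nsmul_eq_zero (R := R) K.out).choose

theorem SimpleClass.prime_char (K : SimpleClass R) : K.char.Prime :=
  (exists_prime_nsmul_eq_zero (R := R) K.out).choose_spec.1

theorem SimpleClass.char_nsmul (K : SimpleClass R) (x : K.out) : K.char • x = 0 :=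
  (exists_prime_nsmul_eq_zero (R := R) K.out).choose_spec.2 x

theorem SimpleClass.char_le_card (K : SimpleClass R) : K.char ≤ Nat.card K.out := by
  have := IsSimpleModule.nontrivial R K.out
  obtain ⟨x, hx⟩ := exists_ne (0 : K.out)
  have h1 : addOrderOf x = K.char := addOrderOf_eq_prime (K.char_nsmul x) hx (hp := ⟨K.prime_char⟩)
  exact Nat.le_of_dvd Nat.card_pos (h1 ▸ addOrderOf_dvd_natCard x)

/-- Multiplications by `1, …, p - 1` are distinct automorphisms. The resulting factor of order `1 /
p` in the mass makes the sum over simple modules converge however small the exponents `u` are. -/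
theorem SimpleClass.char_sub_one_le_autCount (K : SimpleClass R) :
    K.char - 1 ≤ autCount K.out := by
  have := IsSimpleModule.nontrivial R K.out
  obtain ⟨x, hx⟩ := exists_ne (0 : K.out)
  have h1 : addOrderOf x = K.char := addOrderOf_eq_prime (K.char_nsmul x) hx (hp := ⟨K.prime_char⟩)
  have hne : ∀ i : Fin (K.char - 1), ((i : ℕ) + 1) • (LinearMap.id : K.out →ₗ[R] K.out) ≠ 0 := by
    intro i h
    have h2 : ((i : ℕ) + 1) • x = 0 := LinearMap.congr_fun h x
    have := Nat.le_of_dvd (Nat.succ_pos _) (addOrderOf_dvd_of_nsmul_eq_zero h2)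
    omega
  let F : Fin (K.char - 1) → (K.out ≃ₗ[R] K.out) := fun i =>
    LinearEquiv.ofBijective _ (LinearMap.bijective_of_ne_zero (hne i))
  have hF : Function.Injective F := by
    intro i j hij
    have h2 : ((i : ℕ) + 1) • x = ((j : ℕ) + 1) • x := LinearEquiv.congr_fun hij x
    have h3 := nsmul_injOn_Iio_addOrderOf (x := x) (x₁ := (i : ℕ) + 1) (x₂ := (j : ℕ) + 1)
      (by simp only [Set.mem_Iio]; omega) (by simp only [Set.mem_Iio]; omega) h2
    ext
    omega
  simpa [autCount] using Nat.card_le_card_of_injective F hF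

/-- The Chinese remainder theorem for the pairwise comaximal annihilators. -/
theorem exists_mem_annihilator_one_sub_mem (L : SimpleClass R) (s : Finset (SimpleClass R))
    (hL : L ∉ s) : ∃ a : R, (∀ K ∈ s, a ∈ Module.annihilator R K.out) ∧
      1 - a ∈ Module.annihilator R L.out := by
  classical
  induction s using Finset.induction_on with
  | empty => exact ⟨1, by simp, by simp⟩
  | insert K s hK ih =>
    simp only [Finset.mem_insert, not_or] at hL
    obtain ⟨a, ha, ha'⟩ := ih hL.2
    obtain ⟨b, hb, hb'⟩ := (isFinitePrimitive_annihilator L.out).exists_mem_one_sub_mem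
      (isFinitePrimitive_annihilator K.out) (fun h =>
        SimpleClass.not_nonempty_equiv hL.1 (nonempty_linearEquiv_of_annihilator_le h.le))
    refine ⟨a * b, ?_, ?_⟩
    · simp only [Finset.mem_insert, forall_eq_or_imp]
      exact ⟨Ideal.mul_mem_left _ _ hb, fun K' hK' => Ideal.mul_mem_right _ _ (ha K' hK')⟩
    · have : 1 - a * b = (1 - a) + a * (1 - b) := by noncomm_ring
      rw [this]
      exact Ideal.add_mem _ ha' (Ideal.mul_mem_left _ _ hb')

/-- There are at most `g` classes of simple modules of given residue characteristic. -/
theorem card_le_of_char_eq {g p : ℕ} (hp : p.Prime)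
    (hg : Finite (R ⧸ Ideal.span {(p : R)}) ∧ Nat.card (R ⧸ Ideal.span {(p : R)}) ≤ p ^ g)
    (s : Finset (SimpleClass R)) (hs : ∀ K ∈ s, K.char = p) : s.card ≤ g := by
  classical
  obtain ⟨_, hg⟩ := hg
  have hne : ∀ K : SimpleClass R, ∃ x : K.out, x ≠ 0 := fun K =>
    have := IsSimpleModule.nontrivial R K.out
    exists_ne 0
  choose x hx using hne
  -- This map is onto by the Chinese remainder theorem and kills `p`. Each factor has at least `p`
  -- elements, so `p ^ |s| ≤ |R / pR| ≤ p ^ g`.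
  let f : R →ₗ[R] (∀ K : s, K.1.out) :=
    LinearMap.pi fun K => LinearMap.toSpanSingleton R K.1.out (x K.1)
  have hf : Function.Surjective f := by
    intro y
    choose r hr using fun K : s => IsSimpleModule.toSpanSingleton_surjective R (hx K.1) (y K)
    choose a ha ha' using fun K : s =>
      exists_mem_annihilator_one_sub_mem K.1 (s.erase K.1) (by simp)
    refine ⟨∑ L : s, r L * a L, ?_⟩
    ext K
    rw [map_sum, Finset.sum_apply, Finset.sum_eq_single K]
    · change (r K * a K) • x K.1 = y K
      have := Module.mem_annihilator.1 (ha' K) (x K.1)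
      rw [sub_smul, one_smul, sub_eq_zero] at this
      rw [mul_smul, ← this, ← hr K]
      rfl
    · intro L _ hLK
      change (r L * a L) • x K.1 = 0
      rw [mul_smul, Module.mem_annihilator.1 (ha L K.1 (Finset.mem_erase.2
        ⟨fun h => hLK (Subtype.ext h.symm), K.2⟩)) (x K.1), smul_zero]
    · simp
  have hle : Ideal.span {(p : R)} ≤ LinearMap.ker f := by
    rw [Ideal.span_singleton_le_iff_mem, LinearMap.mem_ker]
    ext K
    change (p : R) • x K.1 = 0
    rw [Nat.cast_smul_eq_nsmul, ← hs K.1 K.2, SimpleClass.char_nsmul]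
  have hsurj : Function.Surjective (Submodule.liftQ (Ideal.span {(p : R)}) f hle) := by
    intro y
    obtain ⟨r, rfl⟩ := hf y
    exact ⟨Submodule.Quotient.mk r, rfl⟩
  have h1 := Nat.card_le_card_of_surjective _ hsurj
  rw [Nat.card_pi] at h1
  have h2 : p ^ s.card ≤ ∏ K : s, Nat.card K.1.out := by
    rw [← Fintype.card_coe, ← Finset.card_univ, ← Finset.prod_const]
    exact Finset.prod_le_prod' fun K _ => hs K.1 K.2 ▸ K.1.char_le_card
  exact (Nat.pow_le_pow_iff_right hp.one_lt).1 (h2.trans (h1.trans hg))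

end SimpleModuleCount

/-! ### Finiteness of the total mass -/

section Convergence

variable {R : Type u} [Ring R] {c : FiniteModule R → ℝ≥0∞}

/-- The weight of simple modules decays like a negative power of their order. -/
def HasDecay (c : FiniteModule R → ℝ≥0∞) : Prop :=
  ∃ ε : ℝ, 0 < ε ∧ ∀ K : FiniteModule R, IsSimpleModule R K →
    c K ≤ ENNReal.ofReal ((Nat.card K : ℝ) ^ (-ε))

theorem HasDecay.mass_lt_one (hc : HasDecay c) (K : SimpleClass R) : mass c K.1 < 1 := by
  obtain ⟨ε, hε, h⟩ := hc
  have := IsSimpleModule.nontrivial R K.out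
  have h1 : (1 : ℝ) < Nat.card K.out := by exact_mod_cast Finite.one_lt_card (α := K.out)
  have h2 : c K.out < 1 := (h K.out K.2).trans_lt (by
    rw [ENNReal.ofReal_lt_one]
    exact Real.rpow_lt_one_of_one_lt_of_neg h1 (neg_lt_zero.2 hε))
  refine lt_of_le_of_lt ?_ h2
  refine ENNReal.div_le_of_le_mul ?_
  calc c K.out = c K.out * 1 := (mul_one _).symm
    _ ≤ _ := by gcongr; exact_mod_cast autCount_pos K.out

theorem HasDecay.tsum_simple_ne_top (hR : IsDedekindLike R) (hc : HasDecay c) :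
    ∑' K : SimpleClass R, mass c K.1 ≠ ⊤ := by
  classical
  obtain ⟨ε, hε, h⟩ := hc
  obtain ⟨g, hg⟩ := hR.exists_card_quotient_le
  -- From `|Aut K| ≥ p - 1 ≥ p / 2` come the factor 2 and the additional 1 in the exponent.
  let a : ℕ → ℝ := fun n => 2 * (n : ℝ) ^ (-(1 + ε))
  have ha0 : ∀ n, 0 ≤ a n := fun n => by positivity
  have hasum : Summable a :=
    (Real.summable_nat_rpow.2 (by linarith)).mul_left 2
  have hterm : ∀ K : SimpleClass R, mass c K.1 ≤ ENNReal.ofReal (a K.char) := by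
    intro K
    have hp := K.prime_char
    have hp2 : (2 : ℝ) ≤ K.char := by exact_mod_cast hp.two_le
    have hp0 : (0 : ℝ) < K.char := by linarith
    have h1 : c K.out ≤ ENNReal.ofReal ((K.char : ℝ) ^ (-ε)) := by
      refine (h K.out K.2).trans (ENNReal.ofReal_le_ofReal ?_)
      exact Real.rpow_le_rpow_of_nonpos hp0 (by exact_mod_cast K.char_le_card) (by linarith)
    have h2 : (K.char : ℝ) / 2 ≤ autCount K.out := by
      have h3 : ((K.char - 1 : ℕ) : ℝ) ≤ autCount K.out := by
        exact_mod_cast K.char_sub_one_le_autCount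
      rw [Nat.cast_sub hp.one_le, Nat.cast_one] at h3
      linarith
    refine ENNReal.div_le_of_le_mul (h1.trans ?_)
    rw [← ENNReal.ofReal_natCast, ← ENNReal.ofReal_mul (ha0 _)]
    refine ENNReal.ofReal_le_ofReal ?_
    have h4 : a K.char * (K.char / 2) = (K.char : ℝ) ^ (-ε) := by
      have : (K.char : ℝ) ^ (-ε) = (K.char : ℝ) ^ (-(1 + ε)) * K.char := by
        rw [← Real.rpow_add_one hp0.ne']
        congr 1
        ring
      rw [this]
      simp only [a]
      ring
    rw [← h4]
    exact mul_le_mul_of_nonneg_left h2 (ha0 _)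
  have hbound : ∑' K : SimpleClass R, mass c K.1 ≤ g * ∑' n, ENNReal.ofReal (a n) := by
    rw [ENNReal.tsum_eq_iSup_sum]
    refine iSup_le fun s => ?_
    refine (Finset.sum_le_sum fun K _ => hterm K).trans ?_
    rw [Finset.sum_comp (fun n => ENNReal.ofReal (a n)) SimpleClass.char]
    calc ∑ n ∈ s.image SimpleClass.char, {K ∈ s | K.char = n}.card • ENNReal.ofReal (a n)
        ≤ ∑ n ∈ s.image SimpleClass.char, g * ENNReal.ofReal (a n) := by
          refine Finset.sum_le_sum fun n hn => ?_
          obtain ⟨K, -, rfl⟩ := Finset.mem_image.1 hn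
          rw [nsmul_eq_mul]
          gcongr
          exact_mod_cast card_le_of_char_eq K.prime_char (hg _ K.prime_char.ne_zero) _
            fun L hL => (Finset.mem_filter.1 hL).2
      _ = g * ∑ n ∈ s.image SimpleClass.char, ENNReal.ofReal (a n) := by rw [Finset.mul_sum]
      _ ≤ _ := by gcongr; exact ENNReal.sum_le_tsum _
  refine ne_top_of_le_ne_top (ENNReal.mul_ne_top (ENNReal.natCast_ne_top _) ?_) hbound
  rw [← ENNReal.ofReal_tsum_of_nonneg ha0 hasum]
  exact ENNReal.ofReal_ne_top

/-- Sets of isomorphism classes closed under submodules. -/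
def IsSubmoduleClosed (D : Set (IsoClass R)) : Prop :=
  ∀ K E : IsoClass R, E ∈ D → ∀ i : K.out →ₗ[R] E.out, Function.Injective i → K ∈ D

/-- All classes of submodules of members of `s` will do. Finite sets keep the partial masses finite,
so that terms can be absorbed, and closure under submodules keeps the kernels of surjections inside.
-/
theorem exists_finite_isSubmoduleClosed (s : Finset (IsoClass R)) :
    ∃ D : Set (IsoClass R), D.Finite ∧ ↑s ⊆ D ∧ IsSubmoduleClosed D := by
  have hcls : ∀ (H K : IsoClass R) (i : K.out →ₗ[R] H.out), Function.Injective i →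
      (FiniteModule.ofFinite (R := R) (LinearMap.range i)).toClass = K := by
    intro H K i hi
    symm
    rw [← IsoClass.iso_out_iff]
    exact ⟨(LinearEquiv.ofInjective i hi).trans (FiniteModule.ofFiniteEquiv _).symm⟩
  refine ⟨⋃ H ∈ s, Set.range fun N : Submodule R H.out => (FiniteModule.ofFinite (R := R) N).toClass,
    ?_, ?_, ?_⟩
  · refine s.finite_toSet.biUnion fun H _ => ?_
    have : Finite (Submodule R H.out) := Finite.of_injective _ SetLike.coe_injective
    exact Set.finite_range _
  · intro H hH
    simp only [Set.mem_iUnion]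
    exact ⟨H, hH, _, hcls H H LinearMap.id Function.injective_id⟩
  · intro K E hE i hi
    simp only [Set.mem_iUnion] at hE ⊢
    obtain ⟨H, hH, N, rfl⟩ := hE
    obtain ⟨e⟩ := (FiniteModule.ofFinite (R := R) N).iso_out
    let e' := e.trans (FiniteModule.ofFiniteEquiv (R := R) N)
    exact ⟨H, hH, _, hcls H K ((N.subtype.comp e'.toLinearMap).comp i)
      ((N.injective_subtype.comp e'.injective).comp hi)⟩

/-- The total mass of the modules in `D` without nonzero homomorphisms to the modules in `T`. -/
noncomputable def partialMass (c : FiniteModule R → ℝ≥0∞) (T : Set (SimpleClass R))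
    (D : Set (IsoClass R)) : ℝ≥0∞ :=
  ∑' E, (D ∩ {E | HomFree T E.out}).indicator (mass c) E

theorem partialMass_ne_top (hc : IsWeight c) (T : Set (SimpleClass R)) {D : Set (IsoClass R)}
    (hD : D.Finite) : partialMass c T D ≠ ⊤ := by
  rw [partialMass, tsum_eq_sum (s := hD.toFinset)]
  · refine ENNReal.sum_ne_top.2 fun E _ => ?_
    exact ne_top_of_le_ne_top (hc.mass_ne_top E) (Set.indicator_le_self _ _ E)
  · intro E hE
    rw [Set.Finite.mem_toFinset] at hE
    exact Set.indicator_of_notMem (fun h => hE h.1) _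

/-- The moment inequality at `L`, divided by `|Aut L|`. It applies because for `L ∉ T` the kernel of
a surjection from a `T`-free module to `L` is again `T`-free. -/
theorem tsum_partialMass_mul_surCount_le [IsNoetherianRing R] (hR : IsDedekindLike R)
    (hc : IsWeight c) {T : Set (SimpleClass R)} {D : Set (IsoClass R)} (hD : IsSubmoduleClosed D)
    {L : SimpleClass R} (hL : L ∉ T) :
    ∑' E : IsoClass R, (D ∩ {E | HomFree T E.out}).indicator (mass c) E *
      ((surCount E.out L.out : ℝ≥0∞) / autCount L.out) ≤ mass c L.1 * partialMass c T D := by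
  have := hc.tsum_indicator_mul_surCount_le hR L.out (D ∩ {E | HomFree T E.out}) (by
    rintro K H ⟨hHD, hHT⟩ s
    exact ⟨hD K H hHD s.inc s.inc_injective,
      ((hHT : HomFree T H.out).ker hR hL le_rfl s.proj).congr s.kerEquiv.symm⟩)
  simp only [div_eq_mul_inv, ← mul_assoc]
  rw [ENNReal.tsum_mul_right, mass, div_eq_mul_inv, mul_right_comm]
  exact mul_le_mul' this le_rfl

/-- Absorption of `m * F` in the left side, legitimate because `F` is finite. -/
theorem le_div_of_le_add_mul {F a m : ℝ≥0∞} (hF : F ≠ ⊤) (hm : m < 1) (h : F ≤ a + m * F) :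
    F ≤ a / (1 - m) := by
  rw [ENNReal.le_div_iff_mul_le (Or.inl (tsub_pos_of_lt hm).ne')
    (Or.inl (ne_top_of_le_ne_top ENNReal.one_ne_top tsub_le_self)), mul_comm,
    ENNReal.sub_mul (fun _ _ => hF), one_mul]
  exact tsub_le_iff_right.2 h

/-- A `T`-free module either has no nonzero homomorphism to `L`, or has at least `|Aut L|`
surjections to it; the second kind is bounded by the moment at `L`. -/
theorem partialMass_le_insert [IsNoetherianRing R] (hR : IsDedekindLike R)
    (hc : IsWeight c) {T : Set (SimpleClass R)} {D : Set (IsoClass R)} (hD : IsSubmoduleClosed D)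
    {L : SimpleClass R} (hL : L ∉ T) :
    partialMass c T D ≤ partialMass c (insert L T) D + mass c L.1 * partialMass c T D := by
  refine le_trans ?_ (add_le_add le_rfl (tsum_partialMass_mul_surCount_le hR hc hD hL))
  rw [partialMass, partialMass, ← ENNReal.tsum_add]
  refine ENNReal.tsum_le_tsum fun E => ?_
  by_cases hE : E ∈ D ∩ {E | HomFree T E.out}
  · by_cases hf : ∃ f : E.out →ₗ[R] L.out, f ≠ 0
    · obtain ⟨f, hf⟩ := hf
      have h1 : (1 : ℝ≥0∞) ≤ (surCount E.out L.out : ℝ≥0∞) / autCount L.out := by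
        rw [ENNReal.le_div_iff_mul_le (Or.inl (autCount_ne_zero _))
          (Or.inl (ENNReal.natCast_ne_top _)), one_mul]
        exact_mod_cast autCount_le_surCount f (LinearMap.surjective_of_ne_zero hf)
      refine le_add_left ?_
      calc _ = (D ∩ {E | HomFree T E.out}).indicator (mass c) E * 1 := (mul_one _).symm
        _ ≤ _ := by gcongr
    · push Not at hf
      refine le_add_right ?_
      rw [Set.indicator_of_mem hE, Set.indicator_of_mem]
      refine ⟨hE.1, fun K hK f => ?_⟩
      rcases hK with rfl | hK
      · exact hf f
      · exact hE.2 K hK f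
  · rw [Set.indicator_of_notMem hE]
    exact zero_le

/-- The class of the zero module. -/
def zeroClass (R : Type u) [Ring R] : IsoClass R :=
  FiniteModule.toClass { carrier := PUnit }

theorem eq_zeroClass {E : IsoClass R} (h : Subsingleton E.out) : E = zeroClass R :=
  IsoClass.iso_out_iff.1 ⟨(0 : E.out ≃ₗ[R] (PUnit : Type))⟩

theorem exists_simpleClass_surjective (E : FiniteModule R) [Nontrivial E] :
    ∃ (L : SimpleClass R) (f : E →ₗ[R] L.out), Function.Surjective f := by
  obtain ⟨m, hm⟩ := exists_simple_quotient_of_finite (R := R) E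
  have : Finite (E ⧸ m) := Finite.of_surjective _ (Submodule.mkQ_surjective m)
  obtain ⟨L, ⟨e⟩⟩ := exists_simpleClass (R := R) (E ⧸ m)
  exact ⟨L, e.symm.toLinearMap.comp m.mkQ, e.symm.surjective.comp (Submodule.mkQ_surjective m)⟩

theorem SimpleClass.ne_zero_of_surjective {M : Type*} [AddCommGroup M] [Module R M]
    {L : SimpleClass R} {f : M →ₗ[R] L.out} (hf : Function.Surjective f) : f ≠ 0 := by
  rintro rfl
  have := IsSimpleModule.nontrivial R L.out
  obtain ⟨x, hx⟩ := exists_ne (0 : L.out)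
  obtain ⟨y, hy⟩ := hf x
  exact hx hy.symm

/-- A `T`-free module is zero or surjects onto some simple `L ∉ T`; sum the moment bounds over all
such `L`. -/
theorem partialMass_le_of_tail [IsNoetherianRing R] (hR : IsDedekindLike R)
    (hc : IsWeight c) {T : Set (SimpleClass R)} {D : Set (IsoClass R)} (hD : IsSubmoduleClosed D) :
    partialMass c T D ≤ mass c (zeroClass R) +
      (∑' L : {L // L ∉ T}, mass c L.1.1) * partialMass c T D := by
  classical
  rw [← ENNReal.tsum_mul_right]
  refine le_trans ?_ (add_le_add le_rfl (ENNReal.tsum_le_tsum fun L : {L // L ∉ T} =>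
    tsum_partialMass_mul_surCount_le hR hc hD L.2))
  rw [ENNReal.tsum_comm, ← tsum_ite_eq (zeroClass R) (fun E => mass c E), ← ENNReal.tsum_add,
    partialMass]
  refine ENNReal.tsum_le_tsum fun E => ?_
  by_cases hE : E ∈ D ∩ {E | HomFree T E.out}
  · rcases subsingleton_or_nontrivial E.out with h | h
    · rw [if_pos (eq_zeroClass h), Set.indicator_of_mem hE]
      exact le_self_add
    · obtain ⟨L, f, hf⟩ := exists_simpleClass_surjective E.out
      have hL : L ∉ T := fun h => SimpleClass.ne_zero_of_surjective hf (hE.2 L h f)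
      have h1 : (1 : ℝ≥0∞) ≤ (surCount E.out L.out : ℝ≥0∞) / autCount L.out := by
        rw [ENNReal.le_div_iff_mul_le (Or.inl (autCount_ne_zero _))
          (Or.inl (ENNReal.natCast_ne_top _)), one_mul]
        exact_mod_cast autCount_le_surCount f hf
      refine le_add_left (le_trans ?_ (ENNReal.le_tsum ⟨L, hL⟩))
      calc _ = (D ∩ {E | HomFree T E.out}).indicator (mass c) E * 1 := (mul_one _).symm
        _ ≤ _ := by gcongr
  · rw [Set.indicator_of_notMem hE]
    exact zero_le

/-- The members of `T` are removed one at a time; removing `L` costs the factor `1 / (1 - mass L)`,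
finite because the mass of `L` is less than 1. -/
theorem partialMass_bounded_of_insert [IsNoetherianRing R] (hR : IsDedekindLike R)
    (hc : IsWeight c) (hd : HasDecay c) (T : Finset (SimpleClass R))
    (h : ∃ B : ℝ≥0∞, B ≠ ⊤ ∧ ∀ D : Set (IsoClass R), D.Finite → IsSubmoduleClosed D →
      partialMass c T D ≤ B) :
    ∃ B : ℝ≥0∞, B ≠ ⊤ ∧ ∀ D : Set (IsoClass R), D.Finite → IsSubmoduleClosed D →
      partialMass c ∅ D ≤ B := by
  classical
  induction T using Finset.induction_on with
  | empty => simpa using h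
  | insert L T hL ih =>
    obtain ⟨B, hB, h⟩ := h
    have hm := hd.mass_lt_one L
    refine ih ⟨B / (1 - mass c L.1), ENNReal.div_ne_top hB (tsub_pos_of_lt hm).ne', ?_⟩
    intro D hDf hD
    refine le_div_of_le_add_mul (partialMass_ne_top hc T hDf) hm
      ((partialMass_le_insert hR hc hD (by simpa using hL)).trans ?_)
    gcongr
    simpa using h D hDf hD

/-- The total mass is finite. -/
theorem tsum_mass_ne_top [IsNoetherianRing R] (hR : IsDedekindLike R) (hc : IsWeight c)
    (hd : HasDecay c) : ∑' E, mass c E ≠ ⊤ := by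
  -- Outside a suitable finite set the masses of the simple modules sum to less than 1, so the tail
  -- inequality gives a bound independent of `D`.
  have htail := (ENNReal.tendsto_tsum_compl_atTop_zero (hd.tsum_simple_ne_top hR)).eventually
    (gt_mem_nhds (show (0 : ℝ≥0∞) < 1 by simp))
  obtain ⟨T, hT⟩ := htail.exists
  obtain ⟨B, hB, h⟩ := partialMass_bounded_of_insert hR hc hd T ⟨_,
    ENNReal.div_ne_top (hc.mass_ne_top (zeroClass R)) (tsub_pos_of_lt hT).ne', fun D hDf hD =>
      le_div_of_le_add_mul (partialMass_ne_top hc _ hDf) hT (partialMass_le_of_tail hR hc hD)⟩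
  refine ne_top_of_le_ne_top hB ?_
  rw [ENNReal.tsum_eq_iSup_sum]
  refine iSup_le fun s => ?_
  obtain ⟨D, hDf, hsD, hD⟩ := exists_finite_isSubmoduleClosed s
  refine le_trans ?_ (h D hDf hD)
  refine le_trans ?_ (ENNReal.sum_le_tsum s)
  refine Finset.sum_le_sum fun E hE => ?_
  rw [Set.indicator_of_mem]
  exact ⟨hsD hE, fun K hK => absurd hK (Set.notMem_empty K)⟩

/-- A finite sum of positive masses has countably many terms. -/
theorem countable_isoClass [IsNoetherianRing R] (hR : IsDedekindLike R) (hc : IsWeight c)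
    (hd : HasDecay c) : Countable (IsoClass R) := by
  have h := Summable.countable_support_ennreal (tsum_mass_ne_top hR hc hd)
  have hu : Function.support (mass c) = Set.univ :=
    Set.eq_univ_of_forall fun E => hc.mass_ne_zero E
  rw [hu] at h
  exact Set.countable_univ_iff.1 h

end Convergence

/-! ### Truncated inclusion-exclusion -/

section Bonferroni

/-- The truncations of an alternating sum that detects `t = 1`. -/
theorem alternating_sum_eq_prod {q t : ℝ} (hq : 2 ≤ q) (J : ℕ) :
    ∑ j ∈ Finset.range (J + 1), (-1) ^ j * (∏ i ∈ Finset.range j, (t - q ^ i)) /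
      (∏ i ∈ Finset.range j, (q ^ (i + 1) - 1)) =
      (∏ i ∈ Finset.range J, (q ^ (i + 1) - t)) / ∏ i ∈ Finset.range J, (q ^ (i + 1) - 1) := by
  have hpos : ∀ i : ℕ, 0 < q ^ (i + 1) - 1 := fun i => by
    have : 1 < q ^ (i + 1) := one_lt_pow₀ (by linarith) (Nat.succ_ne_zero i)
    linarith
  induction J with
  | zero => simp
  | succ J ih =>
    have hc : (∏ i ∈ Finset.range J, (q ^ (i + 1) - 1)) ≠ 0 :=
      Finset.prod_ne_zero_iff.2 fun i _ => (hpos i).ne'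
    -- The factor `t - q ^ 0` splits off and the signs reverse the other factors. The new term then
    -- completes the product because `(q ^ (J + 1) - 1) + (1 - t) = q ^ (J + 1) - t`.
    have hs : (-1 : ℝ) ^ (J + 1) * ∏ i ∈ Finset.range (J + 1), (t - q ^ i) =
        (1 - t) * ∏ i ∈ Finset.range J, (q ^ (i + 1) - t) := by
      rw [Finset.prod_range_succ' (fun i => t - q ^ i), pow_zero, pow_succ]
      have : (-1 : ℝ) ^ J * ∏ i ∈ Finset.range J, (t - q ^ (i + 1)) =
          ∏ i ∈ Finset.range J, (q ^ (i + 1) - t) := by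
        rw [← Finset.card_range J, ← Finset.prod_const, Finset.card_range, ← Finset.prod_mul_distrib]
        exact Finset.prod_congr rfl fun i _ => by ring
      rw [← this]
      ring
    rw [Finset.sum_range_succ, ih, hs, Finset.prod_range_succ, Finset.prod_range_succ]
    have := (hpos J).ne'
    field_simp
    ring

/-- Bonferroni type inequalities for the number of surjections to powers of a simple module. -/
theorem abs_sub_alternating_sum_le {q t : ℝ} (hq : 2 ≤ q) {n : ℕ → ℝ}
    (hn : ∀ j, n j = ∏ i ∈ Finset.range j, (t - q ^ i)) (hn0 : ∀ j, 0 ≤ n j) (J : ℕ) :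
    |(if t = 1 then 1 else 0) - ∑ j ∈ Finset.range (J + 1), (-1) ^ j * n j /
      (∏ i ∈ Finset.range j, (q ^ (i + 1) - 1))| ≤
      n J / ∏ i ∈ Finset.range J, (q ^ (i + 1) - 1) := by
  have hpos : ∀ i : ℕ, 0 < q ^ (i + 1) - 1 := fun i => by
    have : 1 < q ^ (i + 1) := one_lt_pow₀ (by linarith) (Nat.succ_ne_zero i)
    linarith
  have hc : 0 < ∏ i ∈ Finset.range J, (q ^ (i + 1) - 1) := Finset.prod_pos fun i _ => hpos i
  simp_rw [hn] at hn0 ⊢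
  rw [alternating_sum_eq_prod hq]
  split_ifs with ht
  · subst ht
    rw [div_self hc.ne', sub_self, abs_zero]
    exact div_nonneg (hn0 J) hc.le
  · rw [zero_sub, abs_neg, abs_div, abs_of_pos hc]
    refine div_le_div_of_nonneg_right ?_ hc.le
    -- If `n J = 0`, then `t = q ^ i` with `0 < i < J`, and the remainder vanishes as well.
    -- Otherwise `n (J + 1) ≥ 0` forces `t ≥ q ^ J`, and the factors can be compared one by one.
    by_cases hJ : ∏ i ∈ Finset.range J, (t - q ^ i) = 0
    · rw [hJ]
      obtain ⟨i, hi, hti⟩ := Finset.prod_eq_zero_iff.1 hJ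
      obtain ⟨i, rfl⟩ : ∃ k, i = k + 1 := Nat.exists_eq_succ_of_ne_zero fun h => ht (by
        rw [h, pow_zero] at hti
        linarith)
      rw [Finset.prod_eq_zero (i := i), abs_zero]
      · exact Finset.mem_range.2 (by have := Finset.mem_range.1 hi; omega)
      · linarith
    · have hJ' : 0 < ∏ i ∈ Finset.range J, (t - q ^ i) := lt_of_le_of_ne (hn0 J) (Ne.symm hJ)
      have htJ : q ^ J ≤ t := by
        have := hn0 (J + 1)
        rw [Finset.prod_range_succ] at this
        have := nonneg_of_mul_nonneg_right this hJ'
        linarith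
      rw [Finset.abs_prod]
      refine Finset.prod_le_prod (fun i _ => abs_nonneg _) fun i hi => ?_
      have h1 : q ^ (i + 1) ≤ q ^ J :=
        pow_le_pow_right₀ (by linarith) (Finset.mem_range.1 hi)
      have h2 : q ^ i ≤ q ^ (i + 1) := pow_le_pow_right₀ (by linarith) (Nat.le_succ i)
      rw [abs_of_nonpos (by linarith)]
      linarith

/-- The first factor `q - 1` may be 1, the others are at least 3; hence `J + 1` factors for the
exponent `J`. -/
theorem two_pow_le_prod {q : ℝ} (hq : 2 ≤ q) (J : ℕ) :
    (2 : ℝ) ^ J ≤ ∏ i ∈ Finset.range (J + 1), (q ^ (i + 1) - 1) := by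
  induction J with
  | zero => simp; linarith
  | succ J ih =>
    rw [Finset.prod_range_succ, pow_succ]
    refine mul_le_mul ih ?_ zero_le_two ((by positivity : (0 : ℝ) ≤ 2 ^ J).trans ih)
    have : q ^ 2 ≤ q ^ (J + 1 + 1) := pow_le_pow_right₀ (by linarith) (by omega)
    nlinarith

end Bonferroni

/-! ### Surjections to powers of a simple module -/

section PowerSurjections

variable {R : Type u} [Ring R]

/-- The number of surjections to a finite module. -/
noncomputable def surCountTo (M : Type*) [AddCommGroup M] [Module R M] (G : FiniteModule R) : ℕ :=
  Nat.card {f : M →ₗ[R] G // Function.Surjective f}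

/-- Given a surjection `ψ` to `L`, a map `α : M → K` makes `(α, ψ)` surjective unless it vanishes on
`ker ψ`, by simplicity of `K`; the exceptions are the maps that factor through `L`. -/
theorem surCountTo_prod (M : Type*) [AddCommGroup M] [Module R M] [Finite M]
    (K L : FiniteModule R) [IsSimpleModule R K] :
    Nat.card {f : M →ₗ[R] K × L // Function.Surjective f} +
      surCountTo M L * Nat.card (L →ₗ[R] K) = surCountTo M L * Nat.card (M →ₗ[R] K) := by
  classical
  have h1 : Finite (M →ₗ[R] K) := DFunLike.finite _
  have h2 : Finite (M →ₗ[R] L) := DFunLike.finite _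
  have h3 : Finite (L →ₗ[R] K) := DFunLike.finite _
  let S := {f : M →ₗ[R] L // Function.Surjective f}
  let p : S × (M →ₗ[R] K) → Prop := fun x => Function.Surjective (x.2.prod x.1.1)
  have hp : ∀ x : S × (M →ₗ[R] K), ¬ p x ↔ ∀ m, x.1.1 m = 0 → x.2 m = 0 := by
    rintro ⟨⟨ψ, hψ⟩, α⟩
    constructor
    · intro h
      by_contra hcon
      refine h ?_
      have hne : α.comp (LinearMap.ker ψ).subtype ≠ 0 := fun h0 =>
        hcon fun m hm => LinearMap.congr_fun h0 ⟨m, hm⟩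
      have hs := LinearMap.surjective_of_ne_zero hne
      rintro ⟨k, l⟩
      obtain ⟨m, rfl⟩ := hψ l
      obtain ⟨m', hm'⟩ := hs (k - α m)
      refine ⟨m + m', Prod.ext ?_ ?_⟩
      · change α (m + m') = k
        rw [map_add, show α m' = k - α m from hm', add_sub_cancel]
      · change ψ (m + m') = ψ m
        rw [map_add, LinearMap.mem_ker.1 m'.2, add_zero]
    · intro h hs
      have := IsSimpleModule.nontrivial R K
      obtain ⟨k, hk⟩ := exists_ne (0 : K)
      obtain ⟨m, hm⟩ := hs (k, 0)
      exact hk ((congrArg Prod.fst hm).symm.trans (h m (congrArg Prod.snd hm)))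
  have e1 : {x // p x} ≃ {f : M →ₗ[R] K × L // Function.Surjective f} :=
    { toFun := fun x => ⟨x.1.2.prod x.1.1.1, x.2⟩
      invFun := fun f => ⟨(⟨(LinearMap.snd R K L).comp f.1, Prod.snd_surjective.comp f.2⟩,
        (LinearMap.fst R K L).comp f.1), f.2⟩
      left_inv := fun x => rfl
      right_inv := fun f => rfl }
  have e2 : Nat.card {x // ¬ p x} = surCountTo M L * Nat.card (L →ₗ[R] K) := by
    rw [surCountTo, ← Nat.card_prod]
    symm
    refine Nat.card_congr (Equiv.ofBijective (fun y : S × (L →ₗ[R] K) =>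
      ⟨(y.1, y.2.comp y.1.1), (hp _).2 fun m hm => ?_⟩) ⟨?_, ?_⟩)
    · change y.2 (y.1.1 m) = 0
      rw [show y.1.1 m = 0 from hm, map_zero]
    · rintro ⟨ψ, a⟩ ⟨ψ', a'⟩ h
      have h' := congrArg Subtype.val h
      obtain rfl : ψ = ψ' := congrArg Prod.fst h'
      refine Prod.ext rfl (LinearMap.ext fun l => ?_)
      obtain ⟨m, rfl⟩ := ψ.2 l
      exact LinearMap.congr_fun (congrArg Prod.snd h') m
    · rintro ⟨⟨ψ, α⟩, h⟩
      obtain ⟨a, ha⟩ := exists_factor ψ.1 ψ.2 α ((hp _).1 h)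
      exact ⟨(ψ, a), Subtype.ext (Prod.ext rfl (LinearMap.ext ha))⟩
  rw [← e2, ← Nat.card_congr e1, ← Nat.card_sum, Nat.card_congr (Equiv.sumCompl p), Nat.card_prod,
    surCountTo]

theorem surCountTo_pow_zero (M : Type*) [AddCommGroup M] [Module R M] (K : FiniteModule R) :
    surCountTo M (K.pow 0) = 1 := by
  have h1 : Unique {f : M →ₗ[R] K.pow 0 // Function.Surjective f} :=
    { default := ⟨0, fun x => ⟨0, Subsingleton.elim (α := PUnit) _ _⟩⟩
      uniq := fun f => Subtype.ext (LinearMap.ext fun x => Subsingleton.elim (α := PUnit) _ _) }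
  exact Nat.card_unique

theorem surCountTo_pow_succ (M : Type*) [AddCommGroup M] [Module R M] [Finite M]
    (K : FiniteModule R) [IsSimpleModule R K] (j : ℕ) :
    (surCountTo M (K.pow (j + 1)) : ℝ) = surCountTo M (K.pow j) *
      ((Nat.card (M →ₗ[R] K) : ℝ) - (Nat.card (K →ₗ[R] K) : ℝ) ^ j) := by
  have h := surCountTo_prod M K (K.pow j)
  rw [card_hom_pow] at h
  have h' : surCountTo M (K.pow (j + 1)) + surCountTo M (K.pow j) * Nat.card (K →ₗ[R] K) ^ j =
    surCountTo M (K.pow j) * Nat.card (M →ₗ[R] K) := h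
  have h2 : (surCountTo M (K.pow (j + 1)) : ℝ) +
      surCountTo M (K.pow j) * (Nat.card (K →ₗ[R] K) : ℝ) ^ j =
    surCountTo M (K.pow j) * (Nat.card (M →ₗ[R] K) : ℝ) := by exact_mod_cast h'
  linarith

theorem surCountTo_pow_eq_prod (M : Type*) [AddCommGroup M] [Module R M] [Finite M]
    (K : FiniteModule R) [IsSimpleModule R K] (j : ℕ) :
    (surCountTo M (K.pow j) : ℝ) = ∏ i ∈ Finset.range j,
      ((Nat.card (M →ₗ[R] K) : ℝ) - (Nat.card (K →ₗ[R] K) : ℝ) ^ i) := by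
  induction j with
  | zero => simp [surCountTo_pow_zero]
  | succ j ih => rw [surCountTo_pow_succ, ih, Finset.prod_range_succ]

theorem two_le_card_end (K : FiniteModule R) [IsSimpleModule R K] :
    (2 : ℝ) ≤ Nat.card (K →ₗ[R] K) := by
  have := IsSimpleModule.nontrivial R K
  have h1 : Finite (K →ₗ[R] K) := DFunLike.finite _
  have h2 : Nontrivial (K →ₗ[R] K) := by
    obtain ⟨x, hx⟩ := exists_ne (0 : K)
    exact ⟨LinearMap.id, 0, fun h => hx (LinearMap.congr_fun h x)⟩
  exact_mod_cast Finite.one_lt_card (α := K →ₗ[R] K)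

end PowerSurjections

/-! ### The moments determine the distribution -/

section Uniqueness

variable {R : Type u} [Ring R]

/-- The number of surjections whose kernel has no nonzero homomorphism to the simple modules
in `T`. -/
noncomputable def freeSurCount (T : Set (SimpleClass R)) (H G : FiniteModule R) : ℕ :=
  Nat.card {φ : H →ₗ[R] G // Function.Surjective φ ∧ HomFree T (LinearMap.ker φ)}

theorem freeSurCount_le (T : Set (SimpleClass R)) (H G : FiniteModule R) :
    freeSurCount T H G ≤ surCount H G := by
  have : Finite (H →ₗ[R] G) := DFunLike.finite _
  exact Nat.card_le_card_of_injective
    (fun φ : {φ : H →ₗ[R] G // Function.Surjective φ ∧ HomFree T (LinearMap.ker φ)} =>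
      (⟨φ.1, φ.2.1⟩ : {f : H →ₗ[R] G // Function.Surjective f}))
    fun φ ψ h => Subtype.ext (Subtype.mk.inj h)

theorem freeSurCount_empty (H G : FiniteModule R) : freeSurCount ∅ H G = surCount H G := by
  refine Nat.card_congr (Equiv.subtypeEquivRight fun φ => ?_)
  simp [HomFree]

/-- The number of pairs of a surjection `φ` as in `freeSurCount` and of a surjection from its kernel
to a power of `L`. -/
noncomputable def freePairCount (T : Set (SimpleClass R)) (L : SimpleClass R) (j : ℕ)
    (H G : FiniteModule R) : ℕ :=
  Nat.card {z : SurPair R H (L.out.pow j) G // HomFree T (LinearMap.ker z.φ)}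

/-- Pairs of surjections as a sigma type. -/
def freePairEquiv (T : Set (SimpleClass R)) (K H G : FiniteModule R) :
    {z : SurPair R H K G // HomFree T (LinearMap.ker z.φ)} ≃
      Σ φ : {φ : H →ₗ[R] G // Function.Surjective φ ∧ HomFree T (LinearMap.ker φ)},
        {ψ : LinearMap.ker φ.1 →ₗ[R] K // Function.Surjective ψ} where
  toFun z := ⟨⟨z.1.φ, z.1.φ_surjective, z.2⟩, z.1.ψ, z.1.ψ_surjective⟩
  invFun x := ⟨⟨x.1.1, x.1.2.1, x.2.1, x.2.2⟩, x.1.2.2⟩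
  left_inv _ := rfl
  right_inv _ := rfl

theorem freePairCount_eq_sum (T : Set (SimpleClass R)) (L : SimpleClass R) (j : ℕ)
    (H G : FiniteModule R)
    [Fintype {φ : H →ₗ[R] G // Function.Surjective φ ∧ HomFree T (LinearMap.ker φ)}] :
    freePairCount T L j H G =
      ∑ φ : {φ : H →ₗ[R] G // Function.Surjective φ ∧ HomFree T (LinearMap.ker φ)},
        surCountTo (LinearMap.ker φ.1) (L.out.pow j) := by
  have : ∀ φ : {φ : H →ₗ[R] G // Function.Surjective φ ∧ HomFree T (LinearMap.ker φ)},
      Finite (LinearMap.ker φ.1 →ₗ[R] L.out.pow j) := fun φ => DFunLike.finite _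
  rw [freePairCount, Nat.card_congr (freePairEquiv T (L.out.pow j) H G), Nat.card_sigma]
  rfl

/-- The condition added by `L` is that the kernel has only the zero homomorphism to `L`, the case `t
= 1` detected by the alternating sums. -/
theorem freeSurCount_insert_eq_sum (T : Set (SimpleClass R)) (L : SimpleClass R)
    (H G : FiniteModule R)
    [Fintype {φ : H →ₗ[R] G // Function.Surjective φ ∧ HomFree T (LinearMap.ker φ)}] :
    (freeSurCount (insert L T) H G : ℝ) =
      ∑ φ : {φ : H →ₗ[R] G // Function.Surjective φ ∧ HomFree T (LinearMap.ker φ)},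
        if (Nat.card (LinearMap.ker φ.1 →ₗ[R] L.out) : ℝ) = 1 then (1 : ℝ) else 0 := by
  classical
  rw [Finset.sum_boole, ← Fintype.card_subtype, ← Nat.card_eq_fintype_card, freeSurCount]
  congr 1
  refine Nat.card_congr ?_
  refine Equiv.trans (Equiv.subtypeEquivRight fun φ => ?_) (Equiv.subtypeSubtypeEquivSubtypeInter
    (fun φ : H →ₗ[R] G => Function.Surjective φ ∧ HomFree T (LinearMap.ker φ))
    (fun φ => (Nat.card (LinearMap.ker φ →ₗ[R] L.out) : ℝ) = 1)).symm
  rw [and_assoc]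
  refine and_congr_right fun _ => ?_
  have hcard : ((Nat.card (LinearMap.ker φ →ₗ[R] L.out) : ℝ) = 1) ↔
      ∀ f : LinearMap.ker φ →ₗ[R] L.out, f = 0 := by
    rw [Nat.cast_eq_one, Nat.card_eq_one_iff_exists]
    exact ⟨fun ⟨x, hx⟩ f => (hx f).trans (hx 0).symm, fun h => ⟨0, h⟩⟩
  rw [hcard]
  constructor
  · exact fun h => ⟨fun K hK => h K (Set.mem_insert_of_mem L hK), h L (Set.mem_insert L T)⟩
  · rintro ⟨h, hL⟩ K (rfl | hK)
    · exact hL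
    · exact h K hK

/-- Bonferroni inequalities for surjections with kernel in a smaller class. -/
theorem abs_freeSurCount_insert_sub_le (T : Set (SimpleClass R)) (L : SimpleClass R)
    (H G : FiniteModule R) (J : ℕ) :
    |(freeSurCount (insert L T) H G : ℝ) - ∑ j ∈ Finset.range (J + 1),
      (-1) ^ j / (∏ i ∈ Finset.range j, ((Nat.card (L.out →ₗ[R] L.out) : ℝ) ^ (i + 1) - 1)) *
        freePairCount T L j H G| ≤
      freePairCount T L J H G /
        ∏ i ∈ Finset.range J, ((Nat.card (L.out →ₗ[R] L.out) : ℝ) ^ (i + 1) - 1) := by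
  have : Finite (H →ₗ[R] G) := DFunLike.finite _
  have := Fintype.ofFinite
    {φ : H →ₗ[R] G // Function.Surjective φ ∧ HomFree T (LinearMap.ker φ)}
  rw [freeSurCount_insert_eq_sum]
  simp_rw [freePairCount_eq_sum, Nat.cast_sum, Finset.mul_sum]
  rw [Finset.sum_comm, ← Finset.sum_sub_distrib, Finset.sum_div]
  refine (Finset.abs_sum_le_sum_abs _ _).trans (Finset.sum_le_sum fun φ _ => ?_)
  refine le_trans (le_of_eq ?_) (abs_sub_alternating_sum_le (two_le_card_end L.out)
    (fun j => surCountTo_pow_eq_prod (LinearMap.ker φ.1) L.out j) (fun j => Nat.cast_nonneg _) J)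
  congr 2
  exact Finset.sum_congr rfl fun j _ => by ring

/-- The two kernels differ by a power of `L`, which is invisible to the modules in `T` since `L ∉
T`. -/
theorem SurPair.homFree_iff (hR : IsDedekindLike R) {T : Set (SimpleClass R)} {L : SimpleClass R}
    (hL : L ∉ T) {j : ℕ} {H G : Type*} [AddCommGroup H] [Module R H] [AddCommGroup G] [Module R G]
    (z : SurPair R H (L.out.pow j) G) :
    HomFree T (LinearMap.ker z.φ) ↔ HomFree T z.kernel := by
  have e : LinearMap.ker z.ψ ≃ₗ[R] z.kernel :=
    Submodule.equivMapOfInjective _ (LinearMap.ker z.φ).injective_subtype _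
  rw [← homFree_congr e]
  exact ⟨fun h => h.ker hR hL (annihilator_le_annihilator_pow L.out j) z.ψ,
    fun h => HomFree.of_ker z.ψ z.ψ_surjective h (homFree_pow hL j)⟩

/-- A pair of surjections, of `H` to `G` and of the kernel to `L^j`, amounts to a surjection of `H`
onto an extension of `G` by `L^j`; the conditions on the kernels match. -/
theorem tsum_freeSurCount_mul_seqCount_div (hR : IsDedekindLike R) {T : Set (SimpleClass R)}
    {L : SimpleClass R} (hL : L ∉ T) (j : ℕ) (H G : FiniteModule R) :
    ∑' E : IsoClass R, (freeSurCount T H E.out : ℝ≥0∞) *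
      ((seqCount (L.out.pow j) E.out G : ℝ≥0∞) / autCount E.out) = freePairCount T L j H G := by
  have hfin : Finite {z : SurPair R H (L.out.pow j) G // HomFree T (LinearMap.ker z.φ)} := by
    have h1 : Finite (H →ₗ[R] G) := DFunLike.finite _
    have h2 : ∀ φ : {φ : H →ₗ[R] G // Function.Surjective φ ∧ HomFree T (LinearMap.ker φ)},
      Finite (LinearMap.ker φ.1 →ₗ[R] L.out.pow j) := fun φ => DFunLike.finite _
    exact Finite.of_equiv _ (freePairEquiv T (L.out.pow j) H G).symm
  rw [freePairCount, ← tsum_card_isInduced_div_autCount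
    (fun z : SurPair R H (L.out.pow j) G => HomFree T (LinearMap.ker z.φ))]
  refine tsum_congr fun E => ?_
  rw [← mul_div_assoc, ← Nat.cast_mul]
  congr 2
  rw [freeSurCount, seqCount, ← Nat.card_prod]
  refine Nat.card_congr
    { toFun := fun x => ⟨(x.1.1, x.2), x.1.2.1, ?_⟩
      invFun := fun y => (⟨y.1.1, y.2.1, ?_⟩, y.1.2)
      left_inv := fun _ => rfl
      right_inv := fun _ => rfl }
  · obtain ⟨z, hz⟩ := exists_isInduced x.1.1 x.1.2.1 x.2
    refine ⟨z, ?_, hz⟩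
    rw [z.homFree_iff hR hL, ← hz.ker_eq]
    exact x.1.2.2
  · obtain ⟨z, hz, hi⟩ := y.2.2
    rw [hi.ker_eq, ← z.homFree_iff hR hL]
    exact hz

/-- The moments of a measure on isomorphism classes, with kernels restricted by `T`. -/
noncomputable def freeMoment (y : IsoClass R → ℝ≥0∞) (T : Set (SimpleClass R))
    (G : FiniteModule R) : ℝ≥0∞ :=
  ∑' H, y H * freeSurCount T H.out G

/-- The pair moments thus depend on `y` only through its `T`-free moments, which drives the
induction on `T`. -/
theorem tsum_mul_freePairCount (hR : IsDedekindLike R) (y : IsoClass R → ℝ≥0∞)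
    {T : Set (SimpleClass R)} {L : SimpleClass R} (hL : L ∉ T) (j : ℕ) (G : FiniteModule R) :
    ∑' H, y H * freePairCount T L j H.out G = ∑' E : IsoClass R,
      ((seqCount (L.out.pow j) E.out G : ℝ≥0∞) / autCount E.out) * freeMoment y T E.out := by
  simp_rw [← tsum_freeSurCount_mul_seqCount_div hR hL, freeMoment, ← ENNReal.tsum_mul_left]
  rw [ENNReal.tsum_comm]
  refine tsum_congr fun E => tsum_congr fun H => ?_
  ring

variable {c : FiniteModule R → ℝ≥0∞}

theorem IsWeight.apply_zero (hc : IsWeight c) (K : FiniteModule R) : c (K.pow 0) = 1 := by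
  have h : ShortExactSeq R (K.pow 0) (K.pow 0) (K.pow 0) :=
    ⟨0, 0, fun x y _ => Subsingleton.elim (α := PUnit) x y,
      fun x => ⟨0, Subsingleton.elim (α := PUnit) _ _⟩,
      fun x => ⟨fun _ => ⟨0, Subsingleton.elim (α := PUnit) _ _⟩, fun _ => rfl⟩⟩
  have h1 := hc.mul h
  have h2 : c (K.pow 0) * 1 = c (K.pow 0) * c (K.pow 0) := by rw [mul_one]; exact h1
  exact ((ENNReal.mul_right_inj (hc.ne_zero _) (hc.ne_top _)).1 h2).symm

theorem IsWeight.apply_pow_le_one (hc : IsWeight c) {K : FiniteModule R} (hK : c K ≤ 1) (j : ℕ) :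
    c (K.pow j) ≤ 1 := by
  induction j with
  | zero => exact (hc.apply_zero K).le
  | succ j ih =>
    have s : ShortExactSeq R K (K.pow (j + 1)) (K.pow j) :=
      ⟨LinearMap.inl R K (K.pow j), LinearMap.snd R K (K.pow j), LinearMap.inl_injective,
        Prod.snd_surjective, fun x => ⟨fun h => ⟨x.1, Prod.ext rfl h.symm⟩, fun ⟨k, h⟩ => by
          rw [← h]
          rfl⟩⟩
    rw [hc.mul s]
    exact mul_le_one' hK ih

/-- Each free moment of an extension `E` of `G` by `L^j` is at most `c E = c (L^j) * c G ≤ c G`, and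
the extensions have total weight 1. The bound is uniform in `j`. -/
theorem tsum_seqCount_mul_freeMoment_le [IsNoetherianRing R] (hR : IsDedekindLike R)
    (hc : IsWeight c) {y : IsoClass R → ℝ≥0∞}
    (hy : ∀ G : FiniteModule R, ∑' H, y H * surCount H.out G = c G) (T : Set (SimpleClass R))
    {L : SimpleClass R} (hcL : c L.out ≤ 1) (j : ℕ) (G : FiniteModule R) :
    ∑' E : IsoClass R, ((seqCount (L.out.pow j) E.out G : ℝ≥0∞) / autCount E.out) *
      freeMoment y T E.out ≤ c G := by
  have hle : ∀ E : IsoClass R, ((seqCount (L.out.pow j) E.out G : ℝ≥0∞) / autCount E.out) *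
      freeMoment y T E.out ≤
        ((seqCount (L.out.pow j) E.out G : ℝ≥0∞) / autCount E.out) * c G := by
    intro E
    rcases isEmpty_or_nonempty (ShortExactSeq R (L.out.pow j) E.out G) with h | ⟨⟨s⟩⟩
    · simp [seqCount]
    · refine mul_le_mul' le_rfl ?_
      calc freeMoment y T E.out ≤ ∑' H, y H * surCount H.out E.out := by
            refine ENNReal.tsum_le_tsum fun H => mul_le_mul' le_rfl ?_
            exact_mod_cast freeSurCount_le T H.out E.out
        _ = c (L.out.pow j) * c G := by rw [hy, hc.mul s]
        _ ≤ 1 * c G := mul_le_mul' (hc.apply_pow_le_one hcL j) le_rfl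
        _ = c G := one_mul _
  refine (ENNReal.tsum_le_tsum hle).trans ?_
  rw [ENNReal.tsum_mul_right, hR.tsum_seqCount_div_autCount_eq_one, one_mul]

theorem summable_toReal_mul {ι : Type*} {y : ι → ℝ≥0∞} {n : ι → ℕ}
    (h : ∑' i, y i * n i ≠ ⊤) : Summable fun i => (y i).toReal * n i := by
  have := ENNReal.summable_toReal h
  simpa [ENNReal.toReal_mul] using this

theorem toReal_tsum_mul {ι : Type*} {y : ι → ℝ≥0∞} {n : ι → ℕ} (hy : ∀ i, y i ≠ ⊤) :
    (∑' i, y i * n i).toReal = ∑' i, (y i).toReal * n i := by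
  rw [ENNReal.tsum_toReal_eq fun i => ENNReal.mul_ne_top (hy i) (ENNReal.natCast_ne_top _)]
  simp [ENNReal.toReal_mul]

theorem freeMoment_ne_top (hc : IsWeight c) {y : IsoClass R → ℝ≥0∞}
    (hy : ∀ G : FiniteModule R, ∑' H, y H * surCount H.out G = c G) (T : Set (SimpleClass R))
    (G : FiniteModule R) : freeMoment y T G ≠ ⊤ := by
  refine ne_top_of_le_ne_top (hc.ne_top G) ?_
  rw [← hy G]
  refine ENNReal.tsum_le_tsum fun H => mul_le_mul' le_rfl ?_
  exact_mod_cast freeSurCount_le T H.out G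

/-- The alternating sums of the moments with kernel surjecting to powers of `L` converge to the
moments with kernel without homomorphisms to `L`. -/
theorem abs_freeMoment_insert_sub_le [IsNoetherianRing R] (hR : IsDedekindLike R)
    (hc : IsWeight c) {y : IsoClass R → ℝ≥0∞} (hyt : ∀ H, y H ≠ ⊤)
    (hy : ∀ G : FiniteModule R, ∑' H, y H * surCount H.out G = c G) {T : Set (SimpleClass R)}
    {L : SimpleClass R} (hL : L ∉ T) (hcL : c L.out ≤ 1) (G : FiniteModule R) (J : ℕ) :
    |(freeMoment y (insert L T) G).toReal - ∑ j ∈ Finset.range (J + 2),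
      (-1) ^ j / (∏ i ∈ Finset.range j, ((Nat.card (L.out →ₗ[R] L.out) : ℝ) ^ (i + 1) - 1)) *
        (∑' H, y H * freePairCount T L j H.out G).toReal| ≤ (c G).toReal / 2 ^ J := by
  have hm : ∀ j, ∑' H, y H * freePairCount T L j H.out G ≤ c G := fun j => by
    rw [tsum_mul_freePairCount hR y hL]
    exact tsum_seqCount_mul_freeMoment_le hR hc hy T hcL j G
  have hm' : ∀ j, ∑' H, y H * freePairCount T L j H.out G ≠ ⊤ := fun j =>
    ne_top_of_le_ne_top (hc.ne_top G) (hm j)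
  have hsum : ∀ j, Summable fun H => (y H).toReal * freePairCount T L j H.out G := fun j =>
    summable_toReal_mul (hm' j)
  have hsum0 : Summable fun H => (y H).toReal * freeSurCount (insert L T) H.out G :=
    summable_toReal_mul (freeMoment_ne_top hc hy _ G)
  set d : ℕ → ℝ := fun j =>
    ∏ i ∈ Finset.range j, ((Nat.card (L.out →ₗ[R] L.out) : ℝ) ^ (i + 1) - 1) with hd
  -- The sums run up to `j = J + 1` so that the error denominator is `d (J + 1)`, which beats `2 ^
  -- J`.
  have hd2 : (2 : ℝ) ^ J ≤ d (J + 1) := two_pow_le_prod (two_le_card_end L.out) J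
  have hd0 : 0 < d (J + 1) := lt_of_lt_of_le (by positivity) hd2
  have hterm : ∀ H : IsoClass R, |(y H).toReal * freeSurCount (insert L T) H.out G -
      ∑ j ∈ Finset.range (J + 2), (-1) ^ j / d j * ((y H).toReal * freePairCount T L j H.out G)| ≤
        (y H).toReal * freePairCount T L (J + 1) H.out G / d (J + 1) := by
    intro H
    have h1 := abs_freeSurCount_insert_sub_le T L H.out G (J + 1)
    have h2 : (y H).toReal * freeSurCount (insert L T) H.out G -
        ∑ j ∈ Finset.range (J + 2), (-1) ^ j / d j *
          ((y H).toReal * freePairCount T L j H.out G) =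
        (y H).toReal * ((freeSurCount (insert L T) H.out G : ℝ) -
          ∑ j ∈ Finset.range (J + 1 + 1), (-1) ^ j / d j * freePairCount T L j H.out G) := by
      rw [mul_sub, Finset.mul_sum]
      congr 1
      exact Finset.sum_congr rfl fun j _ => by ring
    rw [h2, abs_mul, abs_of_nonneg ENNReal.toReal_nonneg, mul_div_assoc]
    exact mul_le_mul_of_nonneg_left h1 ENNReal.toReal_nonneg
  have hsumR : Summable fun H => ∑ j ∈ Finset.range (J + 2),
      (-1) ^ j / d j * ((y H).toReal * freePairCount T L j H.out G) :=
    summable_sum fun j _ => (hsum j).mul_left _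
  have heq : (freeMoment y (insert L T) G).toReal - ∑ j ∈ Finset.range (J + 2),
      (-1) ^ j / d j * (∑' H, y H * freePairCount T L j H.out G).toReal =
      ∑' H, ((y H).toReal * freeSurCount (insert L T) H.out G - ∑ j ∈ Finset.range (J + 2),
        (-1) ^ j / d j * ((y H).toReal * freePairCount T L j H.out G)) := by
    rw [hsum0.tsum_sub hsumR, Summable.tsum_finsetSum fun j _ => (hsum j).mul_left _, freeMoment,
      toReal_tsum_mul hyt]
    congr 1
    refine Finset.sum_congr rfl fun j _ => ?_
    rw [toReal_tsum_mul hyt, tsum_mul_left]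
  rw [heq]
  have hsumB := (hsum (J + 1)).div_const (d (J + 1))
  have habs : Summable fun H => |(y H).toReal * freeSurCount (insert L T) H.out G -
      ∑ j ∈ Finset.range (J + 2), (-1) ^ j / d j *
        ((y H).toReal * freePairCount T L j H.out G)| :=
    Summable.of_nonneg_of_le (fun H => abs_nonneg _) hterm hsumB
  calc _ ≤ ∑' H, |(y H).toReal * freeSurCount (insert L T) H.out G -
      ∑ j ∈ Finset.range (J + 2), (-1) ^ j / d j *
        ((y H).toReal * freePairCount T L j H.out G)| := by
        exact norm_tsum_le_tsum_norm (f := fun H : IsoClass R =>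
          (y H).toReal * freeSurCount (insert L T) H.out G - ∑ j ∈ Finset.range (J + 2),
            (-1) ^ j / d j * ((y H).toReal * freePairCount T L j H.out G)) habs
    _ ≤ ∑' H, (y H).toReal * freePairCount T L (J + 1) H.out G / d (J + 1) :=
        habs.tsum_le_tsum hterm hsumB
    _ = (∑' H, y H * freePairCount T L (J + 1) H.out G).toReal / d (J + 1) := by
        rw [tsum_div_const, toReal_tsum_mul hyt]
    _ ≤ (c G).toReal / 2 ^ J := by
        have := ENNReal.toReal_mono (hc.ne_top G) (hm (J + 1))
        gcongr

/-- The alternating sums for `x` and `y` coincide, and each approximates the corresponding free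
moment up to `c G / 2 ^ J`. -/
theorem freeMoment_insert_eq [IsNoetherianRing R] (hR : IsDedekindLike R)
    (hc : IsWeight c) {x y : IsoClass R → ℝ≥0∞} (hxt : ∀ H, x H ≠ ⊤) (hyt : ∀ H, y H ≠ ⊤)
    (hx : ∀ G : FiniteModule R, ∑' H, x H * surCount H.out G = c G)
    (hy : ∀ G : FiniteModule R, ∑' H, y H * surCount H.out G = c G) {T : Set (SimpleClass R)}
    {L : SimpleClass R} (hL : L ∉ T) (hcL : c L.out ≤ 1)
    (hxy : ∀ G, freeMoment x T G = freeMoment y T G) (G : FiniteModule R) :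
    freeMoment x (insert L T) G = freeMoment y (insert L T) G := by
  rw [← ENNReal.toReal_eq_toReal_iff' (freeMoment_ne_top hc hx _ G) (freeMoment_ne_top hc hy _ G)]
  have hlim : Filter.Tendsto (fun J : ℕ => (c G).toReal / 2 ^ J + (c G).toReal / 2 ^ J)
      Filter.atTop (nhds 0) := by
    have h1 : Filter.Tendsto (fun J : ℕ => (c G).toReal / (2 : ℝ) ^ J) Filter.atTop (nhds 0) :=
      tendsto_const_nhds.div_atTop (tendsto_pow_atTop_atTop_of_one_lt one_lt_two)
    simpa using h1.add h1
  have hle : ∀ J : ℕ, |(freeMoment x (insert L T) G).toReal -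
      (freeMoment y (insert L T) G).toReal| ≤ (c G).toReal / 2 ^ J + (c G).toReal / 2 ^ J := by
    intro J
    have h1 := abs_freeMoment_insert_sub_le hR hc hxt hx hL hcL G J
    have h2 := abs_freeMoment_insert_sub_le hR hc hyt hy hL hcL G J
    simp_rw [tsum_mul_freePairCount hR _ hL] at h1 h2
    simp_rw [hxy] at h1
    rw [abs_sub_comm] at h2
    exact (abs_sub_le _ _ _).trans (add_le_add h1 h2)
  have := ge_of_tendsto' hlim hle
  exact sub_eq_zero.1 (abs_nonpos_iff.1 this)

/-- For large `T`, only the isomorphisms have a kernel without homomorphisms to the modules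
in `T`. -/
theorem exists_finset_freeSurCount_eq [DecidableEq (IsoClass R)] (H G : IsoClass R) :
    ∃ T₀ : Finset (SimpleClass R), ∀ T : Finset (SimpleClass R), T₀ ≤ T →
      freeSurCount (T : Set (SimpleClass R)) H.out G.out = if H = G then autCount H.out else 0 := by
  classical
  have : Finite (H.out →ₗ[R] G.out) := DFunLike.finite _
  have := Fintype.ofFinite (H.out →ₗ[R] G.out)
  -- A map with nonzero kernel is excluded as soon as `T` contains one simple quotient of this
  -- kernel, and there are finitely many maps.
  have hex : ∀ φ : H.out →ₗ[R] G.out, ∃ T₀ : Finset (SimpleClass R),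
      HomFree (T₀ : Set (SimpleClass R)) (LinearMap.ker φ) → Function.Injective φ := by
    intro φ
    by_cases hφ : Function.Injective φ
    · exact ⟨∅, fun _ => hφ⟩
    · have : Nontrivial (LinearMap.ker φ) := by
        rw [Submodule.nontrivial_iff_ne_bot]
        exact fun h => hφ (LinearMap.ker_eq_bot.1 h)
      have e := FiniteModule.ofFiniteEquiv (R := R) (LinearMap.ker φ)
      have := e.toEquiv.nontrivial
      obtain ⟨L, f, hf⟩ := exists_simpleClass_surjective
        (FiniteModule.ofFinite (R := R) (LinearMap.ker φ))
      refine ⟨{L}, fun h => absurd ?_ (SimpleClass.ne_zero_of_surjective hf)⟩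
      ext x
      simpa using LinearMap.congr_fun (h L (by simp) (f.comp e.symm.toLinearMap)) (e x)
  choose T₀ hT₀ using hex
  refine ⟨Finset.univ.biUnion T₀, fun T hT => ?_⟩
  have hinj : ∀ φ : H.out →ₗ[R] G.out, HomFree (T : Set (SimpleClass R)) (LinearMap.ker φ) ↔
      Function.Injective φ := by
    intro φ
    refine ⟨fun h => hT₀ φ fun L hL f => h L ?_ f, fun h L _ f => ?_⟩
    · exact hT (Finset.mem_biUnion.2 ⟨φ, Finset.mem_univ _, hL⟩)
    · ext x
      have : x = 0 := Subtype.ext (h (by rw [x.2, ZeroMemClass.coe_zero, map_zero]))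
      rw [this, map_zero, map_zero]
  split_ifs with hHG
  · subst hHG
    refine Nat.card_congr ⟨fun φ => LinearEquiv.ofBijective φ.1 ⟨(hinj _).1 φ.2.2, φ.2.1⟩,
      fun a => ⟨a.toLinearMap, a.surjective, (hinj _).2 a.injective⟩, fun φ => ?_, fun a => ?_⟩
    · ext; rfl
    · ext; rfl
  · rw [freeSurCount]
    have : IsEmpty {φ : H.out →ₗ[R] G.out // Function.Surjective φ ∧
        HomFree (T : Set (SimpleClass R)) (LinearMap.ker φ)} := by
      refine ⟨fun φ => hHG ?_⟩
      have := IsoClass.iso_out_iff.1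
        ⟨LinearEquiv.ofBijective φ.1 ⟨(hinj _).1 φ.2.2, φ.2.1⟩⟩
      rwa [G.toClass_out] at this
    exact Nat.card_of_isEmpty

/-- The limit of the moments for growing sets of simple modules. -/
theorem tendsto_freeMoment (hc : IsWeight c) {y : IsoClass R → ℝ≥0∞} (hyt : ∀ H, y H ≠ ⊤)
    (hy : ∀ G : FiniteModule R, ∑' H, y H * surCount H.out G = c G) (G : IsoClass R) :
    Filter.Tendsto (fun T : Finset (SimpleClass R) => (freeMoment y T G.out).toReal) Filter.atTop
      (nhds ((y G).toReal * autCount G.out)) := by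
  classical
  have hsumm : Summable fun H => (y H).toReal * surCount H.out G.out :=
    summable_toReal_mul (by rw [hy]; exact hc.ne_top _)
  have hlim : (y G).toReal * autCount G.out =
      ∑' H : IsoClass R, if H = G then (y H).toReal * autCount H.out else 0 :=
    (tsum_ite_eq G fun H : IsoClass R => (y H).toReal * (autCount H.out : ℝ)).symm
  rw [hlim]
  simp_rw [freeMoment, toReal_tsum_mul hyt]
  -- Each term is eventually constant in `T`, and all are dominated by the terms of the surjection
  -- moment.
  refine tendsto_tsum_of_dominated_convergence hsumm (fun H => ?_)
    (Filter.Eventually.of_forall fun T H => ?_)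
  · obtain ⟨T₀, hT₀⟩ := exists_finset_freeSurCount_eq H G
    refine tendsto_const_nhds.congr' ?_
    filter_upwards [Filter.eventually_ge_atTop T₀] with T hT
    rw [hT₀ T hT]
    split_ifs <;> simp
  · rw [Real.norm_eq_abs, abs_of_nonneg (by positivity)]
    gcongr
    exact freeSurCount_le _ _ _

theorem HasDecay.le_one (hd : HasDecay c) (K : SimpleClass R) : c K.out ≤ 1 := by
  obtain ⟨ε, hε, h⟩ := hd
  refine (h K.out K.2).trans (ENNReal.ofReal_le_one.2 ?_)
  have h1 : (1 : ℝ) ≤ Nat.card K.out := by exact_mod_cast Nat.card_pos (α := K.out)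
  exact Real.rpow_le_one_of_one_le_of_nonpos h1 (by linarith)

/-- The moments determine the distribution. -/
theorem eq_of_moments_eq [IsNoetherianRing R] (hR : IsDedekindLike R) (hc : IsWeight c)
    (hd : HasDecay c) {x y : IsoClass R → ℝ≥0∞} (hxt : ∀ H, x H ≠ ⊤) (hyt : ∀ H, y H ≠ ⊤)
    (hx : ∀ G : FiniteModule R, ∑' H, x H * surCount H.out G = c G)
    (hy : ∀ G : FiniteModule R, ∑' H, y H * surCount H.out G = c G) : x = y := by
  classical
  have hfree : ∀ (T : Finset (SimpleClass R)) (G : FiniteModule R),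
      freeMoment x T G = freeMoment y T G := by
    intro T
    induction T using Finset.induction_on with
    | empty =>
      intro G
      simp_rw [freeMoment, Finset.coe_empty, freeSurCount_empty, hx, hy]
    | insert L T hL ih =>
      intro G
      rw [Finset.coe_insert]
      exact freeMoment_insert_eq hR hc hxt hyt hx hy (by simpa using hL) (hd.le_one L) ih G
  funext E
  have h1 := tendsto_freeMoment hc hxt hx E
  simp_rw [hfree] at h1
  have h2 := tendsto_nhds_unique h1 (tendsto_freeMoment hc hyt hy E)
  have h3 : (autCount E.out : ℝ) ≠ 0 := by exact_mod_cast (autCount_pos E.out).ne'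
  exact (ENNReal.toReal_eq_toReal_iff' (hxt E) (hyt E)).1 (mul_right_cancel₀ h3 h2)

end Uniqueness

/-! ### Multiplicativity of the parts `a G` cut out by an idempotent -/

section Components

variable {R : Type u} [Ring R]

theorem natCard_component_pos (a : R) (G : FiniteModule R) : 0 < Nat.card (component a G) := by
  have : Nonempty (component a G) := ⟨⟨a • 0, 0, rfl⟩⟩
  exact Nat.card_pos

theorem mem_component_iff {a : R} (ha : IsIdempotentElem a) {G : FiniteModule R} {x : G} :
    x ∈ component a G ↔ a • x = x := by
  refine ⟨?_, fun h => ⟨x, h⟩⟩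
  rintro ⟨y, rfl⟩
  change a • a • y = a • y
  rw [← mul_smul, ha.eq]

/-- The parts of finite modules cut out by an idempotent have multiplicative orders. -/
theorem ShortExactSeq.natCard_component {K E G : FiniteModule R} (s : ShortExactSeq R K E G)
    {a : R} (ha : IsIdempotentElem a) :
    Nat.card (component a E) = Nat.card (component a K) * Nat.card (component a G) := by
  let p (M : FiniteModule R) : AddSubgroup M := (DistribSMul.toAddMonoidHom M a).range
  have hp : ∀ (M : FiniteModule R) (x : M), x ∈ p M ↔ a • x = x := fun M x =>
    mem_component_iff ha
  let φ : p E →+ p G := ((s.proj.toAddMonoidHom).comp (p E).subtype).codRestrict (p G) fun x => by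
    rw [hp]
    change a • s.proj (x : E) = s.proj (x : E)
    rw [← map_smul, (hp E x).1 x.2]
  have hφ : Function.Surjective φ := by
    intro y
    obtain ⟨x, hx⟩ := s.proj_surjective y
    refine ⟨⟨a • x, x, rfl⟩, Subtype.ext ?_⟩
    change s.proj (a • x) = y
    rw [map_smul, hx, (hp G y).1 y.2]
  have hker : Nat.card φ.ker = Nat.card (p K) := by
    symm
    refine Nat.card_congr (Equiv.ofBijective (fun k => ⟨⟨s.inc k, ?_⟩, ?_⟩) ⟨?_, ?_⟩)
    · rw [hp, ← map_smul, (hp K k).1 k.2]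
    · exact Subtype.ext ((s.exact _).2 ⟨k, rfl⟩)
    · intro k l h
      exact Subtype.ext (s.inc_injective (congrArg (fun z => ((z : φ.ker) : p E).1) h))
    · rintro ⟨⟨x, hx⟩, h⟩
      obtain ⟨k, rfl⟩ := (s.exact x).1 (congrArg Subtype.val h)
      refine ⟨⟨k, (hp K k).2 (s.inc_injective ?_)⟩, rfl⟩
      rw [map_smul, (hp E _).1 hx]
  have := natCard_eq_ker_mul φ hφ
  rw [hker] at this
  exact this

end Components

/-! ### The weight `1 / |G|^u` and its decay -/

section CardPow

variable {A : Type u} [Ring A] [Algebra ℚ A] {S : Set Nat.Primes} {O : Subalgebra (ZS S) A}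
  (hO : IsMaximalOrder S O) {m : ℕ} {e : Fin m → A} (he : IsIdempotentList e)

theorem isIdempotentElem_idem (i : Fin m) : IsIdempotentElem (idem hO he i) :=
  Subtype.ext ((he.mem_range_iff (e i)).1 ⟨i, rfl⟩).1.1

theorem cardPow_pos (u : Fin m → ℚ) (G : FiniteModule O) : 0 < cardPow hO he u G :=
  Finset.prod_pos fun i _ => Real.rpow_pos_of_pos
    (by exact_mod_cast natCard_component_pos (idem hO he i) G) _

theorem ShortExactSeq.cardPow_eq (u : Fin m → ℚ) {K E G : FiniteModule O}
    (s : ShortExactSeq O K E G) :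
    cardPow hO he u E = cardPow hO he u K * cardPow hO he u G := by
  rw [cardPow, cardPow, cardPow, ← Finset.prod_mul_distrib]
  refine Finset.prod_congr rfl fun i _ => ?_
  rw [s.natCard_component (isIdempotentElem_idem hO he i), Nat.cast_mul,
    Real.mul_rpow (Nat.cast_nonneg _) (Nat.cast_nonneg _)]

/-- The weight `G ↦ |G|^{-u}`. -/
noncomputable def invCardPow (u : Fin m → ℚ) (G : FiniteModule O) : ℝ≥0∞ :=
  ENNReal.ofReal (1 / cardPow hO he u G)

theorem isWeight_invCardPow (u : Fin m → ℚ) : IsWeight (invCardPow hO he u) where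
  mul s := by
    have h1 := (cardPow_pos hO he u)
    rw [invCardPow, invCardPow, invCardPow, ← ENNReal.ofReal_mul (one_div_nonneg.2 (h1 _).le),
      s.cardPow_eq hO he u, one_div_mul_one_div]
  ne_zero G := (ENNReal.ofReal_pos.2 (one_div_pos.2 (cardPow_pos hO he u G))).ne'
  ne_top _ := ENNReal.ofReal_ne_top

theorem cardPow_congr (u : Fin m → ℚ) {G H : FiniteModule O} (f : G ≃ₗ[O] H) :
    cardPow hO he u G = cardPow hO he u H := by
  refine Finset.prod_congr rfl fun i _ => ?_
  congr 2
  refine Nat.card_congr (f.toEquiv.subtypeEquiv fun x => ?_)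
  change x ∈ component _ G ↔ f x ∈ component _ H
  rw [mem_component_iff (isIdempotentElem_idem hO he i),
    mem_component_iff (isIdempotentElem_idem hO he i), ← map_smul, f.injective.eq_iff]

/-- Some irreducible central idempotent acts as a nonzero map on a nonzero module. -/
theorem exists_idem_smul_ne_zero [IsArtinianRing A] (K : FiniteModule O) [Nontrivial K] :
    ∃ (i : Fin m) (x : K), idem hO he i • x ≠ 0 := by
  -- Among the central idempotents `f` that act nontrivially on `K`, choose one with `A f` minimal.
  -- If `f = g + h` orthogonally and `g` acts nontrivially on the chosen `x`, minimality gives `A f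
  -- = A g` and so `h = 0`; hence `f` is irreducible.
  let D : Set (Ideal A) := {I | ∃ (f : A) (hf : IsCentralIdempotent f), I = Ideal.span {f} ∧
    ∃ x : K, (⟨f, hO.mem_of_isCentralIdempotent hf⟩ : O) • x ≠ 0}
  have hD : D.Nonempty := by
    have h1 : IsCentralIdempotent (1 : A) := ⟨IsIdempotentElem.one, Set.one_mem_center⟩
    obtain ⟨x, hx⟩ := exists_ne (0 : K)
    refine ⟨_, 1, h1, rfl, x, ?_⟩
    change (1 : O) • x ≠ 0
    rwa [one_smul]
  obtain ⟨I, ⟨f, hf, rfl, x, hx⟩, hmin⟩ := WellFounded.has_min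
    (IsWellFounded.wf : WellFounded (α := Ideal A) (· < ·)) D hD
  have key : ∀ g h : A, IsCentralIdempotent g → IsCentralIdempotent h → g * h = 0 → f = g + h →
      ∀ hg : IsCentralIdempotent g,
      (⟨g, hO.mem_of_isCentralIdempotent hg⟩ : O) • x ≠ 0 → h = 0 := by
    rintro g h - hh hgh rfl hg hx'
    have hhg : h * g = 0 := by rw [((Set.mem_center_iff.1 hh.2).comm g).eq, hgh]
    have hle : Ideal.span {g} ≤ Ideal.span {g + h} := by
      rw [Ideal.span_singleton_le_iff_mem, Ideal.mem_span_singleton']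
      exact ⟨g, by rw [mul_add, hgh, add_zero, hg.1.eq]⟩
    have hle' : Ideal.span {g + h} ≤ Ideal.span {g} := by
      by_contra hlt
      exact hmin _ ⟨g, hg, rfl, x, hx'⟩ (lt_of_le_not_ge hle hlt)
    rw [Ideal.span_singleton_le_iff_mem, Ideal.mem_span_singleton'] at hle'
    obtain ⟨a, ha⟩ := hle'
    calc h = h * (g + h) * h := by rw [mul_add, hhg, zero_add, hh.1.eq, hh.1.eq]
      _ = 0 := by rw [← ha, mul_assoc, mul_assoc, hgh, mul_zero, mul_zero]
  have hirr : IsIrreducibleCentralIdempotent f := by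
    refine ⟨hf, ?_, fun g h hg hh hgh hfgh => ?_⟩
    · rintro rfl
      exact hx (zero_smul O x)
    · by_cases hgx : (⟨g, hO.mem_of_isCentralIdempotent hg⟩ : O) • x = 0
      · left
        have hhg : h * g = 0 := by rw [((Set.mem_center_iff.1 hh.2).comm g).eq, hgh]
        refine key h g hh hg hhg (hfgh.trans (add_comm g h)) hh fun hhx => hx ?_
        have : (⟨f, hO.mem_of_isCentralIdempotent hf⟩ : O) =
            ⟨g, hO.mem_of_isCentralIdempotent hg⟩ + ⟨h, hO.mem_of_isCentralIdempotent hh⟩ :=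
          Subtype.ext hfgh
        rw [this, add_smul, hgx, hhx, add_zero]
      · exact Or.inr (key g h hg hh hgh hfgh hg hgx)
  obtain ⟨i, rfl⟩ := (he.mem_range_iff f).2 hirr
  exact ⟨i, x, hx⟩

/-- Some irreducible central idempotent acts as the identity on a simple module. -/
theorem exists_component_eq_univ [IsArtinianRing A] (K : FiniteModule O) [IsSimpleModule O K] :
    ∃ i : Fin m, component (idem hO he i) K = Set.univ := by
  have := IsSimpleModule.nontrivial O K
  obtain ⟨i, x, hx⟩ := exists_idem_smul_ne_zero hO he K
  have hc : ∀ b : O, idem hO he i * b = b * idem hO he i := fun b => Subtype.ext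
    ((Set.mem_center_iff.1 ((he.mem_range_iff (e i)).1 ⟨i, rfl⟩).1.2).comm (b : A)).eq
  let φ : K →ₗ[O] K :=
    { toFun := fun y => idem hO he i • y
      map_add' := smul_add _
      map_smul' := fun b y => by rw [RingHom.id_apply, ← mul_smul, ← mul_smul, hc] }
  have hφ : φ ≠ 0 := fun h => hx (LinearMap.congr_fun h x)
  exact ⟨i, Set.range_eq_univ.2 (LinearMap.surjective_of_ne_zero hφ)⟩

theorem hasDecay_invCardPow [IsArtinianRing A] {u : Fin m → ℚ} (hu : ∀ i, 0 < u i) :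
    HasDecay (invCardPow hO he u) := by
  classical
  -- The decay exponent is the least of the `u i`; the value 1 for an empty list is arbitrary.
  obtain ⟨ε, hε, hεu⟩ : ∃ ε : ℝ, 0 < ε ∧ ∀ i, ε ≤ u i := by
    rcases isEmpty_or_nonempty (Fin m) with h | h
    · exact ⟨1, one_pos, fun i => h.elim i⟩
    · obtain ⟨i, hi⟩ := Finite.exists_min u
      exact ⟨u i, by exact_mod_cast hu i, fun j => by exact_mod_cast hi j⟩
  refine ⟨ε, hε, fun K hK => ENNReal.ofReal_le_ofReal ?_⟩
  obtain ⟨i, hi⟩ := exists_component_eq_univ hO he K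
  have hK1 : (1 : ℝ) ≤ Nat.card K := by exact_mod_cast Nat.card_pos (α := K)
  rw [Real.rpow_neg (by positivity), one_div]
  refine inv_anti₀ (Real.rpow_pos_of_pos (by linarith) _) ?_
  calc (Nat.card K : ℝ) ^ ε = ∏ j, if j = i then (Nat.card K : ℝ) ^ ε else 1 := by
        rw [Finset.prod_ite_eq' Finset.univ i, if_pos (Finset.mem_univ i)]
    _ ≤ cardPow hO he u K := by
        refine Finset.prod_le_prod (fun j _ => by split_ifs <;> positivity) fun j _ => ?_
        split_ifs with h
        · subst h
          rw [hi, Nat.card_univ]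
          exact Real.rpow_le_rpow_of_exponent_le hK1 (hεu j)
        · refine Real.one_le_rpow ?_ (by exact_mod_cast (hu j).le)
          exact_mod_cast natCard_component_pos (idem hO he j) K

end CardPow

/-! ### Random modules as measures on isomorphism classes -/

section RandomModules

variable {R : Type u} [Ring R] {Ω : Type*}

theorem setOf_iso_eq (X : Ω → FiniteModule R) (G : FiniteModule R) :
    {ω | Iso (X ω) G} = {ω | (X ω).toClass = G.toClass} := by
  simp_rw [FiniteModule.toClass_eq_iff]

variable [MeasurableSpace Ω]

theorem IsRandomModule.lintegral_toClass [Countable (IsoClass R)] {X : Ω → FiniteModule R}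
    (hX : IsRandomModule X) (P : Measure Ω) (f : IsoClass R → ℝ≥0∞) :
    ∫⁻ ω, f (X ω).toClass ∂P = ∑' E : IsoClass R, P {ω | Iso (X ω) E.out} * f E := by
  let _ : MeasurableSpace (IsoClass R) := ⊤
  have hm : Measurable fun ω => (X ω).toClass := measurable_to_countable' fun E => by
    have := hX E.out
    rw [setOf_iso_eq, E.toClass_out] at this
    exact this
  rw [← lintegral_map (f := f) measurable_from_top hm, lintegral_countable']
  refine tsum_congr fun E => ?_
  rw [Measure.map_apply hm (measurableSet_singleton E), mul_comm, setOf_iso_eq, E.toClass_out]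
  rfl

theorem IsRandomModule.surMoment_eq [Countable (IsoClass R)] {X : Ω → FiniteModule R}
    (hX : IsRandomModule X) (P : Measure Ω) (G : FiniteModule R) :
    surMoment P X G = ∑' E : IsoClass R, P {ω | Iso (X ω) E.out} * surCount E.out G := by
  rw [← hX.lintegral_toClass P fun E => (surCount E.out G : ℝ≥0∞), surMoment]
  refine lintegral_congr fun ω => ?_
  obtain ⟨s⟩ := (X ω).iso_out
  rw [surCount_congr s (LinearEquiv.refl R G)]

theorem IsRandomModule.tsum_measure_iso [Countable (IsoClass R)] {X : Ω → FiniteModule R}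
    (hX : IsRandomModule X) (P : Measure Ω) [IsProbabilityMeasure P] :
    ∑' E : IsoClass R, P {ω | Iso (X ω) E.out} = 1 := by
  have := hX.lintegral_toClass P fun _ => 1
  simpa using this.symm

theorem probIso_eq_toReal (P : Measure Ω) (X : Ω → FiniteModule R) (G : FiniteModule R) :
    probIso P X G = (P {ω | Iso (X ω) G.toClass.out}).toReal := by
  rw [probIso, Measure.real, setOf_iso_eq, setOf_iso_eq, IsoClass.toClass_out]

end RandomModules

/-! ### Existence and moments of the random module -/

section CohenMartinetModules

variable {A : Type u} [Ring A] [Algebra ℚ A] {S : Set Nat.Primes} {O : Subalgebra (ZS S) A}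
  {hO : IsMaximalOrder S O} {m : ℕ} {e : Fin m → A} {he : IsIdempotentList e} {u : Fin m → ℚ}

theorem mass_invCardPow (E : IsoClass O) : mass (invCardPow hO he u) E =
    ENNReal.ofReal (1 / (cardPow hO he u E.out * autCount E.out)) := by
  have h : (0 : ℝ) < autCount E.out := by exact_mod_cast autCount_pos E.out
  rw [mass, invCardPow, ← ENNReal.ofReal_natCast, ← ENNReal.ofReal_div_of_pos h, div_div]

theorem cardPow_mul_autCount_pos (G : FiniteModule O) :
    0 < cardPow hO he u G * autCount G :=
  mul_pos (cardPow_pos hO he u G) (by exact_mod_cast autCount_pos G)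

/-- The probabilities of a random module `X(A, u, O)` are proportional to the masses. -/
theorem IsCohenMartinetModule.exists_measure_eq {Ω : Type*} [MeasurableSpace Ω] {P : Measure Ω}
    {X : Ω → FiniteModule O} (h : IsCohenMartinetModule hO he u P X) :
    ∃ a : ℝ≥0∞, ∀ E : IsoClass O,
      P {ω | Iso (X ω) E.out} = a * mass (invCardPow hO he u) E := by
  have := h.1
  let G₀ := (zeroClass O).out
  refine ⟨ENNReal.ofReal (probIso P X G₀ * (cardPow hO he u G₀ * autCount G₀)), fun E => ?_⟩
  have h1 := h.2.2 E.out G₀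
  have hE : 0 < cardPow hO he u E.out * autCount E.out := cardPow_mul_autCount_pos _
  have h0 : 0 < cardPow hO he u G₀ * autCount G₀ := cardPow_mul_autCount_pos _
  -- Division by zero gives 0, whereas the prescribed ratio is positive.
  have hne : probIso P X G₀ ≠ 0 := fun h2 => by
    rw [h2, div_zero] at h1
    exact (div_pos h0 hE).ne h1
  have hnn : 0 ≤ probIso P X G₀ := measureReal_nonneg
  rw [mass_invCardPow, ← ENNReal.ofReal_mul (mul_nonneg hnn h0.le), mul_one_div, mul_div_assoc,
    ← h1, mul_div_cancel₀ _ hne, probIso, ofReal_measureReal]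

/-- The proportionality factor `a` times the total mass is 1, as the probabilities sum to 1. -/
theorem IsCohenMartinetModule.surMoment_eq [IsNoetherianRing O] [Countable (IsoClass O)]
    {Ω : Type*} [MeasurableSpace Ω] {P : Measure Ω} {X : Ω → FiniteModule O}
    (h : IsCohenMartinetModule hO he u P X) (G : FiniteModule O) :
    surMoment P X G = invCardPow hO he u G := by
  have := h.1
  obtain ⟨a, ha⟩ := h.exists_measure_eq
  have h1 := h.2.1.tsum_measure_iso P
  simp_rw [ha, ENNReal.tsum_mul_left] at h1
  rw [h.2.1.surMoment_eq]
  simp_rw [ha, mul_assoc]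
  rw [ENNReal.tsum_mul_left,
    (isWeight_invCardPow hO he u).tsum_mass_mul_surCount hO.isDedekindLike, mul_left_comm, h1,
    mul_one]

theorem exists_isCohenMartinetModule [Countable (IsoClass O)]
    (ht : ∑' E, mass (invCardPow hO he u) E ≠ ⊤) :
    ∃ (Ω : Type) (_ : MeasurableSpace Ω) (P : Measure Ω) (X : Ω → FiniteModule O),
      IsCohenMartinetModule hO he u P X := by
  have hw := isWeight_invCardPow hO he u
  -- Countability allows a copy of the set of classes in `Type`; this copy, with the normalized
  -- masses, is the probability space.
  let s : IsoClass O ≃ Shrink.{0} (IsoClass O) := equivShrink _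
  let f : Shrink.{0} (IsoClass O) → ℝ≥0∞ := fun ω => mass (invCardPow hO he u) (s.symm ω)
  have hf : ∑' ω, f ω = ∑' E, mass (invCardPow hO he u) E :=
    s.symm.tsum_eq (mass (invCardPow hO he u))
  have hf0 : ∑' ω, f ω ≠ 0 := fun h =>
    hw.mass_ne_zero _ (ENNReal.tsum_eq_zero.1 h (s (zeroClass O)))
  let p : PMF (Shrink.{0} (IsoClass O)) := PMF.normalize f hf0 (hf ▸ ht)
  let X : Shrink.{0} (IsoClass O) → FiniteModule O := fun ω => (s.symm ω).out
  let _ : MeasurableSpace (Shrink.{0} (IsoClass O)) := ⊤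
  refine ⟨_, ⊤, p.toMeasure, X, inferInstance, fun G => trivial, fun G₁ G₂ => ?_⟩
  have hset : ∀ G : FiniteModule O, {ω | Iso (X ω) G} = {s G.toClass} := by
    intro G
    ext ω
    simp only [X, Set.mem_ofPred_eq, Set.mem_singleton_iff, IsoClass.iso_out_iff]
    exact s.symm_apply_eq
  have hM : 0 < (∑' ω, f ω).toReal := ENNReal.toReal_pos hf0 (hf ▸ ht)
  have hprob : ∀ G : FiniteModule O, probIso p.toMeasure X G =
      1 / (cardPow hO he u G * autCount G) * ((∑' ω, f ω).toReal)⁻¹ := by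
    intro G
    obtain ⟨t⟩ := G.iso_out
    have h1 : f (s G.toClass) = ENNReal.ofReal (1 / (cardPow hO he u G * autCount G)) := by
      simp only [f, s.symm_apply_apply]
      rw [mass_invCardPow, cardPow_congr hO he u t, autCount_congr t]
    rw [probIso, hset, Measure.real, PMF.toMeasure_apply_singleton _ _ (measurableSet_singleton _),
      PMF.normalize_apply, ENNReal.toReal_mul, h1, ENNReal.toReal_inv,
      ENNReal.toReal_ofReal (one_div_nonneg.2 (cardPow_mul_autCount_pos G).le)]
  rw [hprob, hprob]
  have h1 : 0 < cardPow hO he u G₁ * autCount G₁ := cardPow_mul_autCount_pos _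
  have h2 : 0 < cardPow hO he u G₂ * autCount G₂ := cardPow_mul_autCount_pos _
  rw [mul_div_mul_right _ _ (inv_pos.2 hM).ne', one_div, one_div, inv_div_inv]

end CohenMartinetModules

end CohenMartinet

/-! ### The theorem -/

theorem theoremT {A : Type*} [Ring A] [Algebra ℚ A] [Module.Finite ℚ A]
    [IsSemisimpleRing A] (S : Set Nat.Primes) (hS : S.Infinite)
    (O : Subalgebra (CohenMartinet.ZS S) A) (hO : CohenMartinet.IsMaximalOrder S O)
    {m : ℕ} (e : Fin m → A) (he : CohenMartinet.IsIdempotentList e)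
    (u : Fin m → ℚ) (hu : ∀ i, 0 < u i) :
    (∃ (Ω : Type) (_ : MeasurableSpace Ω) (P : Measure Ω)
        (X : Ω → CohenMartinet.FiniteModule O),
        CohenMartinet.IsCohenMartinetModule hO he u P X) ∧
      ∀ (Ω : Type*) [MeasurableSpace Ω] (P : Measure Ω) (X : Ω → CohenMartinet.FiniteModule O),
        CohenMartinet.IsCohenMartinetModule hO he u P X →
        (∀ G : CohenMartinet.FiniteModule O,
          CohenMartinet.surMoment P X G =
            ENNReal.ofReal (1 / CohenMartinet.cardPow hO he u G)) ∧
        ∀ (Ω' : Type*) [MeasurableSpace Ω'] (P' : Measure Ω') [IsProbabilityMeasure P']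
          (Y : Ω' → CohenMartinet.FiniteModule O), CohenMartinet.IsRandomModule Y →
          (∀ G : CohenMartinet.FiniteModule O,
            CohenMartinet.surMoment P' Y G =
              ENNReal.ofReal (1 / CohenMartinet.cardPow hO he u G)) →
          ∀ G : CohenMartinet.FiniteModule O,
            CohenMartinet.probIso P' Y G = CohenMartinet.probIso P X G := by
  have hd := CohenMartinet.hasDecay_invCardPow hO he hu
  have hw := CohenMartinet.isWeight_invCardPow hO he u
  have hR := hO.isDedekindLike
  have := CohenMartinet.IsOrderOver.isNoetherianRing hO.prop
  have := CohenMartinet.countable_isoClass hR hw hd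
  refine ⟨CohenMartinet.exists_isCohenMartinetModule
    (CohenMartinet.tsum_mass_ne_top hR hw hd), ?_⟩
  intro Ω _ P X hX
  refine ⟨hX.surMoment_eq, ?_⟩
  intro Ω' _ P' _ Y hY hmoments G
  have := hX.1
  have heq := CohenMartinet.eq_of_moments_eq hR hw hd
    (x := fun E => P' {ω | CohenMartinet.Iso (Y ω) E.out})
    (y := fun E => P {ω | CohenMartinet.Iso (X ω) E.out})
    (fun _ => measure_ne_top _ _) (fun _ => measure_ne_top _ _)
    (fun H => (hY.surMoment_eq P' H).symm.trans (hmoments H))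
    (fun H => (hX.2.1.surMoment_eq P H).symm.trans (hX.surMoment_eq H))
  rw [CohenMartinet.probIso_eq_toReal, CohenMartinet.probIso_eq_toReal]
  exact congrArg ENNReal.toReal (congrFun heq G.toClass)
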